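/- Let $\mathcal O\subset\mathbb R^3$ be a bounded open set with smooth boundary such that $M=\partial\mathcal O$ is connected, invariant under all rotations about the $x_3$-axis, and has positive Gauss curvature everywhere. Let $\nu$ be the outward unit normal of $M$, $\chi=e_3\cdot\nu$, $J:T_xM\to T_xM$, $Jv=\nu(x)\times v$ the counterclockwise rotation by $90^\circ$, and $X_3=(-x_2,x_1,0)$ the vector field on $M$ generating the rotations about the $x_3$-axis. For $\Omega\in\mathbb R$ consider the Euler equation for tangent vector fields $u(t)$ on $M$: $$\frac{\partial u}{\partial t}+\nabla_u u=\Omega\,\chi\,Ju-\nabla p,\qquad \operatorname{div}u=0, \tag{1}$$ where $\nabla$ is the Levi-Civita connection (respectively the gradient) of the induced metric. (a) If $f\in C^\infty(M)$ is zonal, that is, $X_3f=0$, then for every $\Omega\in\mathbb R$ the time-independent field $u=J\nabla f$ is a (smooth) stationary solution of (1), with a smooth pressure $p$. (b) Let $V$ be the space of square-integrable tangent vector fields $u$ on $M$ (equivalently, of square-integrable 1-forms) with $\operatorname{div}u=0$ weakly, i.e. $\int_M\langle u,\nabla\varphi\rangle\,dS=0$ for all $\varphi\in C^\infty(M)$;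 let $P$ be the orthogonal projection of $L^2(M,TM)$ onto $V$, and $Bu=P(\chi J Pu)$. Then, for every $\Omega\in\mathbb R$, each $u\in V\cap\operatorname{Ker}B$ is a stationary solution of (1). For general $u\in V\cap\operatorname{Ker}B\subset L^2$ this is meant weakly: $$-\int_M\langle u,\nabla_u\varphi\rangle\,dS=\Omega\int_M\langle\chi Ju,\varphi\rangle\,dS$$ for all smooth divergence-free tangent vector fields $\varphi$ on $M$; if $u$ is smooth, then $u$ is a classical stationary solution of (1), with a smooth pressure. -/

import Mathlib

open MeasureTheory Set Filter Topology
open scoped ContDiff Gradient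

noncomputable section

/-- Euclidean three-space. -/
abbrev E3 : Type := EuclideanSpace ℝ (Fin 3)

/-- The cross product on Euclidean three-space. -/
def cross (a b : E3) : E3 := WithLp.toLp 2 (crossProduct a.ofLp b.ofLp)

theorem norm_cross_le (a b : E3) : ‖cross a b‖ ≤ ‖a‖ * ‖b‖ := by
  refine le_of_sq_le_sq ?_ (by positivity)
  rw [mul_pow, EuclideanSpace.real_norm_sq_eq, EuclideanSpace.real_norm_sq_eq,
    EuclideanSpace.real_norm_sq_eq]
  simp only [cross, crossProduct, Fin.sum_univ_three]
  simp
  nlinarith [sq_nonneg (a 0 * b 0 + a 1 * b 1 + a 2 * b 2)]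

theorem continuous_cross : Continuous fun z : E3 × E3 => cross z.1 z.2 := by
  refine (PiLp.continuous_toLp 2 _).comp (continuous_pi fun i => ?_)
  fin_cases i <;> simp [crossProduct] <;> fun_prop

/-- The vertical unit vector. -/
def e₃ : E3 := !₂[0, 0, 1]

/-- `F` is a smooth defining function, on the open set `U`, of the set `S` (which is `{F < 0}` in
`U`, while the boundary of `S` in `U` is the regular level set `{F = 0}`). -/
structure IsDefiningFunction (S U : Set E3) (F : E3 → ℝ) : Prop where
  isOpen : IsOpen U
  contDiffOn : ContDiffOn ℝ ∞ F U
  gradient_ne_zero : ∀ y ∈ U, ∇ F y ≠ 0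
  mem_iff : ∀ y ∈ U, (y ∈ S ↔ F y < 0)

theorem IsDefiningFunction.hasDerivAt_line {S U : Set E3} {F : E3 → ℝ}
    (hF : IsDefiningFunction S U F) {x : E3} (hx : x ∈ U) (v : E3) :
    HasDerivAt (fun t : ℝ => F (x + t • v)) (inner ℝ (∇ F x) v) 0 := by
  have hd : DifferentiableAt ℝ F x :=
    (hF.contDiffOn.contDiffAt (hF.isOpen.mem_nhds hx)).differentiableAt (by simp)
  have h1 : HasFDerivAt F (InnerProductSpace.toDual ℝ E3 (∇ F x)) (x + (0 : ℝ) • v) := by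
    simpa using hd.hasGradientAt.hasFDerivAt
  have h2 : HasDerivAt (fun t : ℝ => x + t • v) v 0 := by
    simpa using ((hasDerivAt_id (0 : ℝ)).smul_const v).const_add x
  have h3 := h1.comp_hasDerivAt (0 : ℝ) h2
  rwa [InnerProductSpace.toDual_apply_apply] at h3

theorem IsDefiningFunction.eq_zero {S U : Set E3} {F : E3 → ℝ}
    (hF : IsDefiningFunction S U F) {x : E3} (hx : x ∈ U) (hxS : x ∈ frontier S) : F x = 0 := by
  have hc : ContinuousAt F x :=
    (hF.contDiffOn.contDiffAt (hF.isOpen.mem_nhds hx)).continuousAt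
  have hU := hF.isOpen.mem_nhds hx
  rcases lt_trichotomy (F x) 0 with h | h | h
  · exfalso
    refine hxS.2 (mem_interior_iff_mem_nhds.2 ?_)
    filter_upwards [hU, hc.eventually_lt_const h] with y h1 h2
    exact (hF.mem_iff y h1).2 h2
  · exact h
  · exfalso
    have h3 : ∃ᶠ y in 𝓝 x, y ∈ S := mem_closure_iff_frequently.1 hxS.1
    refine h3 ?_
    filter_upwards [hU, hc.eventually_const_lt h] with y h1 h2 h4
    exact absurd ((hF.mem_iff y h1).1 h4) (not_lt.2 h2.le)

/-- A bounded open subset `𝒪` of three-space with smooth boundary. -/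
structure SmoothDomain where
  carrier : Set E3
  isOpen : IsOpen carrier
  isBounded : Bornology.IsBounded carrier
  smooth : ∀ x ∈ frontier carrier, ∃ U F, x ∈ U ∧ IsDefiningFunction carrier U F

namespace SmoothDomain

variable (O : SmoothDomain)

/-- The surface `M = ∂𝒪`. -/
def surface : Set E3 := frontier O.carrier

/-- `n` is the outward unit normal at `x`: the normalized gradient of a defining function. -/
def IsOutwardNormal (x n : E3) : Prop :=
  ∃ U F, x ∈ U ∧ IsDefiningFunction O.carrier U F ∧ n = ‖∇ F x‖⁻¹ • ∇ F x

open Classical in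
/-- The outward unit normal `ν` of `M` (extended by junk off `M`). -/
def normal (x : E3) : E3 := if h : ∃ n, O.IsOutwardNormal x n then h.choose else 0

/-- The tangent plane `T_x M`, as a linear subspace of three-space. -/
def tangent (x : E3) : Submodule ℝ E3 := (Submodule.span ℝ {O.normal x})ᗮ

/-- `χ(x) = e₃ · ν(x)`. -/
def chi (x : E3) : ℝ := inner ℝ e₃ (O.normal x)

/-- `J : T_x M → T_x M`, the counterclockwise rotation by a right angle (seen from outside). -/
def J (x v : E3) : E3 := cross (O.normal x) v

/-- Smooth functions (scalar or vector valued) on `M`. For an embedded surface this is the same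
as being locally the restriction of a smooth function on an open subset of three-space. -/
def SmoothOn {F : Type*} [NormedAddCommGroup F] [NormedSpace ℝ F] (f : E3 → F) : Prop :=
  ContDiffOn ℝ ∞ f O.surface

/-- The surface gradient. The derivative within `M` is only determined on `T_x M`, which is all
that is left after the projection. -/
def grad (f : E3 → ℝ) (x : E3) : E3 :=
  (O.tangent x).starProjection (gradientWithin f O.surface x)

/-- The tangential derivative at `x` of an `E3`-valued map `u`, as an endomorphism of `T_x M`:
`v ↦` tangential part of `D_v u`. For tangent fields `u` this is `v ↦ ∇_v u`
(Levi-Civita connection of the induced metric). -/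
def tangentialDeriv (u : E3 → E3) (x : E3) : O.tangent x →L[ℝ] O.tangent x :=
  (O.tangent x).orthogonalProjectionOnto ∘L fderivWithin ℝ u O.surface x ∘L (O.tangent x).subtypeL

/-- The covariant derivative `∇_v u` at `x`, for `v ∈ T_x M`. -/
def covDeriv (u : E3 → E3) (x v : E3) : E3 :=
  (O.tangent x).starProjection (fderivWithin ℝ u O.surface x v)

/-- The divergence on `M` of a tangent vector field. -/
def div (u : E3 → E3) (x : E3) : ℝ :=
  LinearMap.trace ℝ (O.tangent x) (O.tangentialDeriv u x).toLinearMap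

/-- The Gauss curvature of `M`: the determinant of the derivative of the Gauss map. -/
def gaussCurvature (x : E3) : ℝ := (O.tangentialDeriv O.normal x).det

/-- `u` is a smooth tangent vector field on `M`. -/
def IsSmoothTangentField (u : E3 → E3) : Prop :=
  O.SmoothOn u ∧ ∀ x ∈ O.surface, u x ∈ O.tangent x

/-- The pair `(u, p)` of a velocity and a pressure, smooth on `ℝ × M`, solves
`∂u/∂t + ∇_u u = Ω χ J u - ∇p`, `div u = 0` on `M`. -/
structure IsEulerSolution (Ω : ℝ) (u : ℝ → E3 → E3) (p : ℝ → E3 → ℝ) : Prop where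
  smooth_velocity : ContDiffOn ℝ ∞ (fun z : ℝ × E3 => u z.1 z.2) (univ ×ˢ O.surface)
  smooth_pressure : ContDiffOn ℝ ∞ (fun z : ℝ × E3 => p z.1 z.2) (univ ×ˢ O.surface)
  tangent : ∀ t, ∀ x ∈ O.surface, u t x ∈ O.tangent x
  euler : ∀ t, ∀ x ∈ O.surface, deriv (fun s => u s x) t + O.covDeriv (u t) x (u t x) =
    (Ω * O.chi x) • O.J x (u t x) - O.grad (p t) x
  incompressible : ∀ t, ∀ x ∈ O.surface, O.div (u t) x = 0

/-- `u` is a stationary (time independent) classical solution of the Euler equation. -/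
def IsStationarySolution (Ω : ℝ) (u : E3 → E3) : Prop :=
  ∃ p : ℝ → E3 → ℝ, O.IsEulerSolution Ω (fun _ => u) p

end SmoothDomain

/-! ### Rotations about the vertical axis -/

/-- The rotation `R_s` about the `x₃`-axis. -/
def rot (s : ℝ) (x : E3) : E3 :=
  !₂[Real.cos s * x 0 - Real.sin s * x 1, Real.sin s * x 0 + Real.cos s * x 1, x 2]

/-- The vector field `X₃` generating the rotations about the `x₃`-axis. -/
def X₃ (x : E3) : E3 := !₂[-x 1, x 0, 0]

namespace SmoothDomain

variable (O : SmoothDomain)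

/-- `M` is invariant under rotation about the `x₃`-axis. -/
def IsRotationInvariant : Prop := ∀ s, ∀ x ∈ O.surface, rot s x ∈ O.surface

/-- A zonal function: `f ∈ C^∞(M)` with `X₃ f = 0`. -/
def IsZonal (f : E3 → ℝ) : Prop :=
  O.SmoothOn f ∧ ∀ x ∈ O.surface, fderivWithin ℝ f O.surface x (X₃ x) = 0

/-! ### The outward normal is well defined and continuous -/

theorem IsOutwardNormal.norm_eq {O : SmoothDomain} {x n : E3}
    (hn : O.IsOutwardNormal x n) : ‖n‖ = 1 := by
  obtain ⟨U, F, hxU, hF, rfl⟩ := hn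
  have := hF.gradient_ne_zero x hxU
  rw [norm_smul, norm_inv, norm_norm, inv_mul_cancel₀ (norm_ne_zero_iff.2 this)]

/-- Two outward unit normals at the same boundary point agree. -/
theorem IsOutwardNormal.unique {O : SmoothDomain} {x m n : E3} (hx : x ∈ O.surface)
    (hm : O.IsOutwardNormal x m) (hn : O.IsOutwardNormal x n) : m = n := by
  have hm1 := hm.norm_eq
  have hn1 := hn.norm_eq
  obtain ⟨U, F, hxU, hF, hmF⟩ := hm
  obtain ⟨W, G, hxW, hG, hnG⟩ := hn
  by_contra hne
  have hlt : inner ℝ m n < 1 := (inner_lt_one_iff_real_of_norm_eq_one hm1 hn1).2 hne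
  have hF0 : 0 < ‖∇ F x‖ := norm_pos_iff.2 (hF.gradient_ne_zero x hxU)
  have hG0 : 0 < ‖∇ G x‖ := norm_pos_iff.2 (hG.gradient_ne_zero x hxW)
  have hmF' : ∇ F x = ‖∇ F x‖ • m := by rw [hmF, smul_smul, mul_inv_cancel₀ hF0.ne', one_smul]
  have hnG' : ∇ G x = ‖∇ G x‖ • n := by rw [hnG, smul_smul, mul_inv_cancel₀ hG0.ne', one_smul]
  have hFv : inner ℝ (∇ F x) (n - m) < 0 := by
    rw [hmF', real_inner_smul_left, inner_sub_right, real_inner_self_eq_norm_sq, hm1]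
    exact mul_neg_of_pos_of_neg hF0 (by linarith)
  have hGv : 0 < inner ℝ (∇ G x) (n - m) := by
    rw [hnG', real_inner_smul_left, inner_sub_right, real_inner_self_eq_norm_sq, hn1,
      real_inner_comm]
    exact mul_pos hG0 (by linarith)
  have hline : ContinuousAt (fun t : ℝ => x + t • (n - m)) 0 := by fun_prop
  have hU : ∀ᶠ t in 𝓝[>] (0 : ℝ), x + t • (n - m) ∈ U :=
    (hline.eventually_mem (by simpa using hF.isOpen.mem_nhds hxU)).filter_mono nhdsWithin_le_nhds
  have hW : ∀ᶠ t in 𝓝[>] (0 : ℝ), x + t • (n - m) ∈ W :=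
    (hline.eventually_mem (by simpa using hG.isOpen.mem_nhds hxW)).filter_mono nhdsWithin_le_nhds
  have hFs := (hasDerivAt_iff_tendsto_slope.1 (hF.hasDerivAt_line hxU (n - m))).mono_left
    (nhdsGT_le_nhdsNE (0 : ℝ))
  have hGs := (hasDerivAt_iff_tendsto_slope.1 (hG.hasDerivAt_line hxW (n - m))).mono_left
    (nhdsGT_le_nhdsNE (0 : ℝ))
  have hF00 : F x = 0 := hF.eq_zero hxU hx
  have hG00 : G x = 0 := hG.eq_zero hxW hx
  obtain ⟨t, h1, h2, h3, h4, h5⟩ := (hU.and (hW.and ((hFs.eventually_lt_const hFv).and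
    ((hGs.eventually_const_lt hGv).and self_mem_nhdsWithin)))).exists
  have h5' : (0 : ℝ) < t := h5
  simp only [slope_def_field, zero_smul, add_zero, hF00, hG00, sub_zero] at h3 h4
  have h6 : F (x + t • (n - m)) < 0 := by
    by_contra h; exact absurd h3 (not_lt.2 (div_nonneg (not_lt.1 h) h5'.le))
  have h7 : 0 < G (x + t • (n - m)) := by
    by_contra h; exact absurd h4 (not_lt.2 (div_nonpos_of_nonpos_of_nonneg (not_lt.1 h) h5'.le))
  exact absurd ((hG.mem_iff _ h2).1 ((hF.mem_iff _ h1).2 h6)) (not_lt.2 h7.le)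

theorem isOutwardNormal_normal {x : E3} (hx : x ∈ O.surface) :
    O.IsOutwardNormal x (O.normal x) := by
  obtain ⟨U, F, hxU, hF⟩ := O.smooth x hx
  have h : ∃ n, O.IsOutwardNormal x n := ⟨_, U, F, hxU, hF, rfl⟩
  rw [normal, dif_pos h]
  exact h.choose_spec

theorem continuousOn_normal : ContinuousOn O.normal O.surface := by
  intro x hx
  obtain ⟨U, F, hxU, hF⟩ := O.smooth x hx
  have hg : ContinuousOn (∇ F) U := by
    have := hF.contDiffOn.continuousOn_fderiv_of_isOpen hF.isOpen (by simp)
    exact (InnerProductSpace.toDual ℝ E3).symm.continuous.comp_continuousOn this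
  have hc : ContinuousOn (fun y => ‖∇ F y‖⁻¹ • ∇ F y) U :=
    (hg.norm.inv₀ fun y hy => norm_ne_zero_iff.2 (hF.gradient_ne_zero y hy)).smul hg
  have hU := hF.isOpen.mem_nhds hxU
  have he : ∀ y ∈ O.surface, y ∈ U → O.normal y = ‖∇ F y‖⁻¹ • ∇ F y := fun y hy hyU =>
    (O.isOutwardNormal_normal hy).unique hy ⟨U, F, hyU, hF, rfl⟩
  refine ((hc.continuousAt hU).continuousWithinAt (s := O.surface)).congr_of_eventuallyEq ?_
    (he x hx hxU)
  filter_upwards [self_mem_nhdsWithin, mem_nhdsWithin_of_mem_nhds hU] with y h1 h2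
  exact he y h1 h2

/-! ### The operator `B` on square integrable tangent fields -/

/-- The surface area measure of `M`. -/
def area : Measure E3 := (μHE[2]).restrict O.surface

/-- The closed subspace of tangent fields in the space of square integrable `E3`-valued maps on
`M`, that is, `L²(M, TM)`, identified through the metric with `L²(M, Λ¹)`. Under this
identification `*` is `J` and `δ` is `-div`. -/
def tangentL2 : Submodule ℝ (Lp E3 2 O.area) where
  carrier := {u | ∀ᵐ x ∂O.area, u x ∈ O.tangent x}
  zero_mem' := by
    filter_upwards [Lp.coeFn_zero E3 2 O.area] with x hx
    rw [hx]; exact Submodule.zero_mem _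
  add_mem' := by
    intro u v hu hv
    filter_upwards [hu, hv, Lp.coeFn_add u v] with x h1 h2 h
    rw [h]; exact Submodule.add_mem _ h1 h2
  smul_mem' := by
    intro c u hu
    filter_upwards [hu, Lp.coeFn_smul c u] with x h1 h
    rw [h]; exact Submodule.smul_mem _ c h1

theorem isClosed_tangentL2 : IsClosed (O.tangentL2 : Set (Lp E3 2 O.area)) := by
  refine IsSeqClosed.isClosed fun u v hu huv => ?_
  obtain ⟨k, -, hk⟩ := (tendstoInMeasure_of_tendsto_Lp huv).exists_seq_tendsto_ae
  have hu' : ∀ᵐ x ∂O.area, ∀ n, u n x ∈ O.tangent x := ae_all_iff.2 hu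
  change ∀ᵐ x ∂O.area, v x ∈ O.tangent x
  filter_upwards [hk, hu'] with x h1 h2
  exact (Submodule.isClosed_orthogonal _).mem_of_tendsto h1 (Eventually.of_forall fun n => h2 _)

instance : CompleteSpace O.tangentL2 := O.isClosed_tangentL2.completeSpace_coe

/-- The gradients of smooth functions on `M`, as elements of `L²(M, TM)`. -/
def gradientsL2 : Set O.tangentL2 :=
  {w | ∃ φ : E3 → ℝ, O.SmoothOn φ ∧ (w : E3 → E3) =ᵐ[O.area] O.grad φ}

/-- `V`: the square integrable tangent fields `u` with `div u = 0` weakly, that is, with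
`∫_M ⟨∇φ, u⟩ dS = 0` for all smooth functions `φ` on `M`. -/
def V : Submodule ℝ O.tangentL2 := (Submodule.span ℝ O.gradientsL2)ᗮ

instance : CompleteSpace O.V := (Submodule.isClosed_orthogonal _).completeSpace_coe

/-- The Leray projection `P`: the orthogonal projection of `L²(M, TM)` onto `V`. -/
def leray : O.tangentL2 →L[ℝ] O.tangentL2 := O.V.starProjection

theorem norm_chi_smul_J_le {x : E3} (hx : x ∈ O.surface) (v : E3) :
    ‖O.chi x • O.J x v‖ ≤ ‖v‖ := by
  have hn : ‖O.normal x‖ = 1 := (O.isOutwardNormal_normal hx).norm_eq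
  have he : ‖e₃‖ = 1 := by simp [e₃, EuclideanSpace.norm_eq, Fin.sum_univ_three]
  have h1 : ‖O.chi x‖ ≤ 1 := by
    simpa [chi, hn, he] using norm_inner_le_norm (𝕜 := ℝ) e₃ (O.normal x)
  have h2 : ‖O.J x v‖ ≤ ‖v‖ := by simpa [J, hn] using norm_cross_le (O.normal x) v
  rw [norm_smul]
  nlinarith [norm_nonneg (O.J x v), norm_nonneg (O.chi x)]

theorem aestronglyMeasurable_normal : AEStronglyMeasurable O.normal O.area := by
  unfold area
  exact O.continuousOn_normal.aestronglyMeasurable isClosed_frontier.measurableSet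

theorem ae_mem_surface : ∀ᵐ x ∂O.area, x ∈ O.surface := by
  unfold area
  exact ae_restrict_mem isClosed_frontier.measurableSet

theorem memLp_chi_smul_J {g : E3 → E3} (hg : MemLp g 2 O.area) :
    MemLp (fun x => O.chi x • O.J x (g x)) 2 O.area := by
  have h1 : AEStronglyMeasurable O.chi O.area :=
    (continuous_const.inner continuous_id).comp_aestronglyMeasurable O.aestronglyMeasurable_normal
  have h2 : AEStronglyMeasurable (fun x => O.J x (g x)) O.area :=
    continuous_cross.comp_aestronglyMeasurable
      (O.aestronglyMeasurable_normal.prodMk hg.aestronglyMeasurable)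
  refine MemLp.mono hg (h1.smul h2) ?_
  filter_upwards [O.ae_mem_surface] with x hx
  exact O.norm_chi_smul_J_le hx _

theorem J_mem_tangent (x v : E3) : O.J x v ∈ O.tangent x := by
  rw [tangent, Submodule.mem_orthogonal_singleton_iff_inner_right, J, cross,
    EuclideanSpace.inner_eq_star_dotProduct]
  simp [dotProduct_comm]

/-- The operator `u ↦ χ J u` on `L²(M, TM)`. -/
def chiJ (u : O.tangentL2) : O.tangentL2 :=
  ⟨(O.memLp_chi_smul_J (Lp.memLp (u : Lp E3 2 O.area))).toLp _, by
    change ∀ᵐ x ∂O.area, _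
    filter_upwards [(O.memLp_chi_smul_J (Lp.memLp (u : Lp E3 2 O.area))).coeFn_toLp] with x hx
    rw [hx]; exact Submodule.smul_mem _ _ (O.J_mem_tangent x _)⟩

/-- The operator `B u = P(χ J P u)` on `L²(M, TM)`. -/
def B (u : O.tangentL2) : O.tangentL2 := O.leray (O.chiJ (O.leray u))

/-- `u ∈ L²(M, TM)` is a stationary weak solution of the Euler equation: `u` is weakly divergence
free, and the equation `∇_u u = Ω χ J u - ∇p` (where `∇_u u = div (u ⊗ u)`) holds in the sense of
distributions, tested against smooth divergence-free tangent fields (which annihilate `∇p`). -/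
def IsStationaryWeakSolution (Ω : ℝ) (u : O.tangentL2) : Prop :=
  u ∈ O.V ∧ ∀ φ : E3 → E3, O.IsSmoothTangentField φ → (∀ x ∈ O.surface, O.div φ x = 0) →
    -∫ x, inner ℝ ((u : Lp E3 2 O.area) x) (O.covDeriv φ x ((u : Lp E3 2 O.area) x)) ∂O.area =
      Ω * ∫ x, inner ℝ (O.chi x • O.J x ((u : Lp E3 2 O.area) x)) (φ x) ∂O.area

end SmoothDomain

end

/-! ### Algebra of the cross product and of rotations -/

/-! Write X for `X₃`, Y = JX, r² = |X|² and κ = ⟨dν(X), X⟩. Away from the axis X, Y is an orthogonal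
frame of the tangent plane. Everything rests on three frame identities: the tangential part of D_X X
is χY (`inner_X₃_X₃`), that of D_Y Y is -χY (`inner_fderivWithin_Y`), and r² dx₃ = κ⟨Y, ·⟩ on
tangent vectors (`rsq_mul_height`).

Geometry. Positive determinant makes the second fundamental form definite. Its trace cannot change
sign on a connected surface, and it is positive at a point farthest from the axis, so the form is
positive definite (`shape_pos`). By compactness κ ≥ c r² with c > 0. It follows that a horizontal
section of M is a single orbit of the rotation group (`IsOval.rsq_eq`) and that M meets the axis in
exactly two poles (`IsOval.exists_poles`). Rotation-invariant functions on M are therefore functions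
of the height.

Classical solutions. A smooth equivariant field orthogonal to Y is v = ωX off the poles, with ω
invariant. Then ∇_v v = ω²χY and χJv = ωχY, so the field that must equal ∇p is gY with g invariant
and bounded. Such a field is the gradient of π(x₃), where π' = g r²/κ. The bound on r²/κ makes π
continuous up to the poles, and smoothness there follows because the gradient is already known to be
smooth (`IsOval.exists_potential`). This gives `IsOval.isStationarySolution`; part (a) is the case v
= J∇f.

The kernel of B. If u ∈ V and Bu = 0, then χJu is orthogonal to V. In a chart ⟨J∇η, ∇ψ⟩ dS is a
Jacobian determinant, so J∇η ∈ V for η supported in the chart. Testing χJu with J∇η, and the weak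
divergence of u with χη, leaves ∫ η⟨∇χ, u⟩ = 0, hence ⟨∇χ, u⟩ = 0 almost everywhere. Off the poles
∇χ is a nonzero multiple of Y, so u is a multiple of X (`IsOval.ae_inner_Y`). Testing the divergence
of u with r²ψ then shows that ⟨X, u⟩ is rotation invariant (`IsOval.ae_inner_X₃_rot`). A smooth
representative is thus a zonal flow, and the classical case applies.

Weak solutions. For u in the kernel both sides of the weak equation vanish. Each integrand is an
invariant function times an expression in φ, so only the average of that expression over parallels
counts (`integral_mul_div_eq_zero`). The average of ⟨φ, Y⟩ is the flux of φ through a parallel; it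
does not depend on the height and is zero at a pole (`IsOval.orbitIntegral_inner_Y`). The average of
⟨∇_X φ, X⟩ = X⟨φ, X⟩ - χ⟨φ, Y⟩ then vanishes too. -/

theorem E3_inner_eq (x y : E3) : inner ℝ x y = x 0 * y 0 + x 1 * y 1 + x 2 * y 2 := by
  rw [EuclideanSpace.inner_eq_star_dotProduct]
  simp [dotProduct, Fin.sum_univ_three]; ring

theorem E3_ext {x y : E3} (h0 : x 0 = y 0) (h1 : x 1 = y 1) (h2 : x 2 = y 2) : x = y := by
  ext i; fin_cases i <;> assumption

@[simp] theorem cross_zero_apply (a b : E3) : cross a b 0 = a 1 * b 2 - a 2 * b 1 := by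
  simp [cross, crossProduct]
@[simp] theorem cross_one_apply (a b : E3) : cross a b 1 = a 2 * b 0 - a 0 * b 2 := by
  simp [cross, crossProduct]
@[simp] theorem cross_two_apply (a b : E3) : cross a b 2 = a 0 * b 1 - a 1 * b 0 := by
  simp [cross, crossProduct]

@[simp] theorem e₃_zero : e₃ 0 = 0 := by simp [e₃]
@[simp] theorem e₃_one : e₃ 1 = 0 := by simp [e₃]
@[simp] theorem e₃_two : e₃ 2 = 1 := by simp [e₃]

/-- The cross product as a continuous bilinear map. -/
noncomputable def crossL : E3 →L[ℝ] E3 →L[ℝ] E3 :=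
  LinearMap.mkContinuous₂
    (LinearMap.mk₂ ℝ cross
      (fun a b c => by apply E3_ext <;> simp <;> ring)
      (fun k a b => by apply E3_ext <;> simp <;> ring)
      (fun a b c => by apply E3_ext <;> simp <;> ring)
      (fun k a b => by apply E3_ext <;> simp <;> ring)) 1
    (fun a b => by simpa using norm_cross_le a b)

@[simp] theorem crossL_apply (a b : E3) : crossL a b = cross a b := rfl

theorem cross_smul_right (k : ℝ) (a b : E3) : cross a (k • b) = k • cross a b := by
  exact (crossL a).map_smul k b

theorem E3_cross_anticomm (a b : E3) : cross a b = -cross b a := by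
  apply E3_ext <;> simp <;> ring

theorem inner_cross_right_self (a b : E3) : inner ℝ b (cross a b) = 0 := by
  simp [E3_inner_eq]; ring

theorem inner_cross_cross (a b c d : E3) : inner ℝ (cross a b) (cross c d) =
    inner ℝ a c * inner ℝ b d - inner ℝ a d * inner ℝ b c := by
  simp [E3_inner_eq]; ring

theorem E3_cross_cross (a b c : E3) : cross a (cross b c) = inner ℝ a c • b - inner ℝ a b • c := by
  apply E3_ext <;> simp [E3_inner_eq] <;> ring

theorem inner_cross_cross_self {n v w : E3} (hn : ‖n‖ = 1) (h : inner ℝ n v = 0) :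
    inner ℝ (cross n v) (cross n w) = inner ℝ v w := by
  rw [inner_cross_cross, real_inner_self_eq_norm_sq, hn, real_inner_comm n v, h]; ring

/-- Expansion of a vector of the plane `n^⊥` in the orthogonal frame `a`, `n × a`. -/
theorem norm_sq_smul_eq_frame {n a v : E3} (hn : ‖n‖ = 1) (ha : inner ℝ n a = 0)
    (hv : inner ℝ n v = 0) :
    ‖a‖ ^ 2 • v = inner ℝ v a • a + inner ℝ v (cross n a) • cross n a := by
  -- Both factors lie in the plane orthogonal to n, so their cross product is along n. The expansion
  -- comes from computing a × (v × a) in two ways.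
  have h1 : cross v a = inner ℝ n (cross v a) • n := by
    have h := E3_cross_cross n n (cross v a)
    rw [E3_cross_cross n v a, ha, hv, real_inner_self_eq_norm_sq, hn] at h
    have h0 : cross n (0 : E3) = 0 := (crossL n).map_zero
    simp only [zero_smul, sub_zero, one_pow, one_smul, h0] at h
    exact (sub_eq_zero.1 h.symm).symm
  have h2 := E3_cross_cross a v a
  rw [h1, cross_smul_right, real_inner_self_eq_norm_sq] at h2
  have h3 : inner ℝ n (cross v a) = - inner ℝ v (cross n a) := by simp [E3_inner_eq]; ring
  rw [h3, E3_cross_anticomm a n, smul_neg, neg_smul, neg_neg, real_inner_comm v a] at h2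
  rw [h2, add_sub_cancel]

/-! ### Rotations about the axis and their generator. -/

theorem X₃_eq (x : E3) : X₃ x = cross e₃ x := by apply E3_ext <;> simp [X₃]

@[simp] theorem X₃_zero_apply (x : E3) : X₃ x 0 = - x 1 := by simp [X₃]
@[simp] theorem X₃_one_apply (x : E3) : X₃ x 1 = x 0 := by simp [X₃]
@[simp] theorem X₃_two_apply (x : E3) : X₃ x 2 = 0 := by simp [X₃]

@[simp] theorem rot_zero_apply (s : ℝ) (x : E3) :
    rot s x 0 = Real.cos s * x 0 - Real.sin s * x 1 := by simp [rot]
@[simp] theorem rot_one_apply (s : ℝ) (x : E3) :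
    rot s x 1 = Real.sin s * x 0 + Real.cos s * x 1 := by simp [rot]
@[simp] theorem rot_two_apply (s : ℝ) (x : E3) : rot s x 2 = x 2 := by simp [rot]

theorem inner_rot_rot (s : ℝ) (x y : E3) : inner ℝ (rot s x) (rot s y) = inner ℝ x y := by
  simp [E3_inner_eq]; linear_combination (x 0 * y 0 + x 1 * y 1) * Real.sin_sq_add_cos_sq s

theorem rot_rot (s t : ℝ) (x : E3) : rot s (rot t x) = rot (s + t) x := by
  apply E3_ext <;> simp [Real.cos_add, Real.sin_add] <;> ring

theorem rot_zero (x : E3) : rot 0 x = x := by apply E3_ext <;> simp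

theorem rot_neg_rot (s : ℝ) (x : E3) : rot (-s) (rot s x) = x := by
  rw [rot_rot, neg_add_cancel, rot_zero]

theorem rot_rot_neg (s : ℝ) (x : E3) : rot s (rot (-s) x) = x := by
  rw [rot_rot, add_neg_cancel, rot_zero]

theorem rot_two_pi (x : E3) : rot (2 * Real.pi) x = x := by apply E3_ext <;> simp

/-- The rotation as a linear isometry. -/
noncomputable def rotE (s : ℝ) : E3 ≃ₗᵢ[ℝ] E3 where
  toFun := rot s
  invFun := rot (-s)
  left_inv := rot_neg_rot s
  right_inv := rot_rot_neg s
  map_add' x y := by apply E3_ext <;> simp <;> ring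
  map_smul' k x := by apply E3_ext <;> simp <;> ring
  norm_map' x := by
    change ‖rot s x‖ = ‖x‖
    rw [norm_eq_sqrt_real_inner, inner_rot_rot, ← norm_eq_sqrt_real_inner]

@[simp] theorem rotE_apply (s : ℝ) (x : E3) : rotE s x = rot s x := rfl

@[simp] theorem norm_rot (s : ℝ) (x : E3) : ‖rot s x‖ = ‖x‖ := (rotE s).norm_map x

theorem rot_cross (s : ℝ) (x y : E3) : rot s (cross x y) = cross (rot s x) (rot s y) := by
  apply E3_ext
  · simp; ring
  · simp; ring
  · simp; linear_combination (x 1 * y 0 - x 0 * y 1) * Real.sin_sq_add_cos_sq s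

theorem rot_e₃ (s : ℝ) : rot s e₃ = e₃ := by apply E3_ext <;> simp

theorem rot_X₃ (s : ℝ) (x : E3) : rot s (X₃ x) = X₃ (rot s x) := by
  rw [X₃_eq, rot_cross, rot_e₃, X₃_eq]

theorem contDiff_rot : ContDiff ℝ ∞ fun z : ℝ × E3 => rot z.1 z.2 := by
  have h : ∀ i : Fin 3, ContDiff ℝ ∞ fun z : ℝ × E3 => z.2 i := fun i =>
    ((EuclideanSpace.proj (𝕜 := ℝ) i).contDiff).comp contDiff_snd
  have hc : ContDiff ℝ ∞ fun z : ℝ × E3 => Real.cos z.1 := Real.contDiff_cos.comp contDiff_fst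
  have hs : ContDiff ℝ ∞ fun z : ℝ × E3 => Real.sin z.1 := Real.contDiff_sin.comp contDiff_fst
  rw [contDiff_euclidean]
  intro i
  fin_cases i
  · simpa using (hc.mul (h 0)).sub (hs.mul (h 1))
  · simpa using (hs.mul (h 0)).add (hc.mul (h 1))
  · simpa using h 2

theorem hasDerivAt_rot (s : ℝ) (x : E3) : HasDerivAt (fun t => rot t x) (X₃ (rot s x)) s := by
  have hd : DifferentiableAt ℝ (fun t => rot t x) s :=
    (contDiff_rot.comp (contDiff_id.prodMk contDiff_const)).contDiffAt.differentiableAt (by simp)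
  have hi : ∀ i : Fin 3, HasDerivAt (fun t => rot t x i) (deriv (fun t => rot t x) s i) s :=
    fun i => (EuclideanSpace.proj i : E3 →L[ℝ] ℝ).hasFDerivAt.comp_hasDerivAt
      s hd.hasDerivAt
  suffices deriv (fun t => rot t x) s = X₃ (rot s x) from this ▸ hd.hasDerivAt
  have h0 := (((Real.hasDerivAt_cos s).mul_const (x 0)).sub
      ((Real.hasDerivAt_sin s).mul_const (x 1)))
  have h1 := (((Real.hasDerivAt_sin s).mul_const (x 0)).add
      ((Real.hasDerivAt_cos s).mul_const (x 1)))
  apply E3_ext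
  · refine (hi 0).unique ?_
    convert h0 using 1
    · ext t; simp
    · simp; ring
  · refine (hi 1).unique ?_
    convert h1 using 1
    · ext t; simp
    · simp; ring
  · refine (hi 2).unique ?_
    simpa using hasDerivAt_const s (x 2)

/-- The square of the distance to the axis. -/
noncomputable def rsq (x : E3) : ℝ := x 0 ^ 2 + x 1 ^ 2

theorem norm_X₃_sq (x : E3) : ‖X₃ x‖ ^ 2 = rsq x := by
  rw [← real_inner_self_eq_norm_sq, E3_inner_eq]; simp [rsq]; ring

theorem rsq_rot (s : ℝ) (x : E3) : rsq (rot s x) = rsq x := by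
  simp only [rsq, rot_zero_apply, rot_one_apply]
  linear_combination (x 0 ^ 2 + x 1 ^ 2) * Real.sin_sq_add_cos_sq s

theorem rsq_nonneg (x : E3) : 0 ≤ rsq x := by unfold rsq; positivity

theorem contDiff_rsq : ContDiff ℝ ∞ rsq := by
  have h : ∀ i : Fin 3, ContDiff ℝ ∞ fun z : E3 => z i := fun i =>
    (EuclideanSpace.proj (𝕜 := ℝ) i).contDiff
  exact ((h 0).pow 2).add ((h 1).pow 2)

theorem X₃_eq_zero {x : E3} (h : rsq x = 0) : X₃ x = 0 := by
  have := norm_X₃_sq x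
  rw [h] at this
  simpa using this

/-- Two points at the same height and distance from the axis differ by a rotation. -/
theorem exists_rot_eq {x y : E3} (h2 : x 2 = y 2) (hr : rsq x = rsq y) : ∃ s, rot s x = y := by
  -- Each point is a rotate of the point of the half-plane x₁ ≥ 0, x₂ = 0 at the same height and
  -- radius; the angle is the complex argument of (z₁, z₂).
  have key : ∀ z : E3, ∃ s, rot s (!₂[Real.sqrt (rsq z), 0, z 2]) = z := by
    intro z
    let w : ℂ := ⟨z 0, z 1⟩
    have hw : Real.sqrt (rsq z) = ‖w‖ := by
      rw [Complex.norm_eq_sqrt_sq_add_sq]; rfl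
    refine ⟨w.arg, E3_ext ?_ ?_ ?_⟩
    · simp [hw, mul_comm, Complex.norm_mul_cos_arg, w]
    · simp [hw, mul_comm, Complex.norm_mul_sin_arg, w]
    · simp
  obtain ⟨s, hs⟩ := key x
  obtain ⟨t, ht⟩ := key y
  refine ⟨t - s, ?_⟩
  rw [← hs, rot_rot, sub_add_cancel, ← ht, h2, hr]

namespace SmoothDomain

variable (O : SmoothDomain)

variable {O}

/-! ### The unit normal, the tangent plane, compactness. -/

theorem norm_normal {x : E3} (hx : x ∈ O.surface) : ‖O.normal x‖ = 1 :=
  (O.isOutwardNormal_normal hx).norm_eq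

theorem mem_tangent {x v : E3} : v ∈ O.tangent x ↔ inner ℝ (O.normal x) v = 0 := by
  rw [tangent, Submodule.mem_orthogonal_singleton_iff_inner_right]

theorem starProjection_tangent {x : E3} (hx : x ∈ O.surface) (v : E3) :
    (O.tangent x).starProjection v = v - inner ℝ (O.normal x) v • O.normal x := by
  rw [tangent, Submodule.starProjection_orthogonal', sub_apply, one_apply_eq_self, Submodule.starProjection_unit_singleton _ (norm_normal hx)]

theorem finrank_tangent {x : E3} (hx : x ∈ O.surface) : Module.finrank ℝ (O.tangent x) = 2 := by
  have h0 : O.normal x ≠ 0 := by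
    intro h; have := norm_normal hx; simp [h] at this
  have : Fact (Module.finrank ℝ E3 = 2 + 1) := ⟨by simp⟩
  exact Submodule.finrank_orthogonal_span_singleton h0

theorem tangent_starProjection_of_mem {x v : E3} (hv : v ∈ O.tangent x) :
    (O.tangent x).starProjection v = v :=
  Submodule.starProjection_eq_self_iff.2 hv

theorem inner_starProjection_left {x v w : E3} (hw : w ∈ O.tangent x) :
    inner ℝ ((O.tangent x).starProjection v) w = inner ℝ v w := by
  rw [Submodule.inner_starProjection_left_eq_right, tangent_starProjection_of_mem hw]

theorem isCompact_surface : IsCompact O.surface :=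
  Metric.isCompact_of_isClosed_isBounded isClosed_frontier
    ((O.isBounded.closure).subset frontier_subset_closure)

end SmoothDomain

/-! ### Local charts -/

/-- The Euclidean plane. -/
abbrev E2 : Type := EuclideanSpace ℝ (Fin 2)

theorem IsDefiningFunction.contDiffAt {S U : Set E3} {F : E3 → ℝ}
    (hF : IsDefiningFunction S U F) {x : E3} (hx : x ∈ U) : ContDiffAt ℝ ∞ F x :=
  hF.contDiffOn.contDiffAt (hF.isOpen.mem_nhds hx)

theorem IsDefiningFunction.contDiffOn_gradient {S U : Set E3} {F : E3 → ℝ}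
    (hF : IsDefiningFunction S U F) : ContDiffOn ℝ ∞ (∇ F) U :=
  (InnerProductSpace.toDual ℝ E3).symm.contDiff.comp_contDiffOn
    (hF.contDiffOn.fderiv_of_isOpen hF.isOpen (by simp))

theorem IsDefiningFunction.fderiv_apply {S U : Set E3} {F : E3 → ℝ}
    (_hF : IsDefiningFunction S U F) (x v : E3) :
    fderiv ℝ F x v = inner ℝ (∇ F x) v := by
  rw [← InnerProductSpace.toDual_apply_apply (𝕜 := ℝ), gradient,
    LinearIsometryEquiv.apply_symm_apply]

/-- Moving from a zero of F against the gradient makes F negative at once, so points of S accumulate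
there. Converse to `IsDefiningFunction.eq_zero`; needed to know that chart points lie on the
surface. -/
theorem IsDefiningFunction.mem_frontier {S U : Set E3} {F : E3 → ℝ}
    (hF : IsDefiningFunction S U F) {x : E3} (hx : x ∈ U) (h0 : F x = 0) : x ∈ frontier S := by
  have hnot : x ∉ S := fun h => by
    have := (hF.mem_iff x hx).1 h
    linarith
  refine ⟨?_, fun h => hnot (interior_subset h)⟩
  have hg := hF.gradient_ne_zero x hx
  have hd := hF.hasDerivAt_line hx (-∇ F x)
  have hneg : inner ℝ (∇ F x) (-∇ F x) < 0 := by
    rw [inner_neg_right, real_inner_self_eq_norm_sq]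
    have := norm_pos_iff.2 hg
    nlinarith
  have hs := (hasDerivAt_iff_tendsto_slope.1 hd).mono_left (nhdsGT_le_nhdsNE (0 : ℝ))
  have hline : Tendsto (fun t : ℝ => x + t • (-∇ F x)) (𝓝[>] 0) (𝓝 x) := by
    have : ContinuousAt (fun t : ℝ => x + t • (-∇ F x)) 0 := by fun_prop
    simpa [ContinuousAt] using this.tendsto.mono_left nhdsWithin_le_nhds
  refine mem_closure_of_tendsto hline ?_
  filter_upwards [hs.eventually_lt_const hneg, hline.eventually_mem (hF.isOpen.mem_nhds hx),
    self_mem_nhdsWithin] with t h1 h2 h3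
  rw [hF.mem_iff _ h2]
  have h3' : (0 : ℝ) < t := h3
  simp only [slope_def_field, zero_smul, add_zero, h0, sub_zero] at h1
  by_contra h
  exact absurd h1 (not_lt.2 (div_nonneg (not_lt.1 h) h3'.le))

namespace SmoothDomain

/-- A local parametrization of the surface around `x₀`, inside the set `V`, over a disc; the
inverse is the restriction of a smooth map `ξ`. -/
structure Chart (O : SmoothDomain) (x₀ : E3) (V : Set E3) where
  /-- the radius of the parameter disc -/
  rad : ℝ
  /-- the coordinates -/
  ξ : E3 → E2
  /-- the parametrization -/
  Φ : E2 → E3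
  /-- the chart domain -/
  W : Set E3
  rad_pos : 0 < rad
  isOpen_W : IsOpen W
  mem_W : x₀ ∈ W
  W_subset : W ⊆ V
  contDiff_ξ : ContDiff ℝ ∞ ξ
  ξ_base : ξ x₀ = 0
  mapsTo : MapsTo ξ W (Metric.ball 0 rad)
  contDiffOn_Φ : ContDiffOn ℝ ∞ Φ (Metric.ball 0 rad)
  Φ_mem_W : ∀ y ∈ Metric.ball (0 : E2) rad, Φ y ∈ W
  Φ_mem : ∀ y ∈ Metric.ball (0 : E2) rad, Φ y ∈ O.surface
  ξ_Φ : ∀ y ∈ Metric.ball (0 : E2) rad, ξ (Φ y) = y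
  Φ_ξ : ∀ x ∈ O.surface, x ∈ W → Φ (ξ x) = x

variable {O : SmoothDomain}

/-- Inverse function theorem for (ξ, F), where ξ is the projection onto the plane orthogonal to
∇F(x₀), identified with ℝ². The surface is the slice F = 0, so the inverse restricted to that slice
is the parametrization. The linear ξ is smooth on all of space. -/
theorem exists_chart {x₀ : E3} (hx₀ : x₀ ∈ O.surface) {V : Set E3} (hV : V ∈ 𝓝 x₀) :
    Nonempty (O.Chart x₀ V) := by
  obtain ⟨U, F, hxU, hF⟩ := O.smooth x₀ hx₀
  set n := ∇ F x₀ with hn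
  have hn0 : n ≠ 0 := hF.gradient_ne_zero x₀ hxU
  let T : Submodule ℝ E3 := (Submodule.span ℝ {n})ᗮ
  have hT2 : Module.finrank ℝ T = Module.finrank ℝ E2 := by
    have : Fact (Module.finrank ℝ E3 = 2 + 1) := ⟨by simp⟩
    have h := Submodule.finrank_orthogonal_span_singleton (𝕜 := ℝ) (n := 2) hn0
    simpa [T] using h
  let L : E3 →L[ℝ] E2 :=
    (ContinuousLinearEquiv.ofFinrankEq hT2 : T →L[ℝ] E2) ∘L T.orthogonalProjectionOnto
  have hL : ∀ v, L v = 0 → ∃ c : ℝ, v = c • n := by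
    intro v hv
    have h1 : T.orthogonalProjectionOnto v = 0 := by
      simpa [L] using hv
    rw [Submodule.orthogonalProjectionOnto_eq_zero_iff] at h1
    simp only [T, Submodule.orthogonal_orthogonal] at h1
    obtain ⟨c, hc⟩ := Submodule.mem_span_singleton.1 h1
    exact ⟨c, hc.symm⟩
  let ξ : E3 → E2 := fun y => L (y - x₀)
  have hξ : ContDiff ℝ ∞ ξ := L.contDiff.comp (contDiff_id.sub contDiff_const)
  have hξd : ∀ x, HasFDerivAt ξ L x := fun x => by
    exact L.hasFDerivAt.comp x ((hasFDerivAt_id x).sub_const x₀)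
  let Ψ : E3 → E2 × ℝ := fun y => (ξ y, F y)
  have hΨ : ∀ x ∈ U, ContDiffAt ℝ ∞ Ψ x := fun x hx => hξ.contDiffAt.prodMk (hF.contDiffAt hx)
  -- The kernel of L is the line spanned by n, and the differential of F is injective on it as soon
  -- as ∇F(x) is not orthogonal to n.
  have hΨd : ∀ x ∈ U, inner ℝ (∇ F x) n ≠ 0 →
      ∃ A : E3 ≃L[ℝ] E2 × ℝ, HasFDerivAt Ψ (A : E3 →L[ℝ] E2 × ℝ) x := by
    intro x hx hne
    have hFd : HasFDerivAt F (fderiv ℝ F x) x :=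
      ((hF.contDiffAt hx).differentiableAt (by simp)).hasFDerivAt
    have hd : HasFDerivAt Ψ (L.prod (fderiv ℝ F x)) x := (hξd x).prodMk hFd
    have hinj : Function.Injective (L.prod (fderiv ℝ F x)).toLinearMap := by
      rw [← LinearMap.ker_eq_bot, LinearMap.ker_eq_bot']
      intro v hv
      have hv1 : L v = 0 := congrArg Prod.fst hv
      have hv2 : fderiv ℝ F x v = 0 := congrArg Prod.snd hv
      obtain ⟨c, rfl⟩ := hL v hv1
      rw [hF.fderiv_apply, inner_smul_right] at hv2
      rcases mul_eq_zero.1 hv2 with h | h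
      · simp [h]
      · exact absurd h hne
    have hfr : Module.finrank ℝ E3 = Module.finrank ℝ (E2 × ℝ) := by simp
    let A := (LinearEquiv.ofInjectiveOfFinrankEq _ hinj hfr).toContinuousLinearEquiv
    refine ⟨A, ?_⟩
    convert hd using 1
    ext v : 1
    rfl
  have hcont : ContinuousOn (fun x => inner ℝ (∇ F x) n) U :=
    hF.contDiffOn_gradient.continuousOn.inner continuousOn_const
  have hnn : inner ℝ (∇ F x₀) n ≠ 0 := by
    rw [← hn, real_inner_self_eq_norm_sq]; simpa using hn0
  obtain ⟨A₀, hA₀⟩ := hΨd x₀ hxU hnn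
  let e := (hΨ x₀ hxU).toOpenPartialHomeomorph Ψ hA₀ (by simp)
  have he : ∀ x, e x = Ψ x := fun x => rfl
  have hxe : x₀ ∈ e.source := (hΨ x₀ hxU).mem_toOpenPartialHomeomorph_source hA₀ (by simp)
  let G : Set E3 := U ∩ (fun x => inner ℝ (∇ F x) n) ⁻¹' {0}ᶜ
  have hG : IsOpen G := hcont.isOpen_inter_preimage hF.isOpen isOpen_compl_singleton
  -- Restricting to points where the differential is invertible makes the inverse smooth on the
  -- whole target, not only at the image of the base point.
  let e' := e.restr (G ∩ interior V)
  have hsrc : e'.source = e.source ∩ (G ∩ interior V) := by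
    simp only [e', OpenPartialHomeomorph.restr_source, (hG.inter isOpen_interior).interior_eq]
  have hx' : x₀ ∈ e'.source := by
    rw [hsrc]; exact ⟨hxe, ⟨hxU, hnn⟩, mem_interior_iff_mem_nhds.2 hV⟩
  have he' : ∀ x, e' x = (ξ x, F x) := fun x => rfl
  have hξ0 : ξ x₀ = 0 := by simp [ξ]
  have hF0 : F x₀ = 0 := hF.eq_zero hxU hx₀
  have hsymm : ∀ p ∈ e'.target, ContDiffAt ℝ ∞ e'.symm p := by
    intro p hp
    have h1 : e'.symm p ∈ e'.source := e'.map_target hp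
    rw [hsrc] at h1
    obtain ⟨A, hA⟩ := hΨd _ h1.2.1.1 h1.2.1.2
    exact e'.contDiffAt_symm hp hA (hΨ _ h1.2.1.1)
  have hc0 : Continuous fun y : E2 => (y, (0 : ℝ)) := by fun_prop
  have htar : (fun y : E2 => (y, (0 : ℝ))) ⁻¹' e'.target ∈ 𝓝 0 := by
    refine hc0.continuousAt.preimage_mem_nhds (e'.open_target.mem_nhds ?_)
    have := e'.map_source hx'
    rwa [he', hξ0, hF0] at this
  obtain ⟨ρ, hρ, hball⟩ := Metric.mem_nhds_iff.1 htar
  refine ⟨⟨ρ, ξ, fun y => e'.symm (y, 0), e'.source ∩ ξ ⁻¹' Metric.ball 0 ρ, hρ,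
    ?_, ?_, ?_, ?_, ?_, ?_, ?_, ?_, ?_, ?_, ?_⟩⟩
  · exact e'.open_source.inter (Metric.isOpen_ball.preimage hξ.continuous)
  · exact ⟨hx', by simp [hξ0, hρ]⟩
  · rintro x ⟨hx, -⟩
    rw [hsrc] at hx
    exact interior_subset hx.2.2
  · exact hξ
  · exact hξ0
  · exact fun x hx => hx.2
  · intro y hy
    exact ((hsymm _ (hball hy)).comp y
      (contDiffAt_id.prodMk contDiffAt_const)).contDiffWithinAt
  · intro y hy
    refine ⟨e'.map_target (hball hy), ?_⟩
    have h := e'.right_inv (hball hy)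
    rw [he'] at h
    have h1 : ξ (e'.symm (y, 0)) = y := congrArg Prod.fst h
    rw [mem_preimage, h1]; exact hy
  · intro y hy
    have h := e'.right_inv (hball hy)
    rw [he'] at h
    have hm := e'.map_target (hball hy)
    rw [hsrc] at hm
    exact hF.mem_frontier hm.2.1.1 (congrArg Prod.snd h)
  · intro y hy
    have h := e'.right_inv (hball hy)
    rw [he'] at h
    exact congrArg Prod.fst h
  · rintro x hx ⟨hxs, -⟩
    have h := e'.left_inv hxs
    have hxs' := hxs
    rw [hsrc] at hxs'
    rw [he', hF.eq_zero hxs'.2.1.1 hx] at h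
    exact h

end SmoothDomain

/-! ### Calculus on the surface -/

namespace SmoothDomain

variable {O : SmoothDomain}

theorem normal_eq {U : Set E3} {F : E3 → ℝ} (hF : IsDefiningFunction O.carrier U F) {x : E3}
    (hx : x ∈ O.surface) (hxU : x ∈ U) : O.normal x = ‖∇ F x‖⁻¹ • ∇ F x :=
  (O.isOutwardNormal_normal hx).unique hx ⟨U, F, hxU, hF, rfl⟩

theorem gradient_eq {U : Set E3} {F : E3 → ℝ} (hF : IsDefiningFunction O.carrier U F) {x : E3}
    (hx : x ∈ O.surface) (hxU : x ∈ U) : ∇ F x = ‖∇ F x‖ • O.normal x := by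
  rw [normal_eq hF hx hxU, smul_smul,
    mul_inv_cancel₀ (norm_ne_zero_iff.2 (hF.gradient_ne_zero x hxU)), one_smul]

theorem contDiffOn_unit_gradient {U : Set E3} {F : E3 → ℝ}
    (hF : IsDefiningFunction O.carrier U F) :
    ContDiffOn ℝ ∞ (fun y => ‖∇ F y‖⁻¹ • ∇ F y) U :=
  ((hF.contDiffOn_gradient.norm ℝ hF.gradient_ne_zero).inv
    (fun y hy => norm_ne_zero_iff.2 (hF.gradient_ne_zero y hy))).smul hF.contDiffOn_gradient

theorem smoothOn_of_locally {F : Type*} [NormedAddCommGroup F] [NormedSpace ℝ F] {f : E3 → F}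
    (h : ∀ x ∈ O.surface, ∃ W, IsOpen W ∧ x ∈ W ∧ ContDiffOn ℝ ∞ f (O.surface ∩ W)) :
    O.SmoothOn f :=
  contDiffOn_of_locally_contDiffOn h

theorem smoothOn_normal : O.SmoothOn O.normal := by
  refine smoothOn_of_locally fun x hx => ?_
  obtain ⟨U, F, hxU, hF⟩ := O.smooth x hx
  refine ⟨U, hF.isOpen, hxU, ?_⟩
  exact ((contDiffOn_unit_gradient hF).mono inter_subset_right).congr
    fun y hy => normal_eq hF hy.1 hy.2

/-- The velocity of a curve in the surface is tangent. -/
theorem mem_tangent_of_hasDerivAt {c : ℝ → E3} {t : ℝ} {v : E3} (hc : HasDerivAt c v t)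
    (hM : ∀ᶠ s in 𝓝 t, c s ∈ O.surface) : v ∈ O.tangent (c t) := by
  have hx : c t ∈ O.surface := hM.self_of_nhds
  obtain ⟨U, F, hxU, hF⟩ := O.smooth _ hx
  have hFd : HasFDerivAt F (fderiv ℝ F (c t)) (c t) :=
    ((hF.contDiffAt hxU).differentiableAt (by simp)).hasFDerivAt
  have h1 := hFd.comp_hasDerivAt t hc
  have h2 : F ∘ c =ᶠ[𝓝 t] fun _ => 0 := by
    filter_upwards [hM, hc.continuousAt.eventually_mem (hF.isOpen.mem_nhds hxU)] with s h3 h4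
    exact hF.eq_zero h4 h3
  have h3 := h1.unique ((hasDerivAt_const t (0 : ℝ)).congr_of_eventuallyEq h2)
  rw [hF.fderiv_apply] at h3
  rw [mem_tangent, normal_eq hF hx hxU, real_inner_smul_left, h3, mul_zero]

theorem SmoothOn.hasFDerivWithinAt {F : Type*} [NormedAddCommGroup F] [NormedSpace ℝ F]
    {f : E3 → F} (hf : O.SmoothOn f) {x : E3} (hx : x ∈ O.surface) :
    HasFDerivWithinAt f (fderivWithin ℝ f O.surface x) O.surface x :=
  ((hf x hx).differentiableWithinAt (by simp)).hasFDerivWithinAt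

/-- The derivative of a smooth function along a curve in the surface. -/
theorem SmoothOn.comp_hasDerivAt {F : Type*} [NormedAddCommGroup F] [NormedSpace ℝ F]
    {f : E3 → F} (hf : O.SmoothOn f) {c : ℝ → E3} {t : ℝ} {v : E3} (hc : HasDerivAt c v t)
    (hM : ∀ᶠ s in 𝓝 t, c s ∈ O.surface) :
    HasDerivAt (fun s => f (c s)) (fderivWithin ℝ f O.surface (c t) v) t :=
  (hf.hasFDerivWithinAt hM.self_of_nhds).comp_hasDerivAt t hc hM

namespace Chart

variable {x₀ : E3} {V : Set E3} (C : O.Chart x₀ V)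

theorem ball_mem_nhds {y : E2} (hy : y ∈ Metric.ball 0 C.rad) : Metric.ball 0 C.rad ∈ 𝓝 y :=
  Metric.isOpen_ball.mem_nhds hy

theorem hasFDerivAt_Φ {y : E2} (hy : y ∈ Metric.ball 0 C.rad) :
    HasFDerivAt C.Φ (fderiv ℝ C.Φ y) y :=
  (((C.contDiffOn_Φ y hy).contDiffAt (C.ball_mem_nhds hy)).differentiableAt (by simp)).hasFDerivAt

theorem hasFDerivAt_ξ (x : E3) : HasFDerivAt C.ξ (fderiv ℝ C.ξ x) x :=
  (C.contDiff_ξ.contDiffAt.differentiableAt (by simp)).hasFDerivAt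

theorem fderiv_ξ_fderiv_Φ {y : E2} (hy : y ∈ Metric.ball 0 C.rad) (η : E2) :
    fderiv ℝ C.ξ (C.Φ y) (fderiv ℝ C.Φ y η) = η := by
  have h1 := (C.hasFDerivAt_ξ (C.Φ y)).comp y (C.hasFDerivAt_Φ hy)
  have h2 : C.ξ ∘ C.Φ =ᶠ[𝓝 y] id := by
    filter_upwards [C.ball_mem_nhds hy] with z hz
    exact C.ξ_Φ z hz
  have h3 := h1.unique ((hasFDerivAt_id y).congr_of_eventuallyEq h2)
  exact congrArg (fun A => A η) h3

theorem injective_fderiv_Φ {y : E2} (hy : y ∈ Metric.ball 0 C.rad) :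
    Function.Injective (fderiv ℝ C.Φ y) :=
  Function.LeftInverse.injective (C.fderiv_ξ_fderiv_Φ hy)

theorem hasDerivAt_line {y : E2} (hy : y ∈ Metric.ball 0 C.rad) (η : E2) :
    HasDerivAt (fun t : ℝ => C.Φ (y + t • η)) (fderiv ℝ C.Φ y η) 0 := by
  have h2 : HasDerivAt (fun t : ℝ => y + t • η) η 0 := by
    simpa using ((hasDerivAt_id (0 : ℝ)).smul_const η).const_add y
  have h1 : HasFDerivAt C.Φ (fderiv ℝ C.Φ y) (y + (0 : ℝ) • η) := by
    simpa using C.hasFDerivAt_Φ hy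
  exact h1.comp_hasDerivAt (0 : ℝ) h2

theorem eventually_line {y : E2} (hy : y ∈ Metric.ball 0 C.rad) (η : E2) :
    ∀ᶠ t in 𝓝 (0 : ℝ), y + t • η ∈ Metric.ball 0 C.rad := by
  have : ContinuousAt (fun t : ℝ => y + t • η) 0 := by fun_prop
  refine this.eventually_mem (Metric.isOpen_ball.mem_nhds (by simpa using hy))

theorem fderiv_Φ_mem_tangent {y : E2} (hy : y ∈ Metric.ball 0 C.rad) (η : E2) :
    fderiv ℝ C.Φ y η ∈ O.tangent (C.Φ y) := by
  have := mem_tangent_of_hasDerivAt (C.hasDerivAt_line hy η)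
    (by filter_upwards [C.eventually_line hy η] with t ht using C.Φ_mem _ ht)
  simpa using this

/-- Dimension count: the differential is injective from a plane into the two-dimensional tangent
space. -/
theorem exists_fderiv_Φ_eq {y : E2} (hy : y ∈ Metric.ball 0 C.rad) {τ : E3}
    (hτ : τ ∈ O.tangent (C.Φ y)) : ∃ η, fderiv ℝ C.Φ y η = τ := by
  have hle : LinearMap.range (fderiv ℝ C.Φ y).toLinearMap ≤ O.tangent (C.Φ y) := by
    rintro _ ⟨η, rfl⟩
    exact C.fderiv_Φ_mem_tangent hy η
  have hfr : Module.finrank ℝ (LinearMap.range (fderiv ℝ C.Φ y).toLinearMap) =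
      Module.finrank ℝ (O.tangent (C.Φ y)) := by
    rw [LinearMap.finrank_range_of_inj (C.injective_fderiv_Φ hy),
      finrank_tangent (C.Φ_mem y hy)]
    simp
  have heq := Submodule.eq_of_le_of_finrank_eq hle hfr
  rw [← heq] at hτ
  exact hτ

theorem mem_ball_ξ {x : E3} (hxW : x ∈ C.W) : C.ξ x ∈ Metric.ball 0 C.rad := C.mapsTo hxW

theorem smoothOn_comp {F : Type*} [NormedAddCommGroup F] [NormedSpace ℝ F] {f : E3 → F}
    (hf : O.SmoothOn f) : ContDiffOn ℝ ∞ (fun y => f (C.Φ y)) (Metric.ball 0 C.rad) :=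
  ContDiffOn.comp hf C.contDiffOn_Φ C.Φ_mem

theorem fderiv_comp_Φ {F : Type*} [NormedAddCommGroup F] [NormedSpace ℝ F] {f : E3 → F}
    (hf : O.SmoothOn f) {y : E2} (hy : y ∈ Metric.ball 0 C.rad) (η : E2) :
    fderiv ℝ (fun y => f (C.Φ y)) y η = fderivWithin ℝ f O.surface (C.Φ y) (fderiv ℝ C.Φ y η) := by
  have h1 : HasFDerivAt (fun y => f (C.Φ y))
      (fderivWithin ℝ f O.surface (C.Φ y) ∘L fderiv ℝ C.Φ y) y := by
    refine (hf.hasFDerivWithinAt (C.Φ_mem y hy)).comp_hasFDerivAt y (C.hasFDerivAt_Φ hy) ?_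
    filter_upwards [C.ball_mem_nhds hy] with z hz using C.Φ_mem z hz
  rw [h1.fderiv]; rfl

/-- Writes the derivative on tangent vectors through the smooth maps Φ and ξ, which makes its smooth
dependence on the point visible. -/
theorem fderivWithin_eq {F : Type*} [NormedAddCommGroup F] [NormedSpace ℝ F] {f : E3 → F}
    (hf : O.SmoothOn f) {x τ : E3} (hx : x ∈ O.surface) (hxW : x ∈ C.W) (hτ : τ ∈ O.tangent x) :
    fderivWithin ℝ f O.surface x τ =
      fderiv ℝ (fun y => f (C.Φ y)) (C.ξ x) (fderiv ℝ C.ξ x τ) := by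
  have hy := C.mem_ball_ξ hxW
  have hxe := C.Φ_ξ x hx hxW
  obtain ⟨η, hη⟩ := C.exists_fderiv_Φ_eq hy (by rwa [hxe] : τ ∈ O.tangent (C.Φ (C.ξ x)))
  have h1 := C.fderiv_ξ_fderiv_Φ hy η
  rw [hη, hxe] at h1
  rw [h1, C.fderiv_comp_Φ hf hy, hη, hxe]

end Chart

/-- Every tangent vector is the velocity of a curve in the surface. -/
theorem exists_curve {x τ : E3} (hx : x ∈ O.surface) (hτ : τ ∈ O.tangent x) :
    ∃ c : ℝ → E3, c 0 = x ∧ HasDerivAt c τ 0 ∧ ∀ᶠ t in 𝓝 (0 : ℝ), c t ∈ O.surface := by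
  obtain ⟨C⟩ := exists_chart hx univ_mem
  have hy := C.mem_ball_ξ C.mem_W
  have hxe := C.Φ_ξ x hx C.mem_W
  obtain ⟨η, hη⟩ := C.exists_fderiv_Φ_eq hy (by rwa [hxe] : τ ∈ O.tangent (C.Φ (C.ξ x)))
  refine ⟨fun t => C.Φ (C.ξ x + t • η), by simp [hxe], hη ▸ C.hasDerivAt_line hy η, ?_⟩
  filter_upwards [C.eventually_line hy η] with t ht using C.Φ_mem _ ht

/-- The derivative within the surface, precomposed with the projection to the tangent plane. -/
noncomputable def tderiv (O : SmoothDomain) {F : Type*} [NormedAddCommGroup F] [NormedSpace ℝ F]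
    (f : E3 → F) (x : E3) : E3 →L[ℝ] F :=
  fderivWithin ℝ f O.surface x ∘L (O.tangent x).starProjection

theorem tderiv_apply_of_mem {F : Type*} [NormedAddCommGroup F] [NormedSpace ℝ F] {f : E3 → F}
    {x τ : E3} (hτ : τ ∈ O.tangent x) : O.tderiv f x τ = fderivWithin ℝ f O.surface x τ := by
  simp [tderiv, tangent_starProjection_of_mem hτ]

theorem smoothOn_starProjection :
    O.SmoothOn fun x => (O.tangent x).starProjection := by
  have h : O.SmoothOn fun x => ContinuousLinearMap.id ℝ E3 -
      (innerSL ℝ (O.normal x)).smulRight (O.normal x) :=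
    contDiffOn_const.sub
      (((innerSL ℝ : E3 →L[ℝ] E3 →L[ℝ] ℝ).contDiff.comp_contDiffOn smoothOn_normal).smulRight
        smoothOn_normal)
  refine h.congr fun x hx => ?_
  ext1 v
  rw [starProjection_tangent hx]
  simp

/-- The derivative within M is arbitrary in the normal direction and need not vary smoothly. After
projection only its tangential part remains, and in a chart that part is a composition of smooth
maps. -/
theorem SmoothOn.tderiv {F : Type*} [NormedAddCommGroup F] [NormedSpace ℝ F] {f : E3 → F}
    (hf : O.SmoothOn f) : O.SmoothOn (O.tderiv f) := by
  refine smoothOn_of_locally fun x hx => ?_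
  obtain ⟨C⟩ := exists_chart hx univ_mem
  refine ⟨C.W, C.isOpen_W, C.mem_W, ?_⟩
  have h1 : ContDiffOn ℝ ∞ (fun x => fderiv ℝ (fun y => f (C.Φ y)) (C.ξ x)) (O.surface ∩ C.W) :=
    ((C.smoothOn_comp hf).fderiv_of_isOpen (m := ∞) Metric.isOpen_ball (by simp)).comp
      C.contDiff_ξ.contDiffOn (fun x hx => C.mem_ball_ξ hx.2)
  have h2 : ContDiffOn ℝ ∞ (fun x => fderiv ℝ C.ξ x) (O.surface ∩ C.W) :=
    (C.contDiff_ξ.fderiv_right (m := ∞) (by simp)).contDiffOn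
  have h3 : ContDiffOn ℝ ∞ (fun x => (O.tangent x).starProjection) (O.surface ∩ C.W) :=
    smoothOn_starProjection.mono inter_subset_left
  refine ((h1.clm_comp h2).clm_comp h3).congr fun z hz => ?_
  ext1 v
  exact C.fderivWithin_eq hf hz.1 hz.2 (Submodule.starProjection_apply_mem _ v)

/-! ### Gradient, divergence and curvature in terms of the ambient space and of frames. -/

theorem inner_grad {f : E3 → ℝ} {x τ : E3} (hτ : τ ∈ O.tangent x) :
    inner ℝ (O.grad f x) τ = fderivWithin ℝ f O.surface x τ := by
  rw [grad, inner_starProjection_left hτ, gradientWithin,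
    ← InnerProductSpace.toDual_apply_apply (𝕜 := ℝ), LinearIsometryEquiv.apply_symm_apply]

theorem grad_mem_tangent (f : E3 → ℝ) (x : E3) : O.grad f x ∈ O.tangent x :=
  Submodule.starProjection_apply_mem _ _

theorem grad_eq (f : E3 → ℝ) (x : E3) :
    O.grad f x = (InnerProductSpace.toDual ℝ E3).symm (O.tderiv f x) := by
  apply ext_inner_right ℝ
  intro w
  rw [← InnerProductSpace.toDual_apply_apply (𝕜 := ℝ)
    (x := (InnerProductSpace.toDual ℝ E3).symm (O.tderiv f x)),
    LinearIsometryEquiv.apply_symm_apply, grad, Submodule.inner_starProjection_left_eq_right,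
    gradientWithin, ← InnerProductSpace.toDual_apply_apply (𝕜 := ℝ),
    LinearIsometryEquiv.apply_symm_apply]
  rfl

theorem SmoothOn.grad {f : E3 → ℝ} (hf : O.SmoothOn f) : O.SmoothOn (O.grad f) :=
  ((InnerProductSpace.toDual ℝ E3).symm.contDiff.comp_contDiffOn hf.tderiv).congr
    fun x _ => grad_eq f x

theorem covDeriv_eq {u : E3 → E3} {x v : E3} (hv : v ∈ O.tangent x) :
    O.covDeriv u x v = (O.tangent x).starProjection (O.tderiv u x v) := by
  rw [covDeriv, tderiv_apply_of_mem hv]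

/-- Cyclicity of the trace moves it from the varying tangent plane to the fixed space, where
continuity in the point can be read off. -/
theorem div_eq_trace (u : E3 → E3) (x : E3) :
    O.div u x = LinearMap.trace ℝ E3 (O.tderiv u x).toLinearMap := by
  rw [div, tangentialDeriv, tderiv]
  exact LinearMap.trace_comp_comm' ((fderivWithin ℝ u O.surface x ∘L
    (O.tangent x).subtypeL).toLinearMap) ((O.tangent x).orthogonalProjectionOnto.toLinearMap)

theorem SmoothOn.continuousOn_div {u : E3 → E3} (hu : O.SmoothOn u) :
    ContinuousOn (O.div u) O.surface := by
  let T : (E3 →L[ℝ] E3) →ₗ[ℝ] ℝ :=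
    (LinearMap.trace ℝ E3) ∘ₗ (ContinuousLinearMap.coeLM ℝ)
  have hT : Continuous T := T.continuous_of_finiteDimensional
  refine (hT.comp_continuousOn hu.tderiv.continuousOn).congr fun x _ => ?_
  exact div_eq_trace u x

theorem exists_orthonormalBasis_tangent {x a : E3} (hx : x ∈ O.surface) (ha : a ∈ O.tangent x)
    (ha1 : ‖a‖ = 1) : ∃ b : OrthonormalBasis (Fin 2) ℝ (O.tangent x),
      (b 0 : E3) = a ∧ (b 1 : E3) = O.J x a := by
  have hJ := O.J_mem_tangent x a
  let v : Fin 2 → O.tangent x := ![⟨a, ha⟩, ⟨O.J x a, hJ⟩]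
  have hna : inner ℝ (O.normal x) a = 0 := mem_tangent.1 ha
  have hv : Orthonormal ℝ v := by
    rw [orthonormal_iff_ite]
    have h1 : inner ℝ a a = 1 := by rw [real_inner_self_eq_norm_sq, ha1, one_pow]
    have h2 : inner ℝ (O.J x a) (O.J x a) = 1 := by
      rw [J, inner_cross_cross_self (norm_normal hx) hna, h1]
    have h3 : inner ℝ a (O.J x a) = 0 := inner_cross_right_self _ _
    have h4 : inner ℝ (O.J x a) a = 0 := by rw [real_inner_comm]; exact h3
    intro i j
    have h5 : ‖O.J x a‖ = 1 := by
      rw [norm_eq_sqrt_real_inner, h2, Real.sqrt_one]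
    fin_cases i <;> fin_cases j <;> simp [v, Submodule.coe_inner, ha1, h3, h4, h5]
  let b := basisOfOrthonormalOfCardEqFinrank hv (by rw [finrank_tangent hx]; simp)
  have hb : ⇑b = v := coe_basisOfOrthonormalOfCardEqFinrank hv _
  refine ⟨b.toOrthonormalBasis (by rw [hb]; exact hv), ?_, ?_⟩ <;> simp [hb, v]

theorem inner_tangentialDeriv (u : E3 → E3) {x : E3} (a b : O.tangent x) :
    inner ℝ (O.tangentialDeriv u x a) b = inner ℝ (fderivWithin ℝ u O.surface x a) (b : E3) := by
  rw [Submodule.coe_inner, tangentialDeriv]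
  change inner ℝ ((O.tangent x).starProjection (fderivWithin ℝ u O.surface x a)) (b : E3) = _
  exact inner_starProjection_left b.2

/-- The divergence computed in the orthogonal frame `a`, `J a`. -/
theorem norm_sq_mul_div (u : E3 → E3) {x a : E3} (hx : x ∈ O.surface) (ha : a ∈ O.tangent x) :
    ‖a‖ ^ 2 * O.div u x = inner ℝ (fderivWithin ℝ u O.surface x a) a +
      inner ℝ (fderivWithin ℝ u O.surface x (O.J x a)) (O.J x a) := by
  rcases eq_or_ne a 0 with rfl | h0
  · have : O.J x 0 = 0 := (crossL (O.normal x)).map_zero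
    simp [this]
  have hr : ‖a‖ ≠ 0 := norm_ne_zero_iff.2 h0
  -- Both sides are homogeneous of degree two in a, so a unit vector suffices.
  set c := ‖a‖⁻¹ • a with hc
  have hac : a = ‖a‖ • c := by rw [hc, smul_smul, mul_inv_cancel₀ hr, one_smul]
  obtain ⟨b, hb0, hb1⟩ := exists_orthonormalBasis_tangent hx
    ((O.tangent x).smul_mem ‖a‖⁻¹ ha) (by rw [norm_smul, norm_inv, norm_norm, inv_mul_cancel₀ hr])
  have h1 : O.div u x = inner ℝ (fderivWithin ℝ u O.surface x c) c +
      inner ℝ (fderivWithin ℝ u O.surface x (O.J x c)) (O.J x c) := by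
    rw [div, LinearMap.trace_eq_sum_inner _ b, Fin.sum_univ_two,
      real_inner_comm, real_inner_comm _ (b 1)]
    have e0 := inner_tangentialDeriv u (b 0) (b 0)
    have e1 := inner_tangentialDeriv u (b 1) (b 1)
    rw [hb0] at e0
    rw [hb1] at e1
    exact congrArg₂ _ e0 e1
  have hJ : O.J x a = ‖a‖ • O.J x c := by
    conv_lhs => rw [hac]
    exact cross_smul_right _ _ _
  rw [hJ, h1]
  conv_rhs => rw [hac]
  have hn : ‖‖a‖ • c‖ = ‖a‖ := by rw [← hac]
  simp only [map_smul, inner_smul_left, inner_smul_right, RCLike.conj_to_real, hn]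
  ring

/-- The Gauss curvature computed in the orthogonal frame `a`, `J a`. -/
theorem norm_pow_mul_gaussCurvature {x a : E3} (hx : x ∈ O.surface) (ha : a ∈ O.tangent x) :
    ‖a‖ ^ 4 * O.gaussCurvature x =
      inner ℝ (fderivWithin ℝ O.normal O.surface x a) a *
      inner ℝ (fderivWithin ℝ O.normal O.surface x (O.J x a)) (O.J x a) -
      inner ℝ (fderivWithin ℝ O.normal O.surface x a) (O.J x a) *
      inner ℝ (fderivWithin ℝ O.normal O.surface x (O.J x a)) a := by
  rcases eq_or_ne a 0 with rfl | h0
  · have : O.J x 0 = 0 := (crossL (O.normal x)).map_zero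
    simp [this]
  have hr : ‖a‖ ≠ 0 := norm_ne_zero_iff.2 h0
  -- Both sides are homogeneous of degree four in a.
  set c := ‖a‖⁻¹ • a with hc
  have hac : a = ‖a‖ • c := by rw [hc, smul_smul, mul_inv_cancel₀ hr, one_smul]
  obtain ⟨b, hb0, hb1⟩ := exists_orthonormalBasis_tangent hx
    ((O.tangent x).smul_mem ‖a‖⁻¹ ha) (by rw [norm_smul, norm_inv, norm_norm, inv_mul_cancel₀ hr])
  have h1 : O.gaussCurvature x =
      inner ℝ (fderivWithin ℝ O.normal O.surface x c) c *
      inner ℝ (fderivWithin ℝ O.normal O.surface x (O.J x c)) (O.J x c) -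
      inner ℝ (fderivWithin ℝ O.normal O.surface x c) (O.J x c) *
      inner ℝ (fderivWithin ℝ O.normal O.surface x (O.J x c)) c := by
    have e : ∀ i j, LinearMap.toMatrix b.toBasis b.toBasis
        (O.tangentialDeriv O.normal x).toLinearMap i j =
        inner ℝ (fderivWithin ℝ O.normal O.surface x (b j)) (b i : E3) := by
      intro i j
      rw [LinearMap.toMatrix_apply, ← inner_tangentialDeriv, real_inner_comm]
      simp [OrthonormalBasis.repr_apply_apply]
    rw [gaussCurvature, ContinuousLinearMap.det, ← LinearMap.det_toMatrix b.toBasis,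
      Matrix.det_fin_two, e, e, e, e, hb0, hb1]
    ring
  have hJ : O.J x a = ‖a‖ • O.J x c := by
    conv_lhs => rw [hac]
    exact cross_smul_right _ _ _
  rw [hJ, h1]
  conv_rhs => rw [hac]
  have hn : ‖‖a‖ • c‖ = ‖a‖ := by rw [← hac]
  simp only [map_smul, inner_smul_left, inner_smul_right, RCLike.conj_to_real, hn]
  ring

end SmoothDomain

/-! ### The Gauss map of a surface of revolution with positive curvature -/

namespace SmoothDomain

variable {O : SmoothDomain}

/-- Differentiate ∇F = |∇F| ν along a curve in M: the derivative of |∇F| multiplies ν and drops out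
against a tangent vector. Thus the Hessian of F on the tangent plane is a positive multiple of the
second fundamental form. -/
theorem inner_fderiv_gradient {U : Set E3} {F : E3 → ℝ} (hF : IsDefiningFunction O.carrier U F)
    {x : E3} (hx : x ∈ O.surface) (hxU : x ∈ U) {a b : E3} (ha : a ∈ O.tangent x)
    (hb : b ∈ O.tangent x) :
    inner ℝ (fderiv ℝ (∇ F) x a) b =
      ‖∇ F x‖ * inner ℝ (fderivWithin ℝ O.normal O.surface x a) b := by
  obtain ⟨c, rfl, hc, hM⟩ := exists_curve hx ha
  have hgd : HasFDerivAt (∇ F) (fderiv ℝ (∇ F) (c 0)) (c 0) :=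
    ((hF.contDiffOn_gradient.contDiffAt (hF.isOpen.mem_nhds hxU)).differentiableAt
      (by simp)).hasFDerivAt
  have h1 := hgd.comp_hasDerivAt 0 hc
  have h2 := smoothOn_normal.comp_hasDerivAt hc hM
  have h3 := (((hgd.differentiableAt.norm ℝ (hF.gradient_ne_zero _ hxU)).hasFDerivAt).comp_hasDerivAt
    0 hc)
  have h4 := h3.mul (h2.inner ℝ (hasDerivAt_const (0 : ℝ) b))
  have h5 := h1.inner ℝ (hasDerivAt_const (0 : ℝ) b)
  have h6 := h5.unique (h4.congr_of_eventuallyEq ?_)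
  · rw [mem_tangent] at hb
    simp only [inner_zero_right, zero_add, hb, mul_zero, Function.comp_apply] at h6
    exact h6
  · filter_upwards [hM, hc.continuousAt.eventually_mem (hF.isOpen.mem_nhds hxU)] with t h7 h8
    simp only [Function.comp_apply, Pi.mul_apply]
    conv_lhs => rw [gradient_eq hF h7 h8, real_inner_smul_left]

/-- The second fundamental form is symmetric. -/
theorem inner_fderivWithin_normal_comm {x : E3} (hx : x ∈ O.surface) {a b : E3}
    (ha : a ∈ O.tangent x) (hb : b ∈ O.tangent x) :
    inner ℝ (fderivWithin ℝ O.normal O.surface x a) b =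
      inner ℝ (fderivWithin ℝ O.normal O.surface x b) a := by
  obtain ⟨U, F, hxU, hF⟩ := O.smooth x hx
  have hne : ‖∇ F x‖ ≠ 0 := norm_ne_zero_iff.2 (hF.gradient_ne_zero x hxU)
  -- Through the Riesz isomorphism the derivative of ∇F is the second derivative of F, whose
  -- symmetry is what is needed.
  have hd : ∀ v w, inner ℝ (fderiv ℝ (∇ F) x v) w = fderiv ℝ (fderiv ℝ F) x v w := by
    intro v w
    have h1 : HasFDerivAt (fderiv ℝ F) (fderiv ℝ (fderiv ℝ F) x) x :=
      (((hF.contDiffAt hxU).fderiv_right (m := ∞) (by simp)).differentiableAt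
        (by simp)).hasFDerivAt
    have h2 := ((InnerProductSpace.toDual ℝ E3).symm.toContinuousLinearEquiv.hasFDerivAt).comp x h1
    have h3 : fderiv ℝ (∇ F) x = _ := h2.fderiv
    rw [h3, ← InnerProductSpace.toDual_apply_apply (𝕜 := ℝ)]
    exact congrArg (fun A : E3 →L[ℝ] ℝ => A w)
      (LinearIsometryEquiv.apply_symm_apply (InnerProductSpace.toDual ℝ E3) _)
  have hs : IsSymmSndFDerivAt ℝ F x := (hF.contDiffAt hxU).isSymmSndFDerivAt (by
    simp only [minSmoothness_of_isRCLikeNormedField]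
    exact WithTop.coe_le_coe.2 (le_top : (2 : ℕ∞) ≤ ⊤))
  apply mul_left_cancel₀ hne
  rw [← inner_fderiv_gradient hF hx hxU ha hb, ← inner_fderiv_gradient hF hx hxU hb ha, hd, hd]
  exact hs a b

theorem fderivWithin_normal_mem_tangent {x : E3} (hx : x ∈ O.surface) {a : E3}
    (ha : a ∈ O.tangent x) : fderivWithin ℝ O.normal O.surface x a ∈ O.tangent x := by
  obtain ⟨c, rfl, hc, hM⟩ := exists_curve hx ha
  have h2 := smoothOn_normal.comp_hasDerivAt hc hM
  have h3 := (h2.inner ℝ h2).unique ((hasDerivAt_const (0 : ℝ) (1 : ℝ)).congr_of_eventuallyEq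
    (by filter_upwards [hM] with t ht; simp [norm_normal ht]))
  rw [mem_tangent]
  rw [real_inner_comm (O.normal (c 0))] at h3
  linarith

/-! ### Rotation invariance of the normal and of the tangent planes. -/

theorem X₃_mem_tangent (hrot : O.IsRotationInvariant) {x : E3} (hx : x ∈ O.surface) :
    X₃ x ∈ O.tangent x := by
  have h := hasDerivAt_rot 0 x
  rw [rot_zero] at h
  have := mem_tangent_of_hasDerivAt h (Eventually.of_forall fun s => hrot s x hx)
  rwa [rot_zero] at this

theorem SmoothOn.hasDerivAt_rot (hrot : O.IsRotationInvariant) {F : Type*} [NormedAddCommGroup F]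
    [NormedSpace ℝ F] {f : E3 → F} (hf : O.SmoothOn f) {x : E3} (hx : x ∈ O.surface) (s : ℝ) :
    HasDerivAt (fun t => f (rot t x)) (fderivWithin ℝ f O.surface (rot s x) (X₃ (rot s x))) s :=
  hf.comp_hasDerivAt (_root_.hasDerivAt_rot s x) (Eventually.of_forall fun t => hrot t x hx)

theorem rot_mem_tangent (hrot : O.IsRotationInvariant) {x τ : E3} (hx : x ∈ O.surface)
    (hτ : τ ∈ O.tangent x) (s : ℝ) : rot s τ ∈ O.tangent (rot s x) := by
  obtain ⟨c, rfl, hc, hM⟩ := exists_curve hx hτ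
  have h : HasDerivAt (fun t => rot s (c t)) (rot s τ) 0 :=
    (rotE s).toContinuousLinearEquiv.hasFDerivAt.comp_hasDerivAt 0 hc
  have h2 : ∀ᶠ t in 𝓝 (0 : ℝ), rot s (c t) ∈ O.surface := by
    filter_upwards [hM] with t ht using hrot s _ ht
  have h3 := mem_tangent_of_hasDerivAt h h2
  exact h3

/-- Rotations carry tangent planes to tangent planes, so the normal at the rotated point is plus or
minus the rotated normal. The sign depends continuously on the angle and is + at angle zero. -/
theorem normal_rot (hrot : O.IsRotationInvariant) {x : E3} (hx : x ∈ O.surface) (s : ℝ) :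
    O.normal (rot s x) = rot s (O.normal x) := by
  have hr : ∀ t, rot t x ∈ O.surface := fun t => hrot t x hx
  have hsq : ∀ t, inner ℝ (O.normal (rot t x)) (rot t (O.normal x)) ^ 2 = 1 := by
    intro t
    set m := rot (-t) (O.normal (rot t x)) with hm
    have hmn : rot t m = O.normal (rot t x) := by rw [hm, rot_rot_neg]
    have hm1 : ‖m‖ = 1 := by rw [hm, norm_rot, norm_normal (hr t)]
    have hperp : m ∈ (O.tangent x)ᗮ := by
      rw [Submodule.mem_orthogonal']
      intro τ hτ
      have := mem_tangent.1 (rot_mem_tangent hrot hx hτ t)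
      rwa [← hmn, inner_rot_rot] at this
    rw [tangent, Submodule.orthogonal_orthogonal] at hperp
    obtain ⟨k, hk⟩ := Submodule.mem_span_singleton.1 hperp
    rw [← hmn, inner_rot_rot, ← hk, real_inner_smul_left, real_inner_self_eq_norm_sq,
      norm_normal hx]
    rw [← hk, norm_smul, norm_normal hx, mul_one, Real.norm_eq_abs] at hm1
    rw [one_pow, mul_one, ← sq_abs, hm1, one_pow]
  have hcont : Continuous fun t => inner ℝ (O.normal (rot t x)) (rot t (O.normal x)) := by
    have h1 : Continuous fun t => O.normal (rot t x) :=
      continuous_iff_continuousAt.2 fun t =>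
        (smoothOn_normal.hasDerivAt_rot hrot hx t).continuousAt
    have h2 : Continuous fun t => rot t (O.normal x) :=
      continuous_iff_continuousAt.2 fun t => (_root_.hasDerivAt_rot t _).continuousAt
    exact h1.inner h2
  have h1 : inner ℝ (O.normal (rot s x)) (rot s (O.normal x)) = 1 := by
    have h := isPreconnected_univ.eq_of_sq_eq (f := fun t => inner ℝ (O.normal (rot t x))
      (rot t (O.normal x))) (g := fun _ => 1) hcont.continuousOn continuousOn_const
      (fun t _ => by simpa using hsq t) (fun _ => one_ne_zero) (y := 0) (mem_univ _)
      (by simp [rot_zero, norm_normal hx])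
    exact h (mem_univ s)
  exact (inner_eq_one_iff_of_norm_eq_one (norm_normal (hr s))
    (by rw [norm_rot, norm_normal hx])).1 h1

/-- Derivative at t = 0 of v(R_t x) = R_t v(x). -/
theorem fderivWithin_X₃_eq_of_equivariant (hrot : O.IsRotationInvariant) {v : E3 → E3}
    (hv : O.SmoothOn v) (heq : ∀ s, ∀ x ∈ O.surface, v (rot s x) = rot s (v x))
    {x : E3} (hx : x ∈ O.surface) :
    fderivWithin ℝ v O.surface x (X₃ x) = X₃ (v x) := by
  have h1 := hv.hasDerivAt_rot hrot hx 0
  have h2 := _root_.hasDerivAt_rot 0 (v x)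
  have h3 : (fun t => v (rot t x)) = fun t => rot t (v x) := funext fun t => heq t x hx
  rw [h3] at h1
  have := h1.unique h2
  rwa [rot_zero, rot_zero] at this

theorem fderivWithin_normal_X₃ (hrot : O.IsRotationInvariant) {x : E3} (hx : x ∈ O.surface) :
    fderivWithin ℝ O.normal O.surface x (X₃ x) = X₃ (O.normal x) :=
  fderivWithin_X₃_eq_of_equivariant hrot smoothOn_normal (fun s _ hx => normal_rot hrot hx s) hx

/-- The inner product of the normal and the horizontal part of the position. -/
noncomputable def kap (O : SmoothDomain) (x : E3) : ℝ := O.normal x 0 * x 0 + O.normal x 1 * x 1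

theorem inner_X₃_normal_X₃ (x : E3) : inner ℝ (X₃ (O.normal x)) (X₃ x) = O.kap x := by
  rw [E3_inner_eq]; simp [kap]; ring

theorem inner_shape_X₃ (hrot : O.IsRotationInvariant) {x : E3} (hx : x ∈ O.surface) :
    inner ℝ (fderivWithin ℝ O.normal O.surface x (X₃ x)) (X₃ x) = O.kap x := by
  rw [fderivWithin_normal_X₃ hrot hx, inner_X₃_normal_X₃]

/-- The horizontal part of a vector. -/
noncomputable def horiz (x : E3) : E3 := !₂[x 0, x 1, 0]

@[simp] theorem horiz_zero_apply (x : E3) : horiz x 0 = x 0 := by simp [horiz]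
@[simp] theorem horiz_one_apply (x : E3) : horiz x 1 = x 1 := by simp [horiz]
@[simp] theorem horiz_two_apply (x : E3) : horiz x 2 = 0 := by simp [horiz]

theorem rsq_add_smul_horiz (x : E3) (t : ℝ) : rsq (x + t • horiz x) = (1 + t) ^ 2 * rsq x := by
  simp [rsq]; ring

/-- The distance to the axis is maximal over the compact closure at a boundary point, because from
an interior point off the axis one can still move outwards. -/
theorem rsq_le_of_mem_carrier {x₁ : E3} (hx₁ : x₁ ∈ O.surface)
    (hmax : ∀ y ∈ O.surface, rsq y ≤ rsq x₁) (hpos : 0 < rsq x₁) {y : E3} (hy : y ∈ O.carrier) :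
    rsq y ≤ rsq x₁ := by
  have hcpt : IsCompact (closure O.carrier) := O.isBounded.isCompact_closure
  obtain ⟨z, hz, hzmax⟩ := hcpt.exists_isMaxOn ⟨x₁, frontier_subset_closure hx₁⟩
    contDiff_rsq.continuous.continuousOn
  have h1 : rsq x₁ ≤ rsq z := hzmax (frontier_subset_closure hx₁)
  refine (hzmax (subset_closure hy)).trans (hmax z ?_)
  refine ⟨hz, fun hzi => ?_⟩
  have hzO : z ∈ O.carrier := interior_subset hzi
  have hc : ContinuousAt (fun t : ℝ => z + t • horiz z) 0 := by fun_prop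
  have hev : ∀ᶠ t in 𝓝[>] (0 : ℝ), z + t • horiz z ∈ O.carrier :=
    (hc.eventually_mem (O.isOpen.mem_nhds (by simpa using hzO))).filter_mono nhdsWithin_le_nhds
  obtain ⟨t, ht, ht0⟩ := (hev.and self_mem_nhdsWithin).exists
  have ht0' : (0 : ℝ) < t := ht0
  have h2 : rsq (z + t • horiz z) ≤ rsq z := hzmax (subset_closure ht)
  rw [rsq_add_smul_horiz] at h2
  nlinarith [mul_pos ht0' (hpos.trans_le h1), mul_pos (mul_pos ht0' ht0') (hpos.trans_le h1)]

/-- At a point farthest from the axis the horizontal part of the position is normal to M, and the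
outward normal points away from the axis. This fixes the sign of the second fundamental form at one
point. -/
theorem exists_kap_pos (hne : O.surface.Nonempty) :
    ∃ x ∈ O.surface, 0 < rsq x ∧ 0 < O.kap x := by
  obtain ⟨x, hx, hmax⟩ := O.isCompact_surface.exists_isMaxOn hne contDiff_rsq.continuous.continuousOn
  have hn1 := norm_normal hx
  have hpos : 0 < rsq x := by
    refine lt_of_le_of_ne (rsq_nonneg x) fun h0 => ?_
    -- Otherwise M lies on the axis, so all tangent vectors are vertical, which is impossible for a
    -- plane.
    have hz : ∀ y ∈ O.surface, y 0 = 0 ∧ y 1 = 0 := by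
      intro y hy
      have h1 : rsq y ≤ rsq x := hmax hy
      rw [← h0] at h1
      unfold rsq at h1
      constructor <;> nlinarith [sq_nonneg (y 0), sq_nonneg (y 1)]
    have hT : ∀ τ ∈ O.tangent x, τ 0 = 0 ∧ τ 1 = 0 := by
      intro τ hτ
      obtain ⟨c, rfl, hc, hM⟩ := exists_curve hx hτ
      have hi : ∀ i : Fin 3, HasDerivAt (fun t => c t i) (τ i) 0 := fun i =>
        (EuclideanSpace.proj i : E3 →L[ℝ] ℝ).hasFDerivAt.comp_hasDerivAt 0 hc
      refine ⟨(hi 0).unique ((hasDerivAt_const (0 : ℝ) (0 : ℝ)).congr_of_eventuallyEq ?_),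
        (hi 1).unique ((hasDerivAt_const (0 : ℝ) (0 : ℝ)).congr_of_eventuallyEq ?_)⟩
      · filter_upwards [hM] with t ht using (hz _ ht).1
      · filter_upwards [hM] with t ht using (hz _ ht).2
    have h1 := hT _ (O.J_mem_tangent x !₂[1, 0, 0])
    have h3 := hT _ (O.J_mem_tangent x e₃)
    simp [J] at h1 h3
    have : O.normal x = 0 := E3_ext (by simp [h3]) (by simp [h3]) (by simp [h1])
    simp [this] at hn1
  refine ⟨x, hx, hpos, ?_⟩
  have hperp : ∀ τ ∈ O.tangent x, inner ℝ (horiz x) τ = 0 := by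
    intro τ hτ
    obtain ⟨c, rfl, hc, hM⟩ := exists_curve hx hτ
    have hi : ∀ i : Fin 3, HasDerivAt (fun t => c t i) (τ i) 0 := fun i =>
      (EuclideanSpace.proj i : E3 →L[ℝ] ℝ).hasFDerivAt.comp_hasDerivAt 0 hc
    have h1 : HasDerivAt (fun t => rsq (c t)) _ 0 := ((hi 0).pow 2).add ((hi 1).pow 2)
    have h2 : IsLocalMax (fun t => rsq (c t)) 0 := by
      filter_upwards [hM] with t ht using hmax ht
    have h3 := h2.hasDerivAt_eq_zero h1
    simp at h3
    rw [E3_inner_eq]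
    simp
    linarith
  have hk : horiz x = O.kap x • O.normal x := by
    have h0 : horiz x ∈ (O.tangent x)ᗮ := by
      rw [Submodule.mem_orthogonal']
      exact hperp
    rw [tangent, Submodule.orthogonal_orthogonal] at h0
    obtain ⟨k, hk⟩ := Submodule.mem_span_singleton.1 h0
    have : inner ℝ (O.normal x) (horiz x) = O.kap x := by rw [E3_inner_eq]; simp [kap]
    rw [← hk, real_inner_smul_right, real_inner_self_eq_norm_sq, hn1] at this
    rw [← hk, ← this]; simp
  -- If the normal pointed towards the axis, then points slightly farther out would belong to the
  -- domain, against maximality.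
  by_contra hle
  have hne0 : O.kap x ≠ 0 := by
    intro h
    rw [h, zero_smul] at hk
    have h0 : x 0 = 0 := by rw [← horiz_zero_apply, hk]; simp
    have h1 : x 1 = 0 := by rw [← horiz_one_apply, hk]; simp
    simp [rsq, h0, h1] at hpos
  have hneg : O.kap x < 0 := lt_of_le_of_ne (not_lt.1 hle) hne0
  obtain ⟨U, F, hxU, hF⟩ := O.smooth x hx
  have hd := hF.hasDerivAt_line hxU (horiz x)
  have hdn : inner ℝ (∇ F x) (horiz x) < 0 := by
    rw [gradient_eq hF hx hxU, hk, real_inner_smul_left, real_inner_smul_right,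
      real_inner_self_eq_norm_sq, hn1]
    have := norm_pos_iff.2 (hF.gradient_ne_zero x hxU)
    nlinarith
  have hs := (hasDerivAt_iff_tendsto_slope.1 hd).mono_left (nhdsGT_le_nhdsNE (0 : ℝ))
  have hc : ContinuousAt (fun t : ℝ => x + t • horiz x) 0 := by fun_prop
  have hev : ∀ᶠ t in 𝓝[>] (0 : ℝ), x + t • horiz x ∈ U :=
    (hc.eventually_mem (hF.isOpen.mem_nhds (by simpa using hxU))).filter_mono nhdsWithin_le_nhds
  obtain ⟨t, h1, h2, h3⟩ := ((hs.eventually_lt_const hdn).and (hev.and self_mem_nhdsWithin)).exists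
  have h3' : (0 : ℝ) < t := h3
  simp only [slope_def_field, zero_smul, add_zero, hF.eq_zero hxU hx, sub_zero] at h1
  have h4 : F (x + t • horiz x) < 0 := by
    by_contra h
    exact absurd h1 (not_lt.2 (div_nonneg (not_lt.1 h) h3'.le))
  have h5 := rsq_le_of_mem_carrier hx (fun y hy => hmax hy) hpos ((hF.mem_iff _ h2).2 h4)
  rw [rsq_add_smul_horiz] at h5
  nlinarith [mul_pos h3' hpos, mul_pos (mul_pos h3' h3') hpos]

/-- With A, B the diagonal entries and D the off-diagonal entry of the symmetric form in the frame
a, Ja, one has AB > D² and hence A(A + B) = A² + AB > 0. So every diagonal entry has the sign of the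
trace. -/
theorem shape_mul_div_pos (hK : ∀ x ∈ O.surface, 0 < O.gaussCurvature x) {x a : E3}
    (hx : x ∈ O.surface) (ha : a ∈ O.tangent x) (ha0 : a ≠ 0) :
    0 < inner ℝ (fderivWithin ℝ O.normal O.surface x a) a * O.div O.normal x := by
  have h1 := norm_sq_mul_div O.normal hx ha
  have h2 := norm_pow_mul_gaussCurvature hx ha
  rw [inner_fderivWithin_normal_comm hx ha (O.J_mem_tangent x a)] at h2
  set A := inner ℝ (fderivWithin ℝ O.normal O.surface x a) a
  set B := inner ℝ (fderivWithin ℝ O.normal O.surface x (O.J x a)) (O.J x a)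
  set D := inner ℝ (fderivWithin ℝ O.normal O.surface x (O.J x a)) a
  have hr : 0 < ‖a‖ := norm_pos_iff.2 ha0
  have h3 : 0 < A * B - D * D := by rw [← h2]; have := hK x hx; positivity
  have h4 : 0 < ‖a‖ ^ 2 * (A * O.div O.normal x) := by
    have : ‖a‖ ^ 2 * (A * O.div O.normal x) = A * A + A * B := by
      rw [mul_left_comm, h1]; ring
    rw [this]; nlinarith [mul_self_nonneg A, mul_self_nonneg D]
  exact (mul_pos_iff_of_pos_left (by positivity)).1 h4

/-- Positive Gauss curvature makes the second fundamental form of the closed surface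
positive definite. -/
theorem shape_pos (hconn : IsConnected O.surface) (hrot : O.IsRotationInvariant)
    (hK : ∀ x ∈ O.surface, 0 < O.gaussCurvature x) {x a : E3}
    (hx : x ∈ O.surface) (ha : a ∈ O.tangent x) (ha0 : a ≠ 0) :
    0 < inner ℝ (fderivWithin ℝ O.normal O.surface x a) a := by
  obtain ⟨x₁, hx₁, hr₁, hk₁⟩ := exists_kap_pos hconn.nonempty
  have hX : X₃ x₁ ≠ 0 := by
    intro h
    have := norm_X₃_sq x₁
    rw [h] at this
    simp at this; linarith
  have h1 : 0 < O.div O.normal x₁ := by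
    have := shape_mul_div_pos hK hx₁ (X₃_mem_tangent hrot hx₁) hX
    rw [inner_shape_X₃ hrot hx₁] at this
    exact (mul_pos_iff_of_pos_left hk₁).1 this
  have h2 := shape_mul_div_pos hK hx ha ha0
  have h3 : 0 < O.div O.normal x := by
    -- A trace of opposite signs at two points would vanish somewhere on the connected surface,
    -- which the product inequality excludes.
    by_contra hle
    obtain ⟨y, hy, hy0⟩ := hconn.isPreconnected.intermediate_value hx hx₁
      smoothOn_normal.continuousOn_div ⟨not_lt.1 hle, h1.le⟩
    by_cases hex : ∃ b ∈ O.tangent y, b ≠ 0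
    · obtain ⟨b, hb, hb0⟩ := hex
      have := shape_mul_div_pos hK hy hb hb0
      simp [hy0] at this
    · push Not at hex
      have hbot : O.tangent y = ⊥ := (Submodule.eq_bot_iff _).2 hex
      have := finrank_tangent hy
      rw [hbot] at this
      simp at this
  exact (pos_iff_pos_of_mul_pos h2).2 h3

/-- Minimum of a positive continuous function over the unit tangent bundle, which is compact; the
general vector follows by scaling. -/
theorem exists_shape_lower_bound (hconn : IsConnected O.surface) (hrot : O.IsRotationInvariant)
    (hK : ∀ x ∈ O.surface, 0 < O.gaussCurvature x) :
    ∃ c > 0, ∀ x ∈ O.surface, ∀ a ∈ O.tangent x,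
      c * ‖a‖ ^ 2 ≤ inner ℝ (fderivWithin ℝ O.normal O.surface x a) a := by
  let B : Set (E3 × E3) := O.surface ×ˢ Metric.sphere 0 1
  have hB : IsCompact B := isCompact_surface.prod (isCompact_sphere 0 1)
  have hnc : ContinuousOn (fun z : E3 × E3 => inner ℝ (O.normal z.1) z.2) B :=
    (smoothOn_normal.continuousOn.comp continuousOn_fst fun z hz => hz.1).inner continuousOn_snd
  let Z : Set (E3 × E3) := B ∩ (fun z : E3 × E3 => inner ℝ (O.normal z.1) z.2) ⁻¹' {0}
  have hZ : IsCompact Z :=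
    hB.of_isClosed_subset (hnc.preimage_isClosed_of_isClosed hB.isClosed isClosed_singleton)
      inter_subset_left
  have hfc : ContinuousOn (fun z : E3 × E3 => inner ℝ (O.tderiv O.normal z.1 z.2) z.2) Z :=
    (((smoothOn_normal.tderiv.continuousOn.comp continuousOn_fst fun z hz => hz.1.1).clm_apply
      continuousOn_snd).inner continuousOn_snd)
  have hZne : Z.Nonempty := by
    obtain ⟨x, hx⟩ := hconn.nonempty
    obtain ⟨b, hb, hb0⟩ : ∃ b ∈ O.tangent x, b ≠ 0 := by
      by_contra hex
      push Not at hex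
      have hbot : O.tangent x = ⊥ := (Submodule.eq_bot_iff _).2 hex
      have := finrank_tangent hx
      rw [hbot] at this
      simp at this
    refine ⟨(x, ‖b‖⁻¹ • b), ⟨hx, ?_⟩, ?_⟩
    · simp [norm_smul, norm_ne_zero_iff.2 hb0]
    · simp [real_inner_smul_right, mem_tangent.1 hb]
  obtain ⟨z, hz, hmin⟩ := hZ.exists_isMinOn hZne hfc
  have hzT : z.2 ∈ O.tangent z.1 := mem_tangent.2 hz.2
  have hz1 : ‖z.2‖ = 1 := by simpa using hz.1.2
  refine ⟨inner ℝ (O.tderiv O.normal z.1 z.2) z.2, ?_, ?_⟩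
  · rw [tderiv_apply_of_mem hzT]
    exact shape_pos hconn hrot hK hz.1.1 hzT (by rintro h; simp [h] at hz1)
  · intro x hx a ha
    rcases eq_or_ne a 0 with rfl | h0
    · simp
    have hr : ‖a‖ ≠ 0 := norm_ne_zero_iff.2 h0
    have hmem : (x, ‖a‖⁻¹ • a) ∈ Z := by
      refine ⟨⟨hx, ?_⟩, ?_⟩
      · simp [norm_smul, hr]
      · simp [real_inner_smul_right, mem_tangent.1 ha]
    have h1 : inner ℝ (O.tderiv O.normal z.1 z.2) z.2 ≤
      inner ℝ (O.tderiv O.normal x (‖a‖⁻¹ • a)) (‖a‖⁻¹ • a) := hmin hmem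
    rw [map_smul, real_inner_smul_left, real_inner_smul_right, tderiv_apply_of_mem ha] at h1
    calc _ ≤ ‖a‖⁻¹ * (‖a‖⁻¹ * inner ℝ (fderivWithin ℝ O.normal O.surface x a) a) * ‖a‖ ^ 2 := by
          gcongr
      _ = _ := by field_simp

/-- The uniform bound applied to X, for which |X|² = r². It keeps r²/κ bounded near the poles, where
both terms vanish. -/
theorem exists_kap_lower_bound (hconn : IsConnected O.surface) (hrot : O.IsRotationInvariant)
    (hK : ∀ x ∈ O.surface, 0 < O.gaussCurvature x) :
    ∃ c > 0, ∀ x ∈ O.surface, c * rsq x ≤ O.kap x := by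
  obtain ⟨c, hc, h⟩ := exists_shape_lower_bound hconn hrot hK
  refine ⟨c, hc, fun x hx => ?_⟩
  have := h x hx _ (X₃_mem_tangent hrot hx)
  rwa [norm_X₃_sq, inner_shape_X₃ hrot hx] at this

end SmoothDomain

/-! ### Global shape of the surface -/

namespace SmoothDomain

variable {O : SmoothDomain}

/-- The surface is a connected surface of revolution of positive curvature. -/
structure IsOval (O : SmoothDomain) : Prop where
  connected : IsConnected O.surface
  rot : O.IsRotationInvariant
  curvature_pos : ∀ x ∈ O.surface, 0 < O.gaussCurvature x

/-! ### Rays in the domain and horizontal sections of the surface. -/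

theorem notMem_carrier_of_mem_surface {x : E3} (hx : x ∈ O.surface) : x ∉ O.carrier := by
  have := hx.2
  rwa [O.isOpen.interior_eq] at this

theorem mem_surface_of_closure {x : E3} (hx : x ∈ closure O.carrier) (h : x ∉ O.carrier) :
    x ∈ O.surface := ⟨hx, by rwa [O.isOpen.interior_eq]⟩

theorem eventually_line_mem {U : Set E3} (hU : IsOpen U) {x : E3} (hx : x ∈ U) (e : E3) :
    ∀ᶠ t in 𝓝 (0 : ℝ), x + t • e ∈ U := by
  have hc : ContinuousAt (fun t : ℝ => x + t • e) 0 := by fun_prop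
  exact hc.eventually_mem (hU.mem_nhds (by simpa using hx))

theorem eventually_defining_pos {U : Set E3} {F : E3 → ℝ} (hF : IsDefiningFunction O.carrier U F)
    {x e : E3} (hx : x ∈ O.surface) (hxU : x ∈ U) (he : 0 < inner ℝ (O.normal x) e) :
    ∀ᶠ t in 𝓝[>] (0 : ℝ), 0 < F (x + t • e) := by
  have hd := hF.hasDerivAt_line hxU e
  have hpos : 0 < inner ℝ (∇ F x) e := by
    rw [gradient_eq hF hx hxU, real_inner_smul_left]
    exact mul_pos (norm_pos_iff.2 (hF.gradient_ne_zero x hxU)) he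
  have hs := (hasDerivAt_iff_tendsto_slope.1 hd).mono_left (nhdsGT_le_nhdsNE (0 : ℝ))
  filter_upwards [hs.eventually_const_lt hpos, self_mem_nhdsWithin] with t h1 h3
  have h3' : (0 : ℝ) < t := h3
  simp only [slope_def_field, zero_smul, add_zero, hF.eq_zero hxU hx, sub_zero] at h1
  exact (div_pos_iff_of_pos_right h3').1 h1

/-- A ray leaving the surface in an outward direction is initially outside. -/
theorem eventually_notMem_carrier {x e : E3} (hx : x ∈ O.surface)
    (he : 0 < inner ℝ (O.normal x) e) : ∀ᶠ t in 𝓝[>] (0 : ℝ), x + t • e ∉ O.carrier := by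
  obtain ⟨U, F, hxU, hF⟩ := O.smooth x hx
  filter_upwards [eventually_defining_pos hF hx hxU he,
    (eventually_line_mem hF.isOpen hxU e).filter_mono nhdsWithin_le_nhds] with t h1 h2 h3
  exact absurd ((hF.mem_iff _ h2).1 h3) (not_lt.2 h1.le)

/-- A ray leaving the surface in an inward direction is initially inside. -/
theorem eventually_mem_carrier {x e : E3} (hx : x ∈ O.surface)
    (he : inner ℝ (O.normal x) e < 0) : ∀ᶠ t in 𝓝[>] (0 : ℝ), x + t • e ∈ O.carrier := by
  obtain ⟨U, F, hxU, hF⟩ := O.smooth x hx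
  have hd := hF.hasDerivAt_line hxU e
  have hneg : inner ℝ (∇ F x) e < 0 := by
    rw [gradient_eq hF hx hxU, real_inner_smul_left]
    exact mul_neg_of_pos_of_neg (norm_pos_iff.2 (hF.gradient_ne_zero x hxU)) he
  have hs := (hasDerivAt_iff_tendsto_slope.1 hd).mono_left (nhdsGT_le_nhdsNE (0 : ℝ))
  filter_upwards [hs.eventually_lt_const hneg, self_mem_nhdsWithin,
    (eventually_line_mem hF.isOpen hxU e).filter_mono nhdsWithin_le_nhds] with t h1 h3 h2
  have h3' : (0 : ℝ) < t := h3
  simp only [slope_def_field, zero_smul, add_zero, hF.eq_zero hxU hx, sub_zero] at h1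
  rw [hF.mem_iff _ h2]
  by_contra h
  exact absurd h1 (not_lt.2 (div_nonneg (not_lt.1 h) h3'.le))

theorem IsOval.kap_pos (hO : O.IsOval) {x : E3} (hx : x ∈ O.surface) (hr : 0 < rsq x) :
    0 < O.kap x := by
  obtain ⟨c, hc, h⟩ := exists_kap_lower_bound hO.connected hO.rot hO.curvature_pos
  exact (mul_pos hc hr).trans_le (h x hx)

theorem rsq_line {b e : E3} (hb0 : b 0 = 0) (hb1 : b 1 = 0) (he : e 0 ^ 2 + e 1 ^ 2 = 1) (t : ℝ) :
    rsq (b + t • e) = t ^ 2 := by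
  simp [rsq, hb0, hb1]; linear_combination t ^ 2 * he

/-- At distance t along a horizontal ray from the axis κ equals t⟨ν, e⟩, so such a ray can cross the
surface only outwards. -/
theorem IsOval.inner_normal_pos (hO : O.IsOval) {b e : E3} (hb0 : b 0 = 0) (hb1 : b 1 = 0)
    (he2 : e 2 = 0) (he : e 0 ^ 2 + e 1 ^ 2 = 1) {t : ℝ} (ht : 0 < t)
    (hx : b + t • e ∈ O.surface) : 0 < inner ℝ (O.normal (b + t • e)) e := by
  have h1 := hO.kap_pos hx (by rw [rsq_line hb0 hb1 he]; positivity)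
  have h2 : O.kap (b + t • e) = t * inner ℝ (O.normal (b + t • e)) e := by
    rw [E3_inner_eq, kap]; simp [hb0, hb1, he2]; ring
  rw [h2] at h1
  exact (mul_pos_iff_of_pos_left ht).1 h1

/-- A horizontal ray from the axis stays in the domain until it meets the surface. -/
theorem IsOval.mem_carrier_of_ray (hO : O.IsOval) {b e : E3} (hb0 : b 0 = 0) (hb1 : b 1 = 0)
    (he2 : e 2 = 0) (he : e 0 ^ 2 + e 1 ^ 2 = 1) {t₁ : ℝ}
    (hx : b + t₁ • e ∈ O.surface) {t₀ : ℝ} (ht₀ : 0 < t₀) (h01 : t₀ < t₁) :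
    b + t₀ • e ∈ O.carrier := by
  by_contra hnot
  have h1 := hO.inner_normal_pos hb0 hb1 he2 he (ht₀.trans h01) hx
  have h2 := eventually_mem_carrier hx (e := -e) (by rw [inner_neg_right]; linarith)
  have h3 : ∀ᶠ s in 𝓝[>] (0 : ℝ), s < t₁ - t₀ :=
    (eventually_lt_nhds (by linarith)).filter_mono nhdsWithin_le_nhds
  obtain ⟨s, hs1, hs2, hs3⟩ := (h2.and (h3.and self_mem_nhdsWithin)).exists
  have hs3' : (0 : ℝ) < s := hs3
  have hs4 : b + (t₁ - s) • e ∈ O.carrier := by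
    convert hs1 using 1; module
  have hcont : Continuous fun t : ℝ => b + t • e := by fun_prop
  -- Take the last parameter u at which the ray is outside. Just after u it is inside, so it enters
  -- the domain through a surface point, although such rays can only leave it.
  have hK : IsCompact (Icc t₀ (t₁ - s) ∩ (fun t : ℝ => b + t • e) ⁻¹' O.carrierᶜ) :=
    isCompact_Icc.inter_right (O.isOpen.isClosed_compl.preimage hcont)
  obtain ⟨u, ⟨hu1, hu2⟩, hu3⟩ := hK.exists_isGreatest ⟨t₀, ⟨le_rfl, by linarith⟩, hnot⟩
  have hu4 : u < t₁ - s := lt_of_le_of_ne hu1.2 (by rintro rfl; exact hu2 hs4)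
  have hin : ∀ t, u < t → t ≤ t₁ - s → b + t • e ∈ O.carrier := by
    intro t h5 h6
    by_contra h7
    exact absurd (hu3 ⟨⟨hu1.1.trans h5.le, h6⟩, h7⟩) (not_le.2 h5)
  have hev : ∀ᶠ t in 𝓝[>] (0 : ℝ), b + u • e + t • e ∈ O.carrier := by
    filter_upwards [self_mem_nhdsWithin, (eventually_lt_nhds (sub_pos.2 hu4)).filter_mono
      nhdsWithin_le_nhds] with t h5 h6
    have h5' : (0 : ℝ) < t := h5
    have := hin (u + t) (by linarith) (by linarith)
    rwa [add_smul, ← add_assoc] at this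
  have hcl : b + u • e ∈ closure O.carrier := by
    have hc : ContinuousAt (fun t : ℝ => b + u • e + t • e) 0 := by fun_prop
    refine mem_closure_of_tendsto (b := 𝓝[>] (0 : ℝ)) ?_ hev
    simpa [ContinuousAt] using hc.tendsto.mono_left nhdsWithin_le_nhds
  have hM := mem_surface_of_closure hcl hu2
  have hout := eventually_notMem_carrier hM
    (hO.inner_normal_pos hb0 hb1 he2 he (ht₀.trans_le hu1.1) hM)
  obtain ⟨t, h5, h6⟩ := (hev.and hout).exists
  exact h6 h5

/-- The half turn fixes a point of the axis, hence fixes its normal, whose horizontal part it also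
negates. -/
theorem normal_of_axis (hrot : O.IsRotationInvariant) {x : E3} (hx : x ∈ O.surface)
    (h0 : x 0 = 0) (h1 : x 1 = 0) : O.normal x 0 = 0 ∧ O.normal x 1 = 0 := by
  have h2 := normal_rot hrot hx Real.pi
  have h3 : rot Real.pi x = x := by apply E3_ext <;> simp [h0, h1]
  rw [h3] at h2
  have h4 := congrArg (fun v : E3 => v 0) h2
  have h5 := congrArg (fun v : E3 => v 1) h2
  simp at h4 h5
  constructor <;> linarith

theorem eq_zero_of_rsq {x : E3} (h : rsq x = 0) : x 0 = 0 ∧ x 1 = 0 := by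
  unfold rsq at h
  constructor <;> nlinarith [sq_nonneg (x 0), sq_nonneg (x 1)]

/-- Near a pole the surface lies strictly on one side of its tangent plane. -/
theorem IsOval.eventually_notMem_of_axis (hO : O.IsOval) {x e : E3} (hx : x ∈ O.surface)
    (hr : rsq x = 0) (he2 : e 2 = 0) (he0 : e ≠ 0) :
    ∀ᶠ t in 𝓝[>] (0 : ℝ), x + t • e ∉ O.carrier := by
  obtain ⟨h0, h1⟩ := eq_zero_of_rsq hr
  obtain ⟨hn0, hn1⟩ := normal_of_axis hO.rot hx h0 h1
  have heT : e ∈ O.tangent x := by rw [mem_tangent, E3_inner_eq, hn0, hn1, he2]; ring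
  obtain ⟨U, F, hxU, hF⟩ := O.smooth x hx
  have hS := shape_pos hO.connected hO.rot hO.curvature_pos hx heT he0
  have hg0 : inner ℝ (∇ F x) e = 0 := by
    rw [gradient_eq hF hx hxU, real_inner_smul_left, mem_tangent.1 heT, mul_zero]
  have hgd : HasFDerivAt (∇ F) (fderiv ℝ (∇ F) x) (x + (0 : ℝ) • e) := by
    simpa using ((hF.contDiffOn_gradient.contDiffAt (hF.isOpen.mem_nhds hxU)).differentiableAt
      (by simp)).hasFDerivAt
  have hline : ∀ s : ℝ, HasDerivAt (fun t : ℝ => x + t • e) e s := fun s => by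
    simpa using ((hasDerivAt_id s).smul_const e).const_add x
  have h2 : HasDerivAt (fun t : ℝ => inner ℝ (∇ F (x + t • e)) e)
      (inner ℝ (fderiv ℝ (∇ F) x e) e) 0 := by
    simpa using (hgd.comp_hasDerivAt (0 : ℝ) (hline 0)).inner ℝ (hasDerivAt_const (0 : ℝ) e)
  have hpos : 0 < inner ℝ (fderiv ℝ (∇ F) x e) e := by
    rw [inner_fderiv_gradient hF hx hxU heT heT]
    exact mul_pos (norm_pos_iff.2 (hF.gradient_ne_zero x hxU)) hS
  have hs := (hasDerivAt_iff_tendsto_slope.1 h2).mono_left (nhdsGT_le_nhdsNE (0 : ℝ))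
  -- Along e the first derivative of F vanishes at the point and the second is positive, so F
  -- increases strictly from zero.
  have hev : ∀ᶠ t in 𝓝[>] (0 : ℝ), 0 < inner ℝ (∇ F (x + t • e)) e := by
    filter_upwards [hs.eventually_const_lt hpos, self_mem_nhdsWithin] with t h3 h4
    have h4' : (0 : ℝ) < t := h4
    simp only [slope_def_field, zero_smul, add_zero, hg0, sub_zero] at h3
    exact (div_pos_iff_of_pos_right h4').1 h3
  have hU := eventually_line_mem hF.isOpen hxU e
  obtain ⟨ε, hε, hball⟩ := Metric.eventually_nhds_iff.1 hU
  obtain ⟨δ, hδ, hpd⟩ := mem_nhdsGT_iff_exists_Ioo_subset.1 hev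
  filter_upwards [Ioo_mem_nhdsGT (lt_min hε hδ)] with t ht hmem
  have hU' : ∀ s ∈ Icc 0 t, x + s • e ∈ U := fun s hs => hball (by
    rw [Real.dist_eq, sub_zero, abs_of_nonneg hs.1]
    exact (hs.2.trans_lt ht.2).trans_le (min_le_left _ _))
  have hder : ∀ s ∈ Icc 0 t, HasDerivAt (fun t : ℝ => F (x + t • e))
      (inner ℝ (∇ F (x + s • e)) e) s := by
    intro s hs
    have hFd := ((hF.contDiffAt (hU' s hs)).differentiableAt (by simp)).hasFDerivAt
    have := hFd.comp_hasDerivAt s (hline s)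
    rwa [hF.fderiv_apply] at this
  have hmono := strictMonoOn_of_deriv_pos (convex_Icc 0 t)
    (fun s hs => (hder s hs).continuousAt.continuousWithinAt) (fun s hs => by
      rw [interior_Icc] at hs
      rw [(hder s ⟨hs.1.le, hs.2.le⟩).deriv]
      exact hpd ⟨hs.1, (hs.2.trans ht.2).trans_le (min_le_right _ _)⟩)
  have hlt := hmono (left_mem_Icc.2 ht.1.le) (right_mem_Icc.2 ht.1.le) ht.1
  simp only [zero_smul, add_zero, hF.eq_zero hxU hx] at hlt
  have := (hF.mem_iff _ (hU' t (right_mem_Icc.2 ht.1.le))).1 hmem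
  linarith

/-- The horizontal sections of the surface are circles or points. -/
theorem IsOval.rsq_eq (hO : O.IsOval) {x y : E3} (hx : x ∈ O.surface) (hy : y ∈ O.surface)
    (h2 : x 2 = y 2) : rsq x = rsq y := by
  have key : ∀ x ∈ O.surface, ∀ y ∈ O.surface, x 2 = y 2 → ¬ rsq x < rsq y := by
    intro x hx y hy h2 hlt
    have hry : 0 < rsq y := (rsq_nonneg x).trans_lt hlt
    set R := Real.sqrt (rsq y) with hR
    have hR0 : 0 < R := Real.sqrt_pos.2 hry
    have hRsq : R ^ 2 = rsq y := Real.sq_sqrt hry.le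
    let b : E3 := !₂[0, 0, y 2]
    let e : E3 := R⁻¹ • horiz y
    have hb0 : b 0 = 0 := by simp [b]
    have hb1 : b 1 = 0 := by simp [b]
    have he2 : e 2 = 0 := by simp [e]
    have he : e 0 ^ 2 + e 1 ^ 2 = 1 := by
      have : e 0 ^ 2 + e 1 ^ 2 = (R ^ 2)⁻¹ * rsq y := by simp [e, rsq]; ring
      rw [this, hRsq, inv_mul_cancel₀ hry.ne']
    have hy' : b + R • e = y := by
      have : R • e = horiz y := by rw [smul_smul, mul_inv_cancel₀ hR0.ne', one_smul]
      rw [this]; apply E3_ext <;> simp [b]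
    rw [← hy'] at hy
    -- The ray from the axis point b to y is in the domain before reaching y. If x is on the axis
    -- then x = b, and the ray starts outside by convexity at x. Otherwise a rotate of x lies on the
    -- ray before y, so a surface point would lie in the open domain.
    rcases (rsq_nonneg x).eq_or_lt with h0 | hpos
    · obtain ⟨hx0, hx1⟩ := eq_zero_of_rsq h0.symm
      have hxb : x = b := E3_ext (by simp [hx0, b]) (by simp [hx1, b]) (by simp [h2, b])
      have he0 : e ≠ 0 := by rintro h; simp [h] at he
      have h3 := hO.eventually_notMem_of_axis hx h0.symm he2 he0
      obtain ⟨t, h4, h5, h6⟩ := (h3.and ((eventually_lt_nhds hR0).filter_mono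
        nhdsWithin_le_nhds |>.and self_mem_nhdsWithin)).exists
      rw [hxb] at h4
      exact h4 (hO.mem_carrier_of_ray hb0 hb1 he2 he hy h6 h5)
    · have hs0 : 0 < Real.sqrt (rsq x) := Real.sqrt_pos.2 hpos
      have h3 := hO.mem_carrier_of_ray hb0 hb1 he2 he hy hs0 (Real.sqrt_lt_sqrt hpos.le hlt)
      obtain ⟨s, hs⟩ := exists_rot_eq (x := x) (y := b + Real.sqrt (rsq x) • e)
        (by simp [b, he2, h2]) (by rw [rsq_line hb0 hb1 he, Real.sq_sqrt hpos.le])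
      exact notMem_carrier_of_mem_surface (hs ▸ hO.rot s x hx) h3
  exact le_antisymm (not_lt.1 (key y hy x hx h2.symm)) (not_lt.1 (key x hx y hy h2))

theorem IsOval.exists_rot (hO : O.IsOval) {x y : E3} (hx : x ∈ O.surface) (hy : y ∈ O.surface)
    (h2 : x 2 = y 2) : ∃ s, _root_.rot s x = y :=
  exists_rot_eq h2 (hO.rsq_eq hx hy h2)

/-! ### The height function and the poles. -/

theorem J_X₃_two (x : E3) : O.J x (X₃ x) 2 = O.kap x := by
  simp [J, kap]

/-- Off the axis the height has derivative κ > 0 along Y. -/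
theorem IsOval.axis_of_extremum (hO : O.IsOval) {x : E3} (hx : x ∈ O.surface)
    (hext : IsExtrOn (fun y : E3 => y 2) O.surface x) : rsq x = 0 := by
  by_contra hne
  have hpos := hO.kap_pos hx ((rsq_nonneg x).lt_of_ne' hne)
  obtain ⟨c, hc0, hc, hM⟩ := exists_curve hx (O.J_mem_tangent x (X₃ x))
  have h1 : HasDerivAt (fun t => c t 2) (O.J x (X₃ x) 2) 0 :=
    (EuclideanSpace.proj 2 : E3 →L[ℝ] ℝ).hasFDerivAt.comp_hasDerivAt 0 hc
  have h2 : IsLocalExtr (fun t => c t 2) 0 := by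
    rcases hext with h | h
    · left; filter_upwards [hM] with t ht; rw [hc0]; exact h ht
    · right; filter_upwards [hM] with t ht; rw [hc0]; exact h ht
  have := h2.hasDerivAt_eq_zero h1
  rw [J_X₃_two] at this
  linarith

/-- A domain point at this height would be off the axis; the horizontal ray through it, directed
away from x, leaves the bounded domain through a surface point at the height of x with positive
radius. But the section at that height is the single point x. -/
theorem IsOval.notMem_carrier_of_axis_height (hO : O.IsOval) {x y : E3} (hx : x ∈ O.surface)
    (hr : rsq x = 0) (h2 : y 2 = x 2) : y ∉ O.carrier := by
  intro hy
  have hxy : y ≠ x := by rintro rfl; exact notMem_carrier_of_mem_surface hx hy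
  obtain ⟨hx0, hx1⟩ := eq_zero_of_rsq hr
  have hry : 0 < rsq y := by
    refine (rsq_nonneg y).lt_of_ne' fun h => hxy ?_
    obtain ⟨hy0, hy1⟩ := eq_zero_of_rsq h
    exact E3_ext (by rw [hx0, hy0]) (by rw [hx1, hy1]) h2
  let γ : ℝ → E3 := fun t => y + t • (y - x)
  have hγ : Continuous γ := by fun_prop
  have hγ2 : ∀ t, γ t 2 = x 2 := fun t => by simp [γ, h2]
  have hγr : ∀ t, rsq (γ t) = (1 + t) ^ 2 * rsq y := fun t => by
    simp [γ, rsq, hx0, hx1]; ring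
  obtain ⟨R, hR⟩ := O.isBounded.subset_closedBall 0
  have hpre : IsPreconnected (γ '' Ici 0) := isPreconnected_Ici.image γ hγ.continuousOn
  have hout : ∃ t ∈ Ici (0 : ℝ), γ t ∉ O.carrier := by
    have hd : 0 < ‖y - x‖ := norm_pos_iff.2 (sub_ne_zero.2 hxy)
    refine ⟨(|R| + ‖y‖ + 1) / ‖y - x‖, by simp only [mem_Ici]; positivity, fun h => ?_⟩
    have h3 := hR h
    rw [mem_closedBall_zero_iff] at h3
    have h4 : ‖((|R| + ‖y‖ + 1) / ‖y - x‖) • (y - x)‖ = |R| + ‖y‖ + 1 := by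
      rw [norm_smul, Real.norm_of_nonneg (by positivity), div_mul_cancel₀ _ hd.ne']
    have h5 := norm_sub_norm_le (((|R| + ‖y‖ + 1) / ‖y - x‖) • (y - x)) (-y)
    rw [sub_neg_eq_add, h4, norm_neg] at h5
    have h6 : ‖((|R| + ‖y‖ + 1) / ‖y - x‖) • (y - x) + y‖ ≤ R := by rwa [add_comm]
    have := le_abs_self R
    linarith
  obtain ⟨t, ht, htO⟩ := hout
  obtain ⟨z, ⟨s, hs, rfl⟩, hzM⟩ : (γ '' Ici 0 ∩ frontier O.carrier).Nonempty := by
    by_contra hemp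
    rw [not_nonempty_iff_eq_empty] at hemp
    have hsub := hpre.subset_of_closure_inter_subset O.isOpen
      ⟨γ 0, ⟨0, mem_Ici.2 le_rfl, rfl⟩, by simpa [γ] using hy⟩ (by
        rintro w ⟨hw1, hw2⟩
        by_contra hw3
        have : w ∈ γ '' Ici 0 ∩ frontier O.carrier := ⟨hw2, mem_surface_of_closure hw1 hw3⟩
        rw [hemp] at this
        exact this)
    exact htO (hsub ⟨t, ht, rfl⟩)
  have h3 := hO.rsq_eq hx hzM (hγ2 s).symm
  rw [hr, hγr] at h3
  have hs0 : (0 : ℝ) ≤ s := hs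
  have : 0 < (1 + s) ^ 2 * rsq y := by positivity
  linarith

/-- The sign σ treats both poles at once. Near x the function F increases in the direction of ν(x),
so a surface point beyond the horizontal plane of x would lie straight above (relative to σ) a
domain point in that plane, of which there are none. Connectedness makes this local statement
global. -/
theorem IsOval.le_of_axis (hO : O.IsOval) {x : E3} (hx : x ∈ O.surface)
    (hr : rsq x = 0) {σ : ℝ} (hσ : 0 < σ * O.normal x 2) {y : E3} (hy : y ∈ O.surface) :
    σ * y 2 ≤ σ * x 2 := by
  by_contra hlt
  rw [not_le] at hlt
  have hσ0 : σ ≠ 0 := by rintro rfl; simp at hσ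
  obtain ⟨U, F, hxU, hF⟩ := O.smooth x hx
  have hgc : ContinuousAt (fun z => σ * ∇ F z 2) x := by
    have h1 := hF.contDiffOn_gradient.continuousOn.continuousAt (hF.isOpen.mem_nhds hxU)
    have h2 : ContinuousAt (fun z => ∇ F z 2) x :=
      (EuclideanSpace.proj 2 : E3 →L[ℝ] ℝ).continuous.continuousAt.comp h1
    exact continuousAt_const.mul h2
  have hgx : 0 < σ * ∇ F x 2 := by
    rw [gradient_eq hF hx hxU]
    have := norm_pos_iff.2 (hF.gradient_ne_zero x hxU)
    simp only [PiLp.smul_apply, smul_eq_mul]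
    nlinarith
  obtain ⟨ε, hε, hball⟩ := Metric.eventually_nhds_iff_ball.1
    ((hgc.eventually_const_lt hgx).and (hF.isOpen.mem_nhds hxU))
  have hloc : ∀ w ∈ Metric.ball x ε, w ∈ O.surface → σ * w 2 ≤ σ * x 2 := by
    intro w hw hwM
    by_contra hgt
    rw [not_le] at hgt
    obtain ⟨hx0, hx1⟩ := eq_zero_of_rsq hr
    let w' : E3 := !₂[w 0, w 1, x 2]
    let h : ℝ := w 2 - x 2
    have hw' : w = w' + (1 : ℝ) • (h • e₃) := by apply E3_ext <;> simp [w', h]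
    have hw'b : w' ∈ Metric.ball x ε := by
      rw [mem_ball_iff_norm] at hw ⊢
      refine lt_of_le_of_lt ?_ hw
      rw [EuclideanSpace.norm_eq, EuclideanSpace.norm_eq]
      refine Real.sqrt_le_sqrt ?_
      simp [Fin.sum_univ_three, w']
      positivity
    have hseg : ∀ t ∈ Icc (0 : ℝ) 1, w' + t • (h • e₃) ∈ Metric.ball x ε := by
      intro t ht
      have := (convex_ball x ε).add_smul_sub_mem hw'b hw ht
      rwa [hw', add_sub_cancel_left, one_smul] at this
    have hder : ∀ t ∈ Icc (0 : ℝ) 1, HasDerivAt (fun t : ℝ => F (w' + t • (h • e₃)))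
        (h * ∇ F (w' + t • (h • e₃)) 2) t := by
      intro t ht
      have hFd := ((hF.contDiffAt (hball _ (hseg t ht)).2).differentiableAt (by simp)).hasFDerivAt
      have hl : HasDerivAt (fun t : ℝ => w' + t • (h • e₃)) (h • e₃) t := by
        simpa using ((hasDerivAt_id t).smul_const (h • e₃)).const_add w'
      have h3 := hFd.comp_hasDerivAt t hl
      have h4 : inner ℝ (∇ F (w' + t • (h • e₃))) (h • e₃) = h * ∇ F (w' + t • (h • e₃)) 2 := by
        rw [E3_inner_eq]; simp [mul_comm]
      rw [hF.fderiv_apply, h4] at h3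
      exact h3
    have hmono := strictMonoOn_of_deriv_pos (convex_Icc (0 : ℝ) 1)
      (fun s hs => (hder s hs).continuousAt.continuousWithinAt) (fun s hs => by
        rw [interior_Icc] at hs
        have hs' : s ∈ Icc (0 : ℝ) 1 := ⟨hs.1.le, hs.2.le⟩
        rw [(hder s hs').deriv]
        have h3 : 0 < σ * ∇ F (w' + s • (h • e₃)) 2 := (hball _ (hseg s hs')).1
        have h4 : 0 < σ * h := by simp only [h]; linarith
        have h5 := mul_pos h3 h4
        have h6 : 0 < σ * σ := mul_self_pos.2 hσ0
        refine (mul_pos_iff_of_pos_left h6).1 ?_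
        linarith [h5])
    have h01 := hmono (left_mem_Icc.2 zero_le_one) (right_mem_Icc.2 zero_le_one) zero_lt_one
    simp only [zero_smul, add_zero] at h01
    rw [← hw', hF.eq_zero (hball w hw).2 hwM] at h01
    exact hO.notMem_carrier_of_axis_height hx hr (y := w') (by simp [w'])
      ((hF.mem_iff _ (hball w' hw'b).2).2 h01)
  have hcont2 : Continuous fun z : E3 => σ * z 2 :=
    continuous_const.mul (EuclideanSpace.proj 2 : E3 →L[ℝ] ℝ).continuous
  have hu : IsOpen {z : E3 | σ * x 2 < σ * z 2} := isOpen_lt continuous_const hcont2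
  have hv : IsOpen ({z : E3 | σ * z 2 < σ * x 2} ∪ Metric.ball x ε) :=
    (isOpen_lt hcont2 continuous_const).union Metric.isOpen_ball
  -- The part beyond the plane, and the part before it together with the ball, are open and cover M,
  -- because x is the only surface point in the plane. A common point would lie in the ball and
  -- contradict the local statement.
  obtain ⟨w, hwM, hw1, hw2⟩ := hO.connected.isPreconnected _ _ hu hv (by
    intro w hw
    rcases lt_trichotomy (σ * x 2) (σ * w 2) with h | h | h
    · exact Or.inl h
    · right; right
      have h2 : x 2 = w 2 := mul_left_cancel₀ hσ0 h
      have h3 := hO.rsq_eq hx hw h2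
      obtain ⟨hx0, hx1⟩ := eq_zero_of_rsq hr
      obtain ⟨hw0, hw1⟩ := eq_zero_of_rsq (h3 ▸ hr)
      have : w = x := E3_ext (by rw [hx0, hw0]) (by rw [hx1, hw1]) h2.symm
      rw [this]; exact Metric.mem_ball_self hε
    · exact Or.inr (Or.inl h)) ⟨y, hy, hlt⟩ ⟨x, hx, Or.inr (Metric.mem_ball_self hε)⟩
  rcases hw2 with hw2 | hw2
  · exact lt_asymm (show σ * w 2 < σ * x 2 from hw2) hw1
  · exact absurd (hloc w hw2 hwM) (not_le.2 hw1)

/-- The two poles of an oval of revolution. -/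
structure IsPoles (O : SmoothDomain) (N S : E3) : Prop where
  north_mem : N ∈ O.surface
  south_mem : S ∈ O.surface
  north_axis : rsq N = 0
  south_axis : rsq S = 0
  lt : S 2 < N 2
  le_north : ∀ y ∈ O.surface, y 2 ≤ N 2
  south_le : ∀ y ∈ O.surface, S 2 ≤ y 2
  eq_or_eq : ∀ x ∈ O.surface, rsq x = 0 → x = N ∨ x = S
  exists_height : ∀ c ∈ Icc (S 2) (N 2), ∃ x ∈ O.surface, x 2 = c

theorem continuous_height : Continuous fun z : E3 => z 2 :=
  (EuclideanSpace.proj 2 : E3 →L[ℝ] ℝ).continuous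

/-- The highest and lowest points lie on the axis. At any axis point the normal is vertical, so that
point is extremal in height and coincides with one of the two. -/
theorem IsOval.exists_poles (hO : O.IsOval) : ∃ N S, O.IsPoles N S := by
  obtain ⟨N, hN, hNmax⟩ := O.isCompact_surface.exists_isMaxOn hO.connected.nonempty
    continuous_height.continuousOn
  obtain ⟨S, hS, hSmin⟩ := O.isCompact_surface.exists_isMinOn hO.connected.nonempty
    continuous_height.continuousOn
  have hNr := hO.axis_of_extremum hN (Or.inr hNmax)
  have hSr := hO.axis_of_extremum hS (Or.inl hSmin)
  have heq : ∀ x ∈ O.surface, ∀ y ∈ O.surface, rsq x = 0 → x 2 = y 2 → x = y := by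
    intro x hx y hy hr h2
    obtain ⟨hx0, hx1⟩ := eq_zero_of_rsq hr
    obtain ⟨hy0, hy1⟩ := eq_zero_of_rsq (hO.rsq_eq hx hy h2 ▸ hr)
    exact E3_ext (by rw [hx0, hy0]) (by rw [hx1, hy1]) h2
  refine ⟨N, S, hN, hS, hNr, hSr, ?_, fun y hy => hNmax hy, fun y hy => hSmin hy, ?_, ?_⟩
  · refine lt_of_le_of_ne (hNmax hS) fun h => ?_
    obtain ⟨x, hx, hr, -⟩ := exists_kap_pos hO.connected.nonempty
    have h1 : x 2 ≤ N 2 := hNmax hx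
    have h2 : S 2 ≤ x 2 := hSmin hx
    have h3 := hO.rsq_eq hx hN (by linarith)
    linarith
  · intro x hx hr
    obtain ⟨hx0, hx1⟩ := eq_zero_of_rsq hr
    obtain ⟨hn0, hn1⟩ := normal_of_axis hO.rot hx hx0 hx1
    have hn2 : O.normal x 2 ≠ 0 := by
      intro h
      have h1 := norm_normal hx
      have h2 : O.normal x = 0 := E3_ext (by simp [hn0]) (by simp [hn1]) (by simp [h])
      simp [h2] at h1
    rcases hn2.lt_or_gt with h | h
    · right
      refine heq x hx S hS hr (le_antisymm ?_ (hSmin hx))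
      have := hO.le_of_axis hx hr (σ := -1) (by linarith) hS
      linarith
    · left
      refine heq x hx N hN hr (le_antisymm (hNmax hx) ?_)
      have := hO.le_of_axis hx hr (σ := 1) (by linarith) hN
      linarith
  · intro c hc
    exact hO.connected.isPreconnected.intermediate_value hS hN continuous_height.continuousOn hc

theorem IsPoles.rsq_pos {N S : E3} (h : O.IsPoles N S) {x : E3} (hx : x ∈ O.surface)
    (h1 : S 2 < x 2) (h2 : x 2 < N 2) : 0 < rsq x := by
  refine (rsq_nonneg x).lt_of_ne' fun h0 => ?_
  rcases h.eq_or_eq x hx h0 with rfl | rfl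
  · exact lt_irrefl _ h2
  · exact lt_irrefl _ h1

theorem IsPoles.mem_Ioo (hO : O.IsOval) {N S : E3} (h : O.IsPoles N S) {x : E3}
    (hx : x ∈ O.surface) (hr : 0 < rsq x) : x 2 ∈ Ioo (S 2) (N 2) := by
  constructor
  · refine lt_of_le_of_ne (h.south_le x hx) fun h1 => ?_
    have := hO.rsq_eq h.south_mem hx h1
    rw [h.south_axis] at this; linarith
  · refine lt_of_le_of_ne (h.le_north x hx) fun h1 => ?_
    have := hO.rsq_eq hx h.north_mem h1
    rw [h.north_axis] at this; linarith

end SmoothDomain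

/-! ### The frame `X₃`, `J X₃` -/

theorem cross_eq_smul_of_perp {n a b : E3} (hn : ‖n‖ = 1) (ha : inner ℝ n a = 0)
    (hb : inner ℝ n b = 0) : cross a b = inner ℝ n (cross a b) • n := by
  have h := E3_cross_cross n n (cross a b)
  rw [E3_cross_cross n a b, ha, hb, real_inner_self_eq_norm_sq, hn] at h
  have h0 : cross n (0 : E3) = 0 := (crossL n).map_zero
  simp only [zero_smul, sub_zero, one_pow, one_smul, h0] at h
  exact (sub_eq_zero.1 h.symm).symm

/-- A function on a punctured disc which extends continuously together with its derivative
is differentiable at the centre. -/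
theorem hasFDerivAt_of_punctured {E : Type*} [NormedAddCommGroup E] [NormedSpace ℝ E] {P : E → ℝ}
    {A : E → E →L[ℝ] ℝ} {ρ : ℝ} (hρ : 0 < ρ) (hP : ContinuousOn P (Metric.ball 0 ρ))
    (hA : ContinuousAt A 0)
    (hd : ∀ y ∈ Metric.ball (0 : E) ρ, y ≠ 0 → HasFDerivAt P (A y) y) :
    HasFDerivAt P (A 0) 0 := by
  refine HasFDerivAt.of_isLittleO (Asymptotics.isLittleO_iff.2 fun ε hε => ?_)
  obtain ⟨δ, hδ, hball⟩ := Metric.continuousAt_iff.1 hA ε hε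
  filter_upwards [Metric.ball_mem_nhds (0 : E) (lt_min hρ hδ)] with y hy
  have hy' : ‖y‖ < min ρ δ := by simpa using hy
  rcases eq_or_ne y 0 with rfl | hy0
  · simp
  have hsub : ∀ t ∈ Icc (0 : ℝ) 1, ‖t • y‖ < min ρ δ := fun t ht => by
    rw [norm_smul, Real.norm_of_nonneg ht.1]
    exact (mul_le_of_le_one_left (norm_nonneg y) ht.2).trans_lt hy'
  have hcont : ContinuousOn (fun t : ℝ => P (t • y)) (Icc 0 1) :=
    hP.comp (by fun_prop) fun t ht => by
      simpa using (hsub t ht).trans_le (min_le_left _ _)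
  -- Mean value theorem on the segment from the centre; its interior avoids the centre.
  obtain ⟨t, ht, hslope⟩ := exists_hasDerivAt_eq_slope (fun t : ℝ => P (t • y))
    (fun t => A (t • y) y) zero_lt_one hcont (fun t ht => by
      have h1 := hd (t • y) (by
        simpa using (hsub t ⟨ht.1.le, ht.2.le⟩).trans_le (min_le_left _ _))
        (smul_ne_zero ht.1.ne' hy0)
      have h2 : HasDerivAt (fun t : ℝ => t • y) y t := by
        simpa using (hasDerivAt_id t).smul_const y
      exact h1.comp_hasDerivAt t h2)
  simp only [one_smul, zero_smul, sub_zero, div_one] at hslope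
  have h3 : dist (A (t • y)) (A 0) < ε := hball (by
    rw [dist_zero_right]
    exact (hsub t ⟨ht.1.le, ht.2.le⟩).trans_le (min_le_right _ _))
  rw [← hslope, sub_zero, ← sub_apply]
  refine (ContinuousLinearMap.le_opNorm _ _).trans ?_
  rw [dist_eq_norm] at h3
  gcongr

namespace SmoothDomain

variable {O : SmoothDomain}

/-- The field `J X₃`, which points along the meridians. -/
noncomputable def Y (O : SmoothDomain) (x : E3) : E3 := O.J x (X₃ x)

theorem Y_mem_tangent (x : E3) : O.Y x ∈ O.tangent x := O.J_mem_tangent _ _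

theorem contDiff_X₃ : ContDiff ℝ ∞ X₃ := by
  have : X₃ = crossL e₃ := funext X₃_eq
  rw [this]; exact (crossL e₃).contDiff

theorem hasFDerivAt_X₃ (x : E3) : HasFDerivAt X₃ (crossL e₃) x := by
  have : X₃ = crossL e₃ := funext X₃_eq
  rw [this]; exact (crossL e₃).hasFDerivAt

theorem SmoothOn.cross {a b : E3 → E3} (ha : O.SmoothOn a) (hb : O.SmoothOn b) :
    O.SmoothOn fun x => cross (a x) (b x) :=
  ContDiffOn.clm_apply (crossL.contDiff.comp_contDiffOn ha) hb

theorem SmoothOn.inner {a b : E3 → E3} (ha : O.SmoothOn a) (hb : O.SmoothOn b) :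
    O.SmoothOn fun x => inner ℝ (a x) (b x) :=
  ContDiffOn.inner ℝ ha hb

theorem SmoothOn.J {u : E3 → E3} (hu : O.SmoothOn u) : O.SmoothOn fun x => O.J x (u x) :=
  smoothOn_normal.cross hu

theorem smoothOn_X₃ : O.SmoothOn X₃ := contDiff_X₃.contDiffOn

theorem smoothOn_Y : O.SmoothOn O.Y := smoothOn_X₃.J

theorem smoothOn_chi : O.SmoothOn O.chi := ContDiffOn.inner ℝ contDiffOn_const smoothOn_normal

theorem chi_eq (x : E3) : O.chi x = O.normal x 2 := by
  rw [chi, E3_inner_eq]; simp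

/-! ### Identities in the frame X, Y. -/

theorem norm_sq_smul_eq {x v : E3} (hrot : O.IsRotationInvariant) (hx : x ∈ O.surface)
    (hv : v ∈ O.tangent x) :
    rsq x • v = inner ℝ v (X₃ x) • X₃ x + inner ℝ v (O.Y x) • O.Y x := by
  rw [← norm_X₃_sq]
  exact norm_sq_smul_eq_frame (norm_normal hx) (mem_tangent.1 (X₃_mem_tangent hrot hx))
    (mem_tangent.1 hv)

/-- Vertical component of the frame expansion: X is horizontal and Y has height κ. It turns
functions of the height into potentials of meridional fields. -/
theorem rsq_mul_height {x v : E3} (hrot : O.IsRotationInvariant) (hx : x ∈ O.surface)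
    (hv : v ∈ O.tangent x) : rsq x * v 2 = inner ℝ v (O.Y x) * O.kap x := by
  have := congrArg (fun w : E3 => w 2) (norm_sq_smul_eq hrot hx hv)
  simpa [Y, J_X₃_two] using this

/-- Since X is linear, D_X X is X applied twice, so this is the identity ∇_X X = χY. It uses only
|ν| = 1 and the tangency of X and τ. -/
theorem inner_X₃_X₃ {x τ : E3} (hrot : O.IsRotationInvariant) (hx : x ∈ O.surface)
    (hτ : τ ∈ O.tangent x) : inner ℝ (X₃ (X₃ x)) τ = O.chi x * inner ℝ (O.Y x) τ := by
  have h1 := norm_normal hx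
  have h2 : inner ℝ (O.normal x) (O.normal x) = 1 := by
    rw [real_inner_self_eq_norm_sq, h1, one_pow]
  have h3 := mem_tangent.1 (X₃_mem_tangent hrot hx)
  have h4 := mem_tangent.1 hτ
  rw [E3_inner_eq] at h2 h3 h4
  simp only [X₃_zero_apply, X₃_one_apply, X₃_two_apply] at h3
  rw [chi_eq, E3_inner_eq, E3_inner_eq, Y, J]
  simp only [X₃_zero_apply, X₃_one_apply, X₃_two_apply, cross_zero_apply, cross_one_apply,
    cross_two_apply]
  linear_combination (x 0 * τ 0 + x 1 * τ 1) * h2 - (O.normal x 0 * x 0 + O.normal x 1 * x 1) * h4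
    + (O.normal x 0 * τ 1 - O.normal x 1 * τ 0) * h3

theorem fderivWithin_inner {a b : E3 → E3} (ha : O.SmoothOn a) (hb : O.SmoothOn b) {x τ : E3}
    (hx : x ∈ O.surface) (hτ : τ ∈ O.tangent x) :
    fderivWithin ℝ (fun y => inner ℝ (a y) (b y)) O.surface x τ =
      inner ℝ (a x) (fderivWithin ℝ b O.surface x τ) +
      inner ℝ (fderivWithin ℝ a O.surface x τ) (b x) := by
  obtain ⟨c, rfl, hc, hM⟩ := exists_curve hx hτ
  exact ((ha.inner hb).comp_hasDerivAt hc hM).unique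
    ((ha.comp_hasDerivAt hc hM).inner ℝ (hb.comp_hasDerivAt hc hM))

theorem fderivWithin_X₃ {x τ : E3} (hx : x ∈ O.surface) (hτ : τ ∈ O.tangent x) :
    fderivWithin ℝ X₃ O.surface x τ = X₃ τ := by
  obtain ⟨c, rfl, hc, hM⟩ := exists_curve hx hτ
  have h := (hasFDerivAt_X₃ (c 0)).comp_hasDerivAt 0 hc
  rw [X₃_eq]
  exact (smoothOn_X₃.comp_hasDerivAt hc hM).unique h

theorem fderivWithin_Y {x τ : E3} (hx : x ∈ O.surface) (hτ : τ ∈ O.tangent x) :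
    fderivWithin ℝ O.Y O.surface x τ =
      cross (fderivWithin ℝ O.normal O.surface x τ) (X₃ x) + cross (O.normal x) (X₃ τ) := by
  obtain ⟨c, rfl, hc, hM⟩ := exists_curve hx hτ
  have h1 := smoothOn_normal.comp_hasDerivAt hc hM
  have h2 := smoothOn_X₃.comp_hasDerivAt hc hM
  rw [fderivWithin_X₃ hx hτ] at h2
  have h3 : HasDerivAt (fun t => crossL (O.normal (c t)))
      (crossL (fderivWithin ℝ O.normal O.surface (c 0) τ)) 0 :=
    crossL.hasFDerivAt.comp_hasDerivAt 0 h1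
  exact (smoothOn_Y.comp_hasDerivAt hc hM).unique (h3.clm_apply h2)

/-- In the product rule for ν × X the term with dν is a cross product of tangent vectors, hence
normal; the other term is ν × (e₃ × Y) = -χY. -/
theorem inner_fderivWithin_Y {x τ : E3} (hrot : O.IsRotationInvariant) (hx : x ∈ O.surface)
    (hτ : τ ∈ O.tangent x) :
    inner ℝ (fderivWithin ℝ O.Y O.surface x (O.Y x)) τ = - (O.chi x * inner ℝ (O.Y x) τ) := by
  have hY := Y_mem_tangent (O := O) x
  rw [fderivWithin_Y hx hY, inner_add_left, cross_eq_smul_of_perp (norm_normal hx)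
    (mem_tangent.1 (fderivWithin_normal_mem_tangent hx hY))
    (mem_tangent.1 (X₃_mem_tangent hrot hx)), real_inner_smul_left, mem_tangent.1 hτ, mul_zero,
    zero_add, X₃_eq, E3_cross_cross, mem_tangent.1 hY, zero_smul, zero_sub, inner_neg_left,
    real_inner_smul_left, real_inner_comm, ← chi]

/-! ### Functions of the height -/

theorem rsq_ne_zero_X₃ {x : E3} (h : 0 < rsq x) : X₃ x ≠ 0 := by
  intro h0
  have := norm_X₃_sq x
  rw [h0] at this
  simp at this; linarith

/-- Locally the surface contains a curve parametrized by the height. -/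
theorem IsOval.exists_meridian (hO : O.IsOval) {x : E3} (hx : x ∈ O.surface) (hr : 0 < rsq x) :
    ∃ m : ℝ → E3, m (x 2) = x ∧ ContDiffAt ℝ ∞ m (x 2) ∧
      ∀ᶠ c in 𝓝 (x 2), m c ∈ O.surface ∧ m c 2 = c := by
  obtain ⟨C⟩ := exists_chart hx univ_mem
  have hy := C.mem_ball_ξ C.mem_W
  have hxe := C.Φ_ξ x hx C.mem_W
  obtain ⟨η, hη⟩ := C.exists_fderiv_Φ_eq hy
    (by rw [hxe]; exact Y_mem_tangent x : O.Y x ∈ O.tangent (C.Φ (C.ξ x)))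
  let c : ℝ → E3 := fun t => C.Φ (C.ξ x + t • η)
  have hc0 : c 0 = x := by simp [c, hxe]
  have hcd : HasDerivAt c (O.Y x) 0 := hη ▸ C.hasDerivAt_line hy η
  have hcs : ContDiffAt ℝ ∞ c 0 := by
    have h1 : ContDiffAt ℝ ∞ C.Φ (C.ξ x + (0 : ℝ) • η) := by
      simpa using (C.contDiffOn_Φ _ hy).contDiffAt (C.ball_mem_nhds hy)
    exact h1.comp (0 : ℝ) (contDiffAt_const.add (contDiffAt_id.smul contDiffAt_const))
  let π₂ : E3 →L[ℝ] ℝ := EuclideanSpace.proj 2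
  let f : ℝ → ℝ := fun t => c t 2
  have hfs : ContDiffAt ℝ ∞ f 0 := π₂.contDiff.contDiffAt.comp (0 : ℝ) hcs
  have hfd : HasDerivAt f (O.kap x) 0 := by
    have := π₂.hasFDerivAt.comp_hasDerivAt 0 hcd
    have h2 : π₂ (O.Y x) = O.kap x := J_X₃_two x
    rwa [h2] at this
  -- The height along a curve with velocity Y has derivative κ ≠ 0, so the inverse function theorem
  -- reparametrizes that curve by height.
  have hk := (hO.kap_pos hx hr).ne'
  have hfd' : HasFDerivAt f ((ContinuousLinearEquiv.unitsEquivAut ℝ (Units.mk0 _ hk) :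
      ℝ ≃L[ℝ] ℝ) : ℝ →L[ℝ] ℝ) 0 :=
    hfd.hasFDerivAt.congr_fderiv (by ext; simp)
  have hf0 : f 0 = x 2 := by simp [f, hc0]
  let g := hfs.localInverse hfd' (by simp)
  have hg : ContDiffAt ℝ ∞ g (f 0) := hfs.to_localInverse hfd' (by simp)
  have hg0 : g (f 0) = 0 := hfs.localInverse_apply_image hfd' (by simp)
  have hright : ∀ᶠ y in 𝓝 (f 0), f (g y) = y :=
    (hfs.hasStrictFDerivAt' hfd' (by simp)).eventually_right_inverse
  rw [hf0] at hg hg0 hright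
  refine ⟨c ∘ g, by simp [hg0, hc0], ?_, ?_⟩
  · exact ContDiffAt.comp (x 2) (by rwa [hg0]) hg
  · have hev : ∀ᶠ t in 𝓝 (g (x 2)), c t ∈ O.surface := by
      rw [hg0]
      filter_upwards [C.eventually_line hy η] with t ht using C.Φ_mem _ ht
    filter_upwards [hright, hg.continuousAt.eventually hev] with d h1 h2
    exact ⟨h2, h1⟩

open Classical in
/-- The function of the height defined by a function on the surface. -/
noncomputable def heightFun (O : SmoothDomain) (f : E3 → ℝ) (c : ℝ) : ℝ :=
  if h : ∃ x ∈ O.surface, x 2 = c then f h.choose else 0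

/-- The chosen point does not matter: points of M at equal height differ by a rotation. -/
theorem IsOval.heightFun_apply (hO : O.IsOval) {f : E3 → ℝ}
    (hf : ∀ s, ∀ x ∈ O.surface, f (_root_.rot s x) = f x) {x : E3} (hx : x ∈ O.surface) :
    O.heightFun f (x 2) = f x := by
  have h : ∃ y ∈ O.surface, y 2 = x 2 := ⟨x, hx, rfl⟩
  rw [heightFun, dif_pos h]
  obtain ⟨s, hs⟩ := hO.exists_rot hx h.choose_spec.1 h.choose_spec.2.symm
  rw [← hs, hf s x hx]

/-- Heights of a closed subset of the compact surface form a closed set, so preimages of closed sets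
are closed. -/
theorem IsOval.continuousOn_heightFun (hO : O.IsOval) {f : E3 → ℝ}
    (hf : ∀ s, ∀ x ∈ O.surface, f (_root_.rot s x) = f x) (hfc : ContinuousOn f O.surface)
    {N S : E3} (hP : O.IsPoles N S) : ContinuousOn (O.heightFun f) (Icc (S 2) (N 2)) := by
  rw [continuousOn_iff_isClosed]
  intro t ht
  refine ⟨(fun z : E3 => z 2) '' (O.surface ∩ f ⁻¹' t), ?_, ?_⟩
  · have h1 : IsClosed (O.surface ∩ f ⁻¹' t) :=
      hfc.preimage_isClosed_of_isClosed isClosed_frontier ht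
    exact ((isCompact_surface.of_isClosed_subset h1 inter_subset_left).image
      continuous_height).isClosed
  · ext c
    constructor
    · rintro ⟨h1, h2⟩
      obtain ⟨x, hx, rfl⟩ := hP.exists_height c h2
      refine ⟨⟨x, ⟨hx, ?_⟩, rfl⟩, h2⟩
      rwa [mem_preimage, ← hO.heightFun_apply hf hx]
    · rintro ⟨⟨x, ⟨hx, h1⟩, rfl⟩, h2⟩
      refine ⟨?_, h2⟩
      rwa [mem_preimage, hO.heightFun_apply hf hx]

/-- A smooth zonal field along the meridians is a gradient. -/
theorem IsOval.exists_potential (hO : O.IsOval) {w : E3 → E3} (hw : O.SmoothOn w)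
    (hwT : ∀ x ∈ O.surface, w x ∈ O.tangent x) {g : E3 → ℝ}
    (hg : ∀ s, ∀ x ∈ O.surface, g (_root_.rot s x) = g x)
    (hgc : ContinuousOn g (O.surface ∩ {x | 0 < rsq x})) {K : ℝ}
    (hgK : ∀ x ∈ O.surface, 0 < rsq x → |g x| ≤ K)
    (hwg : ∀ x ∈ O.surface, 0 < rsq x → w x = g x • O.Y x) :
    ∃ p : E3 → ℝ, O.SmoothOn p ∧ ∀ x ∈ O.surface, O.grad p x = w x := by
  obtain ⟨N, S, hP⟩ := hO.exists_poles
  obtain ⟨k, hk, hkap⟩ := exists_kap_lower_bound hO.connected hO.rot hO.curvature_pos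
  -- The derivative of the potential with respect to height: on tangent vectors dx₃ = (κ/r²)⟨Y, ·⟩,
  -- so G dx₃ = g⟨Y, ·⟩.
  let G : E3 → ℝ := fun x => g x * (rsq x / O.kap x)
  have hkrot : ∀ s, ∀ x ∈ O.surface, O.kap (_root_.rot s x) = O.kap x := by
    intro s x hx
    rw [← inner_X₃_normal_X₃, normal_rot hO.rot hx, ← rot_X₃, ← rot_X₃, inner_rot_rot,
      inner_X₃_normal_X₃]
  have hG : ∀ s, ∀ x ∈ O.surface, G (_root_.rot s x) = G x := by
    intro s x hx
    simp only [G, hg s x hx, rsq_rot, hkrot s x hx]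
  have hkc : ContinuousOn O.kap O.surface := by
    have h : ContinuousOn (fun x => inner ℝ (X₃ (O.normal x)) (X₃ x)) O.surface :=
      (contDiff_X₃.continuous.comp_continuousOn smoothOn_normal.continuousOn).inner
        contDiff_X₃.continuous.continuousOn
    exact h.congr fun x _ => (inner_X₃_normal_X₃ x).symm
  have hGc : ContinuousOn G (O.surface ∩ {x | 0 < rsq x}) :=
    hgc.mul ((contDiff_rsq.continuous.continuousOn).div (hkc.mono inter_subset_left)
      fun x hx => (hO.kap_pos hx.1 hx.2).ne')
  have hGK : ∀ x ∈ O.surface, 0 < rsq x → |G x| ≤ K * k⁻¹ := by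
    intro x hx hr
    have h1 := hkap x hx
    have h2 := hO.kap_pos hx hr
    rw [abs_mul]
    have h3 : |rsq x / O.kap x| ≤ k⁻¹ := by
      rw [abs_of_pos (div_pos hr h2), div_le_iff₀ h2, ← div_eq_inv_mul, le_div_iff₀ hk]
      linarith
    exact mul_le_mul (hgK x hx hr) h3 (abs_nonneg _) ((abs_nonneg _).trans (hgK x hx hr))
  set Gh := O.heightFun G with hGh
  have hGcont : ∀ x ∈ O.surface, 0 < rsq x → ContinuousAt Gh (x 2) := by
    intro x hx hr
    obtain ⟨m, hm0, hms, hm⟩ := hO.exists_meridian hx hr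
    have h1 : Gh =ᶠ[𝓝 (x 2)] fun c => G (m c) := by
      filter_upwards [hm] with c hc
      conv_lhs => rw [← hc.2]
      exact hO.heightFun_apply hG hc.1
    refine ContinuousAt.congr_of_eventuallyEq ?_ h1
    have h2 : ContinuousWithinAt G (O.surface ∩ {x | 0 < rsq x}) (m (x 2)) := by
      rw [hm0]; exact hGc x ⟨hx, hr⟩
    refine h2.tendsto.comp (tendsto_nhdsWithin_iff.2 ⟨hms.continuousAt, ?_⟩)
    have h3 : ∀ᶠ c in 𝓝 (x 2), 0 < rsq (m c) :=
      (contDiff_rsq.continuous.continuousAt.comp hms.continuousAt).eventually_const_lt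
        (by rw [Function.comp_apply, hm0]; exact hr)
    filter_upwards [hm, h3] with c h4 h5 using ⟨h4.1, h5⟩
  have hIoo : ∀ c ∈ Ioo (S 2) (N 2), ∃ x ∈ O.surface, 0 < rsq x ∧ x 2 = c := by
    intro c hc
    obtain ⟨x, hx, rfl⟩ := hP.exists_height c (Ioo_subset_Icc_self hc)
    exact ⟨x, hx, hP.rsq_pos hx hc.1 hc.2, rfl⟩
  have hGhc : ContinuousOn Gh (Ioo (S 2) (N 2)) := by
    intro c hc
    obtain ⟨x, hx, hr, rfl⟩ := hIoo c hc
    exact (hGcont x hx hr).continuousWithinAt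
  -- Boundedness suffices: nothing is claimed about G at the two poles.
  have hInt : IntervalIntegrable Gh volume (S 2) (N 2) := by
    rw [intervalIntegrable_iff_integrableOn_Ioo_of_le hP.lt.le]
    refine IntegrableOn.of_bound (by simp) (hGhc.aestronglyMeasurable measurableSet_Ioo)
      (K * k⁻¹) ?_
    filter_upwards [ae_restrict_mem measurableSet_Ioo] with c hc
    obtain ⟨x, hx, hr, rfl⟩ := hIoo c hc
    rw [hGh, hO.heightFun_apply hG hx]
    exact hGK x hx hr
  let π : ℝ → ℝ := fun c => ∫ t in (S 2)..c, Gh t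
  have hπc : ContinuousOn π (Icc (S 2) (N 2)) := by
    have := intervalIntegral.continuousOn_primitive_interval (μ := volume) (f := Gh)
      (a := S 2) (b := N 2) (by
        rw [uIcc_of_le hP.lt.le, integrableOn_Icc_iff_integrableOn_Ioo]
        exact (intervalIntegrable_iff_integrableOn_Ioo_of_le hP.lt.le).1 hInt)
    rwa [uIcc_of_le hP.lt.le] at this
  have hπd : ∀ x ∈ O.surface, 0 < rsq x → HasDerivAt π (G x) (x 2) := by
    intro x hx hr
    have hm := hP.mem_Ioo hO hx hr
    have h1 := intervalIntegral.integral_hasDerivAt_right (a := S 2) (b := x 2) (f := Gh)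
      (hInt.mono_set (by
        rw [uIcc_of_le hm.1.le, uIcc_of_le hP.lt.le]
        exact Icc_subset_Icc_right hm.2.le))
      (hGhc.stronglyMeasurableAtFilter isOpen_Ioo _ hm)
      (hGcont x hx hr)
    rwa [hGh, hO.heightFun_apply hG hx] at h1
  let p : E3 → ℝ := fun x => π (x 2)
  have hpc : ContinuousOn p O.surface :=
    hπc.comp continuous_height.continuousOn fun x hx => ⟨hP.south_le x hx, hP.le_north x hx⟩
  have main : ∀ x₀ ∈ O.surface, ∃ C : O.Chart x₀ univ,
      ContDiffOn ℝ ∞ (fun y => p (C.Φ y)) (Metric.ball 0 C.rad) ∧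
      ∀ y ∈ Metric.ball (0 : E2) C.rad, ∀ η, fderiv ℝ (fun y => p (C.Φ y)) y η =
        inner ℝ (w (C.Φ y)) (fderiv ℝ C.Φ y η) := by
    intro x₀ hx₀
    -- The chart avoids any pole other than its centre, so only the parameter 0 can correspond to a
    -- pole.
    have hVn : (({N, S} : Set E3) \ {x₀})ᶜ ∈ 𝓝 x₀ :=
      ((toFinite _).isClosed).isOpen_compl.mem_nhds (by simp)
    obtain ⟨C'⟩ := exists_chart hx₀ hVn
    let C : O.Chart x₀ univ := { C' with W_subset := subset_univ _ }
    refine ⟨C, ?_⟩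
    let A : E2 → E2 →L[ℝ] ℝ := fun y => (innerSL ℝ (w (C.Φ y))) ∘L fderiv ℝ C.Φ y
    have hAs : ContDiffOn ℝ ∞ A (Metric.ball 0 C.rad) :=
      (((innerSL ℝ : E3 →L[ℝ] E3 →L[ℝ] ℝ).contDiff.comp_contDiffOn
        (C.smoothOn_comp hw))).clm_comp
        (C.contDiffOn_Φ.fderiv_of_isOpen (m := ∞) Metric.isOpen_ball (by simp))
    have hreg : ∀ y ∈ Metric.ball (0 : E2) C.rad, 0 < rsq (C.Φ y) →
        HasFDerivAt (fun y => p (C.Φ y)) (A y) y := by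
      intro y hy hr
      have hx := C.Φ_mem y hy
      have h1 := (hπd _ hx hr).comp_hasFDerivAt y
        ((EuclideanSpace.proj 2 : E3 →L[ℝ] ℝ).hasFDerivAt.comp y (C.hasFDerivAt_Φ hy))
      refine h1.congr_fderiv ?_
      ext η
      have hT := C.fderiv_Φ_mem_tangent hy η
      have h2 := rsq_mul_height hO.rot hx hT
      have hk0 := (hO.kap_pos hx hr).ne'
      simp only [A, ContinuousLinearMap.comp_apply, innerSL_apply_apply, hwg _ hx hr,
        real_inner_smul_left]
      change G (C.Φ y) * (fderiv ℝ C.Φ y η) 2 = _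
      simp only [G]
      rw [real_inner_comm, mul_assoc, div_mul_eq_mul_div, h2, mul_div_cancel_right₀ _ hk0]
    have hall : ∀ y ∈ Metric.ball (0 : E2) C.rad, HasFDerivAt (fun y => p (C.Φ y)) (A y) y := by
      have hne : ∀ y ∈ Metric.ball (0 : E2) C.rad, y ≠ 0 → 0 < rsq (C.Φ y) := by
        intro y hy hy0
        refine (rsq_nonneg _).lt_of_ne' fun h0 => hy0 ?_
        have h1 := hP.eq_or_eq _ (C.Φ_mem y hy) h0
        have h2 := C'.W_subset (C.Φ_mem_W y hy)
        have h3 : C.Φ y = x₀ := by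
          by_contra h4
          exact h2 ⟨h1, h4⟩
        rw [← C.ξ_Φ y hy, h3, C.ξ_base]
      intro y hy
      -- At a possible pole the potential is continuous and the candidate derivative A, built from
      -- the smooth field w, is continuous as well.
      rcases eq_or_ne y 0 with rfl | hy0
      · refine hasFDerivAt_of_punctured C.rad_pos ?_ ?_ fun y hy hy0 => hreg y hy (hne y hy hy0)
        · exact hpc.comp C.contDiffOn_Φ.continuousOn C.Φ_mem
        · exact hAs.continuousOn.continuousAt (C.ball_mem_nhds hy)
      · exact hreg y hy (hne y hy hy0)
    refine ⟨?_, fun y hy η => by rw [(hall y hy).fderiv]; rfl⟩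
    -- The derivative is the smooth map A, so the potential is smooth.
    rw [contDiffOn_infty_iff_fderiv_of_isOpen Metric.isOpen_ball]
    exact ⟨fun y hy => (hall y hy).differentiableAt.differentiableWithinAt,
      hAs.congr fun y hy => (hall y hy).fderiv⟩
  have hps : O.SmoothOn p := by
    refine smoothOn_of_locally fun x hx => ?_
    obtain ⟨C, hC, -⟩ := main x hx
    refine ⟨C.W, C.isOpen_W, C.mem_W, ?_⟩
    refine (hC.comp C.contDiff_ξ.contDiffOn (fun z hz => C.mem_ball_ξ hz.2)).congr fun z hz => ?_
    simp only [Function.comp_apply, C.Φ_ξ z hz.1 hz.2]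
  refine ⟨p, hps, fun x hx => ?_⟩
  obtain ⟨C, -, hC⟩ := main x hx
  have hy := C.mem_ball_ξ C.mem_W
  have hxe := C.Φ_ξ x hx C.mem_W
  have key : ∀ τ ∈ O.tangent x, inner ℝ (O.grad p x - w x) τ = 0 := by
    intro τ hτ
    obtain ⟨η, hη⟩ := C.exists_fderiv_Φ_eq hy (by rwa [hxe] : τ ∈ O.tangent (C.Φ (C.ξ x)))
    have h1 := C.fderiv_ξ_fderiv_Φ hy η
    rw [hη, hxe] at h1
    rw [inner_sub_left, inner_grad hτ, C.fderivWithin_eq hps hx C.mem_W hτ, hC _ hy, h1, hη, hxe,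
      sub_self]
  exact sub_eq_zero.1 (inner_self_eq_zero.1
    (key _ ((O.tangent x).sub_mem (grad_mem_tangent p x) (hwT x hx))))

end SmoothDomain

/-! ### Stationary zonal flows -/

namespace SmoothDomain

variable {O : SmoothDomain}

/-- A vector field commuting with the rotations. -/
def IsEquivariant (O : SmoothDomain) (v : E3 → E3) : Prop :=
  ∀ s, ∀ x ∈ O.surface, v (rot s x) = rot s (v x)

theorem exists_ne_zero_mem_tangent {x : E3} (hx : x ∈ O.surface) :
    ∃ a ∈ O.tangent x, a ≠ 0 := by
  by_contra hex
  push Not at hex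
  have hbot : O.tangent x = ⊥ := (Submodule.eq_bot_iff _).2 hex
  have := finrank_tangent hx
  rw [hbot] at this
  simp at this

theorem normal_two_ne_zero_of_axis (hrot : O.IsRotationInvariant) {x : E3} (hx : x ∈ O.surface)
    (hr : rsq x = 0) : O.normal x 2 ≠ 0 := by
  obtain ⟨hx0, hx1⟩ := eq_zero_of_rsq hr
  obtain ⟨hn0, hn1⟩ := normal_of_axis hrot hx hx0 hx1
  intro h
  have h1 := norm_normal hx
  have h2 : O.normal x = 0 := E3_ext (by simp [hn0]) (by simp [hn1]) (by simp [h])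
  simp [h2] at h1

/-- The half turn fixes the point and negates horizontal vectors, and the tangent plane at a pole is
horizontal. -/
theorem IsEquivariant.eq_zero_of_axis {v : E3 → E3} (hv : O.IsEquivariant v)
    (hrot : O.IsRotationInvariant) {x : E3} (hx : x ∈ O.surface) (hT : v x ∈ O.tangent x)
    (hr : rsq x = 0) : v x = 0 := by
  obtain ⟨hx0, hx1⟩ := eq_zero_of_rsq hr
  obtain ⟨hn0, hn1⟩ := normal_of_axis hrot hx hx0 hx1
  have h2 := hv Real.pi x hx
  have h3 : rot Real.pi x = x := by apply E3_ext <;> simp [hx0, hx1]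
  rw [h3] at h2
  have h4 := congrArg (fun v : E3 => v 0) h2
  have h5 := congrArg (fun v : E3 => v 1) h2
  simp at h4 h5
  rw [mem_tangent, E3_inner_eq, hn0, hn1, zero_mul, zero_mul, zero_add, zero_add] at hT
  have h6 := (mul_eq_zero.1 hT).resolve_left (normal_two_ne_zero_of_axis hrot hx hr)
  exact E3_ext (by simp; linarith) (by simp; linarith) (by simpa using h6)

/-- The angular velocity of a field along the circles of latitude. -/
noncomputable def angular (v : E3 → E3) (x : E3) : ℝ := inner ℝ (v x) (X₃ x) / rsq x

theorem eq_angular_smul (hrot : O.IsRotationInvariant) {v : E3 → E3} {x : E3} (hx : x ∈ O.surface)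
    (hT : v x ∈ O.tangent x) (hY : inner ℝ (v x) (O.Y x) = 0) (hr : 0 < rsq x) :
    v x = angular v x • X₃ x := by
  have h := norm_sq_smul_eq hrot hx hT
  rw [hY, zero_smul, add_zero] at h
  rw [angular, div_eq_inv_mul, mul_smul, ← h, smul_smul, inv_mul_cancel₀ hr.ne', one_smul]

theorem IsEquivariant.angular_rot {v : E3 → E3} (hv : O.IsEquivariant v) (s : ℝ) {x : E3}
    (hx : x ∈ O.surface) : angular v (rot s x) = angular v x := by
  rw [angular, angular, hv s x hx, ← rot_X₃, inner_rot_rot, rsq_rot]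

theorem chi_rot (hrot : O.IsRotationInvariant) (s : ℝ) {x : E3}
    (hx : x ∈ O.surface) : O.chi (rot s x) = O.chi x := by
  rw [chi_eq, chi_eq, normal_rot hrot hx, rot_two_apply]

theorem Y_equivariant (hrot : O.IsRotationInvariant) : O.IsEquivariant O.Y := by
  intro s x hx
  rw [Y, J, normal_rot hrot hx, ← rot_X₃, ← rot_cross]; rfl

/-- The divergence of a zonal flow vanishes. -/
theorem div_eq_zero_of_equivariant (hrot : O.IsRotationInvariant) {v : E3 → E3}
    (hv : O.IsSmoothTangentField v) (hY : ∀ x ∈ O.surface, inner ℝ (v x) (O.Y x) = 0)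
    (heq : O.IsEquivariant v) {x : E3} (hx : x ∈ O.surface) : O.div v x = 0 := by
  rcases (rsq_nonneg x).eq_or_lt with hr | hr
  · have hX0 : X₃ x = 0 := X₃_eq_zero hr.symm
    have hv0 := heq.eq_zero_of_axis hrot hx (hv.2 x hx) hr.symm
    have hY0 : O.Y x = 0 := by rw [Y, hX0]; exact (crossL (O.normal x)).map_zero
    have hchi : O.chi x ≠ 0 := by rw [chi_eq]; exact normal_two_ne_zero_of_axis hrot hx hr.symm
    -- At a pole both v and Y vanish, so the second-order part of ⟨v, Y⟩ = 0 along a curve with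
    -- velocity a reads ⟨D_a v, D_a Y⟩ = 0. Here D_a Y = -χa and χ ≠ 0.
    have key : ∀ a ∈ O.tangent x, inner ℝ (fderivWithin ℝ v O.surface x a) a = 0 := by
      intro a ha
      obtain ⟨c, rfl, hc, hM⟩ := exists_curve hx ha
      have h1 := hv.1.comp_hasDerivAt hc hM
      have h2 := smoothOn_Y.comp_hasDerivAt hc hM
      rw [fderivWithin_Y hx ha, hX0, X₃_eq, E3_cross_cross, mem_tangent.1 ha, zero_smul, zero_sub,
        real_inner_comm, ← chi] at h2
      have h3 : cross (fderivWithin ℝ O.normal O.surface (c 0) a) 0 = 0 :=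
        (crossL _).map_zero
      rw [h3, zero_add] at h2
      have s1 := hasDerivAt_iff_tendsto_slope.1 h1
      have s2 := hasDerivAt_iff_tendsto_slope.1 h2
      have s3 := s1.inner (𝕜 := ℝ) s2
      have s4 := tendsto_nhds_unique s3 ((tendsto_const_nhds (x := (0 : ℝ))).congr' (by
        filter_upwards [hM.filter_mono nhdsWithin_le_nhds] with t ht
        simp only [slope_def_module, hv0, hY0, sub_zero, real_inner_smul_left,
          real_inner_smul_right, hY _ ht, mul_zero]))
      rw [inner_neg_right, real_inner_smul_right, neg_eq_zero] at s4
      exact (mul_eq_zero.1 s4).resolve_left hchi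
    obtain ⟨a, ha, ha0⟩ := exists_ne_zero_mem_tangent hx
    have h := norm_sq_mul_div v hx ha
    rw [key a ha, key _ (O.J_mem_tangent x a), add_zero] at h
    exact (mul_eq_zero.1 h).resolve_left (by simpa using ha0)
  · have h := norm_sq_mul_div v hx (X₃_mem_tangent hrot hx)
    have hva := eq_angular_smul hrot hx (hv.2 x hx) (hY x hx) hr
    have h1 : inner ℝ (fderivWithin ℝ v O.surface x (X₃ x)) (X₃ x) = 0 := by
      rw [fderivWithin_X₃_eq_of_equivariant hrot hv.1 heq hx, hva, X₃_eq (angular v x • X₃ x),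
        cross_smul_right, real_inner_smul_left, real_inner_comm, inner_cross_right_self, mul_zero]
    -- Differentiating ⟨v, Y⟩ = 0 along Y gives ⟨D_Y v, Y⟩ = -⟨v, D_Y Y⟩ = χ⟨v, Y⟩ = 0.
    have h2 : inner ℝ (fderivWithin ℝ v O.surface x (O.Y x)) (O.Y x) = 0 := by
      have hYT := Y_mem_tangent (O := O) x
      have h3 := fderivWithin_inner hv.1 smoothOn_Y hx hYT
      have h4 : fderivWithin ℝ (fun y => inner ℝ (v y) (O.Y y)) O.surface x (O.Y x) = 0 := by
        obtain ⟨c, hc0, hc, hM⟩ := exists_curve hx hYT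
        subst hc0
        exact ((hv.1.inner smoothOn_Y).comp_hasDerivAt hc hM).unique
          ((hasDerivAt_const (0 : ℝ) (0 : ℝ)).congr_of_eventuallyEq
            (by filter_upwards [hM] with t ht using hY _ ht))
      rw [h4, real_inner_comm, inner_fderivWithin_Y hrot hx (hv.2 x hx), real_inner_comm,
        hY x hx] at h3
      linarith
    rw [h1] at h
    change _ = 0 + inner ℝ (fderivWithin ℝ v O.surface x (O.Y x)) (O.Y x) at h
    rw [h2, add_zero, norm_X₃_sq] at h
    exact (mul_eq_zero.1 h).resolve_left hr.ne'

theorem abs_chi_le {x : E3} (hx : x ∈ O.surface) : |O.chi x| ≤ 1 := by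
  have he : ‖e₃‖ = 1 := by simp [e₃, EuclideanSpace.norm_eq, Fin.sum_univ_three]
  simpa [chi, norm_normal hx, he] using abs_real_inner_le_norm e₃ (O.normal x)

theorem exists_tderiv_bound {F : Type*} [NormedAddCommGroup F] [NormedSpace ℝ F] {f : E3 → F}
    (hf : O.SmoothOn f) : ∃ C, ∀ x ∈ O.surface, ‖O.tderiv f x‖ ≤ C :=
  isCompact_surface.exists_bound_of_continuousOn hf.tderiv.continuousOn

theorem norm_X₃_X₃ (x : E3) : ‖X₃ (X₃ x)‖ = ‖X₃ x‖ := by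
  rw [norm_eq_sqrt_real_inner, norm_eq_sqrt_real_inner, E3_inner_eq, E3_inner_eq]
  simp [add_comm]

/-- A smooth zonal flow is stationary. -/
theorem IsOval.isStationarySolution (hO : O.IsOval) {v : E3 → E3} (hv : O.IsSmoothTangentField v)
    (hY : ∀ x ∈ O.surface, inner ℝ (v x) (O.Y x) = 0) (heq : O.IsEquivariant v) (Ω : ℝ) :
    O.IsStationarySolution Ω v := by
  have hrot := hO.rot
  -- The field that must be the gradient of the pressure.
  let w : E3 → E3 := fun x => (Ω * O.chi x) • O.J x (v x) -
    (O.tangent x).starProjection (O.tderiv v x (v x))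
  have hw : O.SmoothOn w :=
    ((contDiffOn_const.mul smoothOn_chi).smul hv.1.J).sub
      (smoothOn_starProjection.clm_apply (hv.1.tderiv.clm_apply hv.1))
  let g : E3 → ℝ := fun x => Ω * O.chi x * angular v x - O.chi x * angular v x ^ 2
  have hwg : ∀ x ∈ O.surface, 0 < rsq x → w x = g x • O.Y x := by
    intro x hx hr
    have hva := eq_angular_smul hrot hx (hv.2 x hx) (hY x hx) hr
    have hXT := X₃_mem_tangent hrot hx
    -- Equivariance gives D_X v = X(v) = ωX(X), with ω the angular velocity, hence D_v v = ω²X(X),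
    -- whose tangential part is ω²χY.
    have h1 : (O.tangent x).starProjection (O.tderiv v x (v x)) =
        (O.chi x * angular v x ^ 2) • O.Y x := by
      have h2 : O.tderiv v x (v x) = (angular v x ^ 2) • X₃ (X₃ x) := by
        conv_lhs => rw [hva]
        rw [map_smul, tderiv_apply_of_mem hXT,
          fderivWithin_X₃_eq_of_equivariant hrot hv.1 heq hx, hva, X₃_eq (angular v x • X₃ x),
          cross_smul_right, smul_smul, ← X₃_eq, ← sq]
      have h3 : (O.tangent x).starProjection (X₃ (X₃ x)) = O.chi x • O.Y x := by
        rw [← sub_eq_zero, ← inner_self_eq_zero (𝕜 := ℝ)]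
        have hmem := (O.tangent x).sub_mem
          (Submodule.starProjection_apply_mem (O.tangent x) (X₃ (X₃ x)))
          ((O.tangent x).smul_mem (O.chi x) (Y_mem_tangent x))
        rw [inner_sub_left, inner_starProjection_left hmem, inner_X₃_X₃ hrot hx hmem,
          real_inner_smul_left, sub_self]
      rw [h2, map_smul, h3, smul_smul, mul_comm]
    have h4 : O.J x (v x) = angular v x • O.Y x := by
      conv_lhs => rw [hva]
      exact cross_smul_right _ _ _
    simp only [w, g, h1, h4, smul_smul, sub_smul]
  have hwT : ∀ x ∈ O.surface, w x ∈ O.tangent x := fun x hx =>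
    (O.tangent x).sub_mem ((O.tangent x).smul_mem _ (O.J_mem_tangent _ _))
      (Submodule.starProjection_apply_mem _ _)
  have hgrot : ∀ s, ∀ x ∈ O.surface, g (_root_.rot s x) = g x := by
    intro s x hx
    simp only [g, chi_rot hrot s hx, heq.angular_rot s hx]
  obtain ⟨C, hC⟩ := exists_tderiv_bound hv.1
  -- From |D_X v| = |ω||X(X)| = |ω||X|, the angular velocity is bounded by the norm of the
  -- derivative of v, also near the poles.
  have hang : ∀ x ∈ O.surface, 0 < rsq x → |angular v x| ≤ C := by
    intro x hx hr
    have hXT := X₃_mem_tangent hrot hx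
    have h1 := (O.tderiv v x).le_opNorm (X₃ x)
    have hva := eq_angular_smul hrot hx (hv.2 x hx) (hY x hx) hr
    rw [tderiv_apply_of_mem hXT, fderivWithin_X₃_eq_of_equivariant hrot hv.1 heq hx, hva,
      X₃_eq (angular v x • X₃ x), cross_smul_right, ← X₃_eq, norm_smul, norm_X₃_X₃] at h1
    exact (le_of_mul_le_mul_right h1 (norm_pos_iff.2 (rsq_ne_zero_X₃ hr))).trans (hC x hx)
  have hgK : ∀ x ∈ O.surface, 0 < rsq x → |g x| ≤ |Ω| * C + C ^ 2 := by
    intro x hx hr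
    have h1 := hang x hx hr
    have h2 := abs_chi_le hx
    have hC0 : 0 ≤ C := (abs_nonneg _).trans h1
    calc |g x| ≤ |Ω * O.chi x * angular v x| + |O.chi x * angular v x ^ 2| := abs_sub _ _
      _ = |Ω| * (|O.chi x| * |angular v x|) + |O.chi x| * |angular v x| ^ 2 := by
        rw [abs_mul, abs_mul, abs_mul, abs_pow, mul_assoc]
      _ ≤ |Ω| * (1 * C) + 1 * C ^ 2 := by gcongr
      _ = _ := by ring
  have hgc : ContinuousOn g (O.surface ∩ {x | 0 < rsq x}) := by
    have h1 : ContinuousOn (angular v) (O.surface ∩ {x | 0 < rsq x}) :=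
      ((hv.1.continuousOn.inner contDiff_X₃.continuous.continuousOn).mono inter_subset_left).div
        contDiff_rsq.continuous.continuousOn fun x hx => (ne_of_gt hx.2)
    have h2 := (smoothOn_chi (O := O)).continuousOn.mono
      (inter_subset_left (t := {x | 0 < rsq x}))
    exact ((continuousOn_const.mul h2).mul h1).sub (h2.mul (h1.pow 2))
  obtain ⟨p, hp, hpw⟩ := hO.exists_potential hw hwT hgrot hgc hgK hwg
  refine ⟨fun _ => p, ?_, ?_, fun _ => hv.2, ?_, fun _ x hx =>
    div_eq_zero_of_equivariant hrot hv hY heq hx⟩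
  · exact ContDiffOn.comp hv.1 contDiffOn_snd fun z hz => hz.2
  · exact ContDiffOn.comp hp contDiffOn_snd fun z hz => hz.2
  · intro t x hx
    rw [hpw x hx, deriv_const, zero_add, covDeriv_eq (hv.2 x hx)]
    simp only [w]
    abel

/-! ### From zonal functions to zonal flows. -/

theorem IsZonal.comp_rot (hrot : O.IsRotationInvariant) {f : E3 → ℝ} (hf : O.IsZonal f) (s : ℝ)
    {x : E3} (hx : x ∈ O.surface) : f (rot s x) = f x := by
  have h1 : ∀ t, HasDerivAt (fun t => f (rot t x)) 0 t := fun t => by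
    have := hf.1.hasDerivAt_rot hrot hx t
    rwa [hf.2 _ (hrot t x hx)] at this
  have := is_const_of_deriv_eq_zero (fun t => (h1 t).differentiableAt) (fun t => (h1 t).deriv) s 0
  simpa [rot_zero] using this

theorem grad_equivariant (hrot : O.IsRotationInvariant) {f : E3 → ℝ} (hf : O.SmoothOn f)
    (hz : ∀ s, ∀ x ∈ O.surface, f (rot s x) = f x) : O.IsEquivariant (O.grad f) := by
  intro s x hx
  have hxs := hrot s x hx
  have key : ∀ τ ∈ O.tangent x,
      inner ℝ (O.grad f (rot s x) - rot s (O.grad f x)) (rot s τ) = 0 := by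
    intro τ hτ
    rw [inner_sub_left, inner_rot_rot, inner_grad hτ, inner_grad (rot_mem_tangent hrot hx hτ s)]
    obtain ⟨c, rfl, hc, hM⟩ := exists_curve hx hτ
    have h1 : HasDerivAt (fun t => rot s (c t)) (rot s τ) 0 :=
      (rotE s).toContinuousLinearEquiv.hasFDerivAt.comp_hasDerivAt 0 hc
    have h2 := hf.comp_hasDerivAt h1 (by filter_upwards [hM] with t ht using hrot s _ ht)
    have h3 := hf.comp_hasDerivAt hc hM
    rw [sub_eq_zero]
    refine h2.unique (h3.congr_of_eventuallyEq ?_)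
    filter_upwards [hM] with t ht using hz s _ ht
  have hmem := (O.tangent _).sub_mem (grad_mem_tangent f (rot s x))
    (rot_mem_tangent hrot hx (grad_mem_tangent f x) s)
  have h4 := rot_mem_tangent hrot hxs hmem (-s)
  rw [rot_neg_rot] at h4
  have h5 := key _ h4
  rw [rot_rot_neg] at h5
  exact sub_eq_zero.1 (inner_self_eq_zero.1 h5)

/-- J is an isometry of the tangent plane, so ⟨J∇f, Y⟩ = ⟨∇f, X⟩ = Xf = 0, and J∇f inherits
equivariance from f and ν. -/
theorem IsOval.isStationarySolution_of_isZonal (hO : O.IsOval) {f : E3 → ℝ} (hf : O.IsZonal f)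
    (Ω : ℝ) : O.IsStationarySolution Ω (fun x => O.J x (O.grad f x)) := by
  have hrot := hO.rot
  refine hO.isStationarySolution ⟨hf.1.grad.J, fun x _ => O.J_mem_tangent _ _⟩ ?_ ?_ Ω
  · intro x hx
    rw [Y, J, J, inner_cross_cross_self (norm_normal hx) (mem_tangent.1 (grad_mem_tangent f x)),
      inner_grad (X₃_mem_tangent hrot hx), hf.2 x hx]
  · intro s x hx
    change O.J (_root_.rot s x) (O.grad f (_root_.rot s x)) = _root_.rot s (O.J x (O.grad f x))
    rw [grad_equivariant hrot hf.1 (fun s x hx => hf.comp_rot hrot s hx) s x hx, J,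
      normal_rot hrot hx, ← rot_cross]; rfl

end SmoothDomain

/-! ### The area measure in a chart -/

section AreaFormula

open scoped NNReal ENNReal

theorem LipschitzOnWith.euclideanHausdorffMeasure_image_le {X Y : Type*} [EMetricSpace X]
    [EMetricSpace Y] [MeasurableSpace X] [BorelSpace X] [MeasurableSpace Y] [BorelSpace Y]
    {K : ℝ≥0} {f : X → Y} {s : Set X} (h : LipschitzOnWith K f s) (d : ℕ) :
    (μHE[d] : Measure Y) (f '' s) ≤ (K : ℝ≥0∞) ^ d * (μHE[d] : Measure X) s := by
  simp only [Measure.euclideanHausdorffMeasure_def, Measure.smul_apply]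
  have h1 := h.hausdorffMeasure_image_le (d := d) (Nat.cast_nonneg d)
  rw [ENNReal.rpow_natCast] at h1
  calc _ ≤ _ • ((K : ℝ≥0∞) ^ d * (μH[d] : Measure X) s) := by gcongr
    _ = _ := (mul_smul_comm _ _ _).symm

/-- Comparison of measures is a local property. -/
theorem measure_le_of_locally {X : Type*} [TopologicalSpace X] [SecondCountableTopology X]
    [MeasurableSpace X] [OpensMeasurableSpace X] {ν μ : Measure X} {K : ℝ≥0∞} {D : Set X}
    (h : ∀ y ∈ D, ∃ U ∈ 𝓝 y, ∀ s ⊆ U, MeasurableSet s → s ⊆ D → ν s ≤ K * μ s)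
    {s : Set X} (hs : MeasurableSet s) (hsD : s ⊆ D) : ν s ≤ K * μ s := by
  choose! U hU hle using h
  obtain ⟨t, htD, htc, hcov⟩ := TopologicalSpace.countable_cover_nhdsWithin
    (f := fun y => interior (U y)) (s := s)
    fun y hy => mem_nhdsWithin_of_mem_nhds (interior_mem_nhds.2 (hU y (hsD hy)))
  rcases s.eq_empty_or_nonempty with rfl | ⟨y₀, hy₀⟩
  · simp
  have htne : t.Nonempty := by
    obtain ⟨y, hy, -⟩ := mem_iUnion₂.1 (hcov hy₀)
    exact ⟨y, hy⟩
  obtain ⟨e, rfl⟩ := htc.exists_eq_range htne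
  let d : ℕ → Set X := disjointed fun n => interior (U (e n))
  have hdm : ∀ n, MeasurableSet (s ∩ d n) := fun n =>
    hs.inter (MeasurableSet.disjointed (fun n => isOpen_interior.measurableSet) n)
  have hdd : Pairwise (Function.onFun Disjoint fun n => s ∩ d n) := fun i j hij =>
    ((disjoint_disjointed fun n => interior (U (e n))) hij).mono inter_subset_right
      inter_subset_right
  have hsu : s = ⋃ n, s ∩ d n := by
    rw [← inter_iUnion, iUnion_disjointed, eq_comm, inter_eq_left]
    simpa using hcov
  calc ν s = ∑' n, ν (s ∩ d n) := by
        conv_lhs => rw [hsu]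
        exact measure_iUnion hdd hdm
    _ ≤ ∑' n, K * μ (s ∩ d n) := ENNReal.tsum_le_tsum fun n =>
        hle (e n) (hsD (htD (mem_range_self n))) _
          (inter_subset_right.trans ((disjointed_subset _ n).trans interior_subset)) (hdm n)
          (inter_subset_left.trans hsD)
    _ = K * μ s := by
        rw [ENNReal.tsum_mul_left]
        conv_rhs => rw [hsu]
        rw [measure_iUnion hdd hdm]

theorem ENNReal.le_of_forall_pow_three_mul_le {a b : ℝ≥0∞}
    (h : ∀ L : ℝ≥0, 1 < L → a ≤ ((L : ℝ≥0∞) ^ 3) * b) : a ≤ b := by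
  have h1 : Tendsto (fun L : ℝ≥0 => ((L : ℝ≥0∞) ^ 3) * b) (𝓝[>] 1) (𝓝 (((1 : ℝ≥0) : ℝ≥0∞) ^ 3 * b)) := by
    refine ENNReal.Tendsto.mul_const ?_ (Or.inl (by simp))
    have : Continuous fun L : ℝ≥0 => (L : ℝ≥0∞) ^ 3 := (ENNReal.continuous_pow 3).comp
      ENNReal.continuous_coe
    exact this.continuousAt.tendsto.mono_left nhdsWithin_le_nhds
  have h2 := ge_of_tendsto h1 (by filter_upwards [self_mem_nhdsWithin] with L hL using h L hL)
  simpa using h2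

namespace SmoothDomain

variable {O : SmoothDomain}

/-- The basis vectors of the plane. -/
noncomputable def basisE2 (i : Fin 2) : E2 := EuclideanSpace.basisFun (Fin 2) ℝ i

/-- The square of the normalized determinant is the Gram determinant of the columns, which by
Lagrange's identity is the square of the norm of their cross product. -/
theorem normDet_eq_norm_cross (A : E2 →L[ℝ] E3) :
    A.toLinearMap.normDet = ‖cross (A (basisE2 0)) (A (basisE2 1))‖ := by
  have h := A.toLinearMap.normDet_sq_eq_det_gram (EuclideanSpace.basisFun (Fin 2) ℝ)
  rw [Matrix.det_fin_two] at h
  have h2 : ‖cross (A (basisE2 0)) (A (basisE2 1))‖ ^ 2 = A.toLinearMap.normDet ^ 2 := by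
    rw [← real_inner_self_eq_norm_sq, inner_cross_cross]
    exact h.symm
  exact (pow_left_inj₀ (LinearMap.normDet_nonneg _) (norm_nonneg _) two_ne_zero).1 h2.symm

namespace Chart

variable {x₀ : E3} {V : Set E3} (C : O.Chart x₀ V)

/-- The area density. -/
noncomputable def jac (y : E2) : ℝ :=
  ‖cross (fderiv ℝ C.Φ y (basisE2 0)) (fderiv ℝ C.Φ y (basisE2 1))‖

theorem contDiffOn_fderiv_Φ : ContDiffOn ℝ ∞ (fderiv ℝ C.Φ) (Metric.ball 0 C.rad) :=
  C.contDiffOn_Φ.fderiv_of_isOpen (m := ∞) Metric.isOpen_ball (by simp)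

theorem continuousOn_fderiv_apply (η : E2) :
    ContinuousOn (fun y => fderiv ℝ C.Φ y η) (Metric.ball 0 C.rad) :=
  C.contDiffOn_fderiv_Φ.continuousOn.clm_apply continuousOn_const

theorem continuousOn_cross_fderiv : ContinuousOn (fun y =>
    cross (fderiv ℝ C.Φ y (basisE2 0)) (fderiv ℝ C.Φ y (basisE2 1))) (Metric.ball 0 C.rad) :=
  continuous_cross.comp_continuousOn
    ((C.continuousOn_fderiv_apply _).prodMk (C.continuousOn_fderiv_apply _))

theorem continuousOn_jac : ContinuousOn C.jac (Metric.ball 0 C.rad) :=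
  C.continuousOn_cross_fderiv.norm

theorem jac_pos {y : E2} (hy : y ∈ Metric.ball 0 C.rad) : 0 < C.jac y := by
  rw [jac, ← normDet_eq_norm_cross]
  refine lt_of_le_of_ne (LinearMap.normDet_nonneg _) (Ne.symm ?_)
  exact ((fderiv ℝ C.Φ y).toLinearMap.normDet_ne_zero_tfae.out 0 4).2 (C.injective_fderiv_Φ hy)

/-- The area measure in the chart. -/
noncomputable def pushArea : Measure E2 := ((μHE[2] : Measure E3).restrict (O.surface ∩ C.W)).map C.ξ

/-- The area measure in the chart, as a density. -/
noncomputable def densArea : Measure E2 :=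
  (volume.restrict (Metric.ball 0 C.rad)).withDensity fun y => ENNReal.ofReal (C.jac y)

theorem surface_inter_W_eq_image (s : Set E2) (hs : s ⊆ Metric.ball 0 C.rad) :
    C.ξ ⁻¹' s ∩ (O.surface ∩ C.W) = C.Φ '' s := by
  ext x
  constructor
  · rintro ⟨h1, h2, h3⟩
    exact ⟨C.ξ x, h1, C.Φ_ξ x h2 h3⟩
  · rintro ⟨y, hy, rfl⟩
    exact ⟨by rwa [mem_preimage, C.ξ_Φ y (hs hy)], C.Φ_mem y (hs hy), C.Φ_mem_W y (hs hy)⟩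

theorem pushArea_apply {s : Set E2} (hs : MeasurableSet s) (hsD : s ⊆ Metric.ball 0 C.rad) :
    C.pushArea s = (μHE[2] : Measure E3) (C.Φ '' s) := by
  rw [pushArea, Measure.map_apply C.contDiff_ξ.continuous.measurable hs,
    Measure.restrict_apply (C.contDiff_ξ.continuous.measurable hs),
    C.surface_inter_W_eq_image s hsD]

theorem densArea_apply {s : Set E2} (hs : MeasurableSet s) (hsD : s ⊆ Metric.ball 0 C.rad) :
    C.densArea s = ∫⁻ y in s, ENNReal.ofReal (C.jac y) := by
  rw [densArea, withDensity_apply _ hs, Measure.restrict_restrict hs, inter_eq_left.2 hsD]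

theorem area_image_linear (y : E2) (s : Set E2) : (μHE[2] : Measure E3) (fderiv ℝ C.Φ y '' s) =
    ENNReal.ofReal (C.jac y) * volume s := by
  have h := (fderiv ℝ C.Φ y).toLinearMap.euclideanHausdorffMeasure_image_eq_normDet_mul_volume s
  rw [normDet_eq_norm_cross, finrank_euclideanSpace_fin] at h
  exact h

/-- Near y₀ the map Φ is its differential A up to distortion L: Φ∘A⁻¹ and its inverse are
L-Lipschitz, so areas of images agree up to L². The third factor L absorbs the variation of the
density. -/
theorem exists_nhds_compare {y₀ : E2} (hy₀ : y₀ ∈ Metric.ball 0 C.rad) {L : ℝ≥0} (hL : 1 < L) :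
    ∃ U ∈ 𝓝 y₀, ∀ s ⊆ U, MeasurableSet s → s ⊆ Metric.ball 0 C.rad →
      C.pushArea s ≤ (L : ℝ≥0∞) ^ 3 * C.densArea s ∧
      C.densArea s ≤ (L : ℝ≥0∞) ^ 3 * C.pushArea s := by
  set A := fderiv ℝ C.Φ y₀ with hA
  obtain ⟨k, hk, hanti⟩ := A.toLinearMap.exists_antilipschitzWith
    (LinearMap.ker_eq_bot.2 (C.injective_fderiv_Φ hy₀))
  have hL' : (1 : ℝ) < L := by exact_mod_cast hL
  have hL0 : (0 : ℝ) < L := by linarith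
  -- Chosen so that 1 + ε ≤ L and L(1 - ε) = 1, the upper and the lower Lipschitz bound.
  let ε : ℝ := 1 - (L : ℝ)⁻¹
  have hε : 0 < ε := by
    simp only [ε, sub_pos]; exact inv_lt_one_of_one_lt₀ hL'
  have hε1 : 1 + ε ≤ L := by
    simp only [ε]
    have : (L : ℝ) * (L : ℝ)⁻¹ = 1 := mul_inv_cancel₀ hL0.ne'
    nlinarith [inv_pos.2 hL0, sq_nonneg ((L : ℝ) - 1)]
  have hε2 : (L : ℝ) * (1 - ε) = 1 := by
    simp only [ε]; rw [sub_sub_cancel, mul_inv_cancel₀ hL0.ne']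
  have hstrict : HasStrictFDerivAt C.Φ A y₀ :=
    ((C.contDiffOn_Φ y₀ hy₀).contDiffAt (C.ball_mem_nhds hy₀)).hasStrictFDerivAt (by simp)
  -- With k the antilipschitz constant of A, an error c|y - z| is at most ε|Ay - Az|.
  let c : ℝ≥0 := ⟨ε, hε.le⟩ / k
  have hc : 0 < c := div_pos (by exact_mod_cast hε) hk
  obtain ⟨U₁, hU₁, happ⟩ := hstrict.approximates_deriv_on_nhds (Or.inr hc)
  have hest : ∀ y ∈ U₁, ∀ z ∈ U₁, ‖C.Φ y - C.Φ z - (A y - A z)‖ ≤ ε * ‖A y - A z‖ := by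
    intro y hy z hz
    have h1 := happ y hy z hz
    rw [map_sub] at h1
    refine h1.trans ?_
    have h2 := hanti.le_mul_dist y z
    rw [dist_eq_norm, dist_eq_norm] at h2
    have hk' : (0 : ℝ) < k := hk
    calc (c : ℝ) * ‖y - z‖ ≤ c * (k * ‖A y - A z‖) := by gcongr; exact h2
      _ = ε * ‖A y - A z‖ := by
        have : (c : ℝ) = ε / k := rfl
        rw [this]; field_simp
  have hup : ∀ y ∈ U₁, ∀ z ∈ U₁, ‖C.Φ y - C.Φ z‖ ≤ L * ‖A y - A z‖ := by
    intro y hy z hz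
    have h1 := hest y hy z hz
    have h2 := norm_le_insert' (C.Φ y - C.Φ z) (A y - A z)
    calc _ ≤ ‖A y - A z‖ + ε * ‖A y - A z‖ := h2.trans (by gcongr)
      _ = (1 + ε) * ‖A y - A z‖ := by ring
      _ ≤ _ := by gcongr
  have hlow : ∀ y ∈ U₁, ∀ z ∈ U₁, ‖A y - A z‖ ≤ L * ‖C.Φ y - C.Φ z‖ := by
    intro y hy z hz
    have h1 := hest y hy z hz
    have h2 := norm_le_insert (C.Φ y - C.Φ z) (A y - A z)
    have h3 : (1 - ε) * ‖A y - A z‖ ≤ ‖C.Φ y - C.Φ z‖ := by linarith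
    calc ‖A y - A z‖ = L * ((1 - ε) * ‖A y - A z‖) := by rw [← mul_assoc, hε2, one_mul]
      _ ≤ _ := by gcongr
  have hjc : ContinuousAt C.jac y₀ := C.continuousOn_jac.continuousAt (C.ball_mem_nhds hy₀)
  have hj0 := C.jac_pos hy₀
  have hU₂ : ∀ᶠ y in 𝓝 y₀, C.jac y < L * C.jac y₀ :=
    hjc.eventually_lt_const (lt_mul_of_one_lt_left hj0 hL')
  have hU₃ : ∀ᶠ y in 𝓝 y₀, C.jac y₀ < L * C.jac y :=
    (continuousAt_const.mul hjc).eventually_const_lt (lt_mul_of_one_lt_left hj0 hL')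
  refine ⟨U₁ ∩ ({y | C.jac y < L * C.jac y₀} ∩ {y | C.jac y₀ < L * C.jac y}),
    inter_mem hU₁ (inter_mem hU₂ hU₃), fun s hsU hs hsD => ?_⟩
  have hL3 : (ENNReal.ofReal (L : ℝ)) = (L : ℝ≥0∞) := ENNReal.ofReal_coe_nnreal
  -- The differential of ξ at Φ(y₀) is a left inverse of A, so this map is Φ∘A⁻¹ on the range of A.
  have himg1 : C.Φ '' s = (fun w => C.Φ (fderiv ℝ C.ξ (C.Φ y₀) w)) '' (A '' s) := by
    rw [image_image]
    exact image_congr fun y _ => by rw [C.fderiv_ξ_fderiv_Φ hy₀]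
  have himg2 : A '' s = (fun x => A (C.ξ x)) '' (C.Φ '' s) := by
    rw [image_image]
    exact image_congr fun y hy => by rw [C.ξ_Φ y (hsD hy)]
  have hlip1 : LipschitzOnWith L (fun w => C.Φ (fderiv ℝ C.ξ (C.Φ y₀) w)) (A '' s) := by
    refine LipschitzOnWith.of_dist_le_mul ?_
    rintro _ ⟨y, hy, rfl⟩ _ ⟨z, hz, rfl⟩
    rw [hA, C.fderiv_ξ_fderiv_Φ hy₀, C.fderiv_ξ_fderiv_Φ hy₀, dist_eq_norm, dist_eq_norm]
    exact hup y (hsU hy).1 z (hsU hz).1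
  have hlip2 : LipschitzOnWith L (fun x => A (C.ξ x)) (C.Φ '' s) := by
    refine LipschitzOnWith.of_dist_le_mul ?_
    rintro _ ⟨y, hy, rfl⟩ _ ⟨z, hz, rfl⟩
    rw [C.ξ_Φ y (hsD hy), C.ξ_Φ z (hsD hz), dist_eq_norm, dist_eq_norm]
    exact hlow y (hsU hy).1 z (hsU hz).1
  have hm1 := hlip1.euclideanHausdorffMeasure_image_le 2
  have hm2 := hlip2.euclideanHausdorffMeasure_image_le 2
  rw [← himg1, C.area_image_linear] at hm1
  rw [← himg2, C.area_image_linear] at hm2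
  rw [C.pushArea_apply hs hsD, C.densArea_apply hs hsD]
  constructor
  · calc _ ≤ _ := hm1
      _ = (L : ℝ≥0∞) ^ 2 * ∫⁻ y in s, ENNReal.ofReal (C.jac y₀) := by rw [setLIntegral_const]
      _ ≤ (L : ℝ≥0∞) ^ 2 * ∫⁻ y in s, L * ENNReal.ofReal (C.jac y) := by
        gcongr 1
        refine setLIntegral_mono' hs fun y hy => ?_
        rw [← hL3, ← ENNReal.ofReal_mul hL0.le]
        exact ENNReal.ofReal_le_ofReal (hsU hy).2.2.le
      _ = _ := by rw [lintegral_const_mul' _ _ ENNReal.coe_ne_top]; ring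
  · calc ∫⁻ y in s, ENNReal.ofReal (C.jac y)
          ≤ ∫⁻ y in s, L * ENNReal.ofReal (C.jac y₀) := by
            refine setLIntegral_mono' hs fun y hy => ?_
            rw [← hL3, ← ENNReal.ofReal_mul hL0.le]
            exact ENNReal.ofReal_le_ofReal (hsU hy).2.1.le
      _ = L * (ENNReal.ofReal (C.jac y₀) * volume s) := by rw [setLIntegral_const, mul_assoc]
      _ ≤ L * ((L : ℝ≥0∞) ^ 2 * (μHE[2] : Measure E3) (C.Φ '' s)) := by gcongr
      _ = _ := by ring

/-- The area formula. -/
theorem pushArea_eq : C.pushArea = C.densArea := by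
  have hball : ∀ {s : Set E2}, MeasurableSet s → s ⊆ Metric.ball 0 C.rad →
      C.pushArea s = C.densArea s := by
    intro s hs hsD
    refine le_antisymm (ENNReal.le_of_forall_pow_three_mul_le fun L hL => ?_)
      (ENNReal.le_of_forall_pow_three_mul_le fun L hL => ?_)
    · refine measure_le_of_locally (D := Metric.ball 0 C.rad) (fun y hy => ?_) hs hsD
      obtain ⟨U, hU, h⟩ := C.exists_nhds_compare hy hL
      exact ⟨U, hU, fun s h1 h2 h3 => (h s h1 h2 h3).1⟩
    · refine measure_le_of_locally (D := Metric.ball 0 C.rad) (fun y hy => ?_) hs hsD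
      obtain ⟨U, hU, h⟩ := C.exists_nhds_compare hy hL
      exact ⟨U, hU, fun s h1 h2 h3 => (h s h1 h2 h3).2⟩
  -- Both measures are carried by the parameter disc, where the comparison with L tending to 1 gives
  -- equality.
  have hnull1 : C.pushArea (Metric.ball 0 C.rad)ᶜ = 0 := by
    rw [pushArea, Measure.map_apply C.contDiff_ξ.continuous.measurable
      measurableSet_ball.compl, Measure.restrict_apply
      (C.contDiff_ξ.continuous.measurable measurableSet_ball.compl)]
    have : C.ξ ⁻¹' (Metric.ball 0 C.rad)ᶜ ∩ (O.surface ∩ C.W) = ∅ := by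
      ext x
      simp only [mem_inter_iff, mem_preimage, mem_compl_iff, mem_empty_iff_false, iff_false]
      rintro ⟨h1, h2, h3⟩
      exact h1 (C.mem_ball_ξ h3)
    rw [this, measure_empty]
  have hnull2 : C.densArea (Metric.ball 0 C.rad)ᶜ = 0 := by
    rw [densArea, withDensity_apply _ measurableSet_ball.compl,
      Measure.restrict_restrict measurableSet_ball.compl, compl_inter_self]
    simp
  ext s hs
  have h1 : C.pushArea (s \ Metric.ball 0 C.rad) = 0 := measure_mono_null (fun x hx => hx.2) hnull1
  have h2 : C.densArea (s \ Metric.ball 0 C.rad) = 0 := measure_mono_null (fun x hx => hx.2) hnull2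
  have h3 := measure_inter_add_sdiff (μ := C.pushArea) s
    (measurableSet_ball (x := (0 : E2)) (ε := C.rad))
  have h4 := measure_inter_add_sdiff (μ := C.densArea) s
    (measurableSet_ball (x := (0 : E2)) (ε := C.rad))
  rw [← h3, ← h4, h1, h2, hball (hs.inter measurableSet_ball) inter_subset_right]

end Chart

end SmoothDomain

end AreaFormula

/-! ### Measure-theoretic properties of the area -/

namespace SmoothDomain

variable {O : SmoothDomain}

namespace Chart

variable {x₀ : E3} {V : Set E3} (C : O.Chart x₀ V)

theorem pushArea_eq_map : C.pushArea = (O.area.restrict C.W).map C.ξ := by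
  rw [pushArea, area, Measure.restrict_restrict C.isOpen_W.measurableSet, inter_comm]

theorem aemeasurable_ofReal_jac : AEMeasurable (fun y => ENNReal.ofReal (C.jac y))
    (volume.restrict (Metric.ball 0 C.rad)) :=
  (C.continuousOn_jac.aemeasurable measurableSet_ball).ennreal_ofReal

/-- Surface integrals in a chart. -/
theorem setIntegral_eq {F : Type*} [NormedAddCommGroup F] [NormedSpace ℝ F] {f : E3 → F}
    (hf : ContinuousOn (fun y => f (C.Φ y)) (Metric.ball 0 C.rad)) :
    ∫ x in C.W, f x ∂O.area = ∫ y in Metric.ball 0 C.rad, C.jac y • f (C.Φ y) := by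
  have hae : AEStronglyMeasurable (fun y => f (C.Φ y)) C.densArea :=
    (hf.aestronglyMeasurable measurableSet_ball).mono_ac (withDensity_absolutelyContinuous _ _)
  rw [← C.pushArea_eq, C.pushArea_eq_map] at hae
  have h1 : ∫ x in C.W, f x ∂O.area = ∫ x in C.W, f (C.Φ (C.ξ x)) ∂O.area := by
    refine integral_congr_ae ?_
    filter_upwards [ae_restrict_mem C.isOpen_W.measurableSet,
      ae_restrict_of_ae O.ae_mem_surface] with x hxW hx
    rw [C.Φ_ξ x hx hxW]
  rw [h1, ← integral_map C.contDiff_ξ.continuous.measurable.aemeasurable hae,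
    ← C.pushArea_eq_map, C.pushArea_eq, densArea,
    integral_withDensity_eq_integral_toReal_smul₀ C.aemeasurable_ofReal_jac
      (Eventually.of_forall fun y => ENNReal.ofReal_lt_top)]
  refine integral_congr_ae (Eventually.of_forall fun y => ?_)
  have : 0 ≤ C.jac y := norm_nonneg _
  simp only [ENNReal.toReal_ofReal this]

theorem area_W_pos : 0 < O.area C.W := by
  have h0 : C.pushArea univ = O.area C.W := by
    rw [pushArea_eq_map, Measure.map_apply C.contDiff_ξ.continuous.measurable .univ]
    simp
  rw [← h0, C.pushArea_eq, densArea, withDensity_apply _ .univ, Measure.restrict_univ,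
    pos_iff_ne_zero, Ne, lintegral_eq_zero_iff' C.aemeasurable_ofReal_jac]
  intro h
  have h1 : ∀ᵐ y ∂(volume.restrict (Metric.ball (0 : E2) C.rad)), False := by
    filter_upwards [h, ae_restrict_mem measurableSet_ball] with y h1 h2
    exact absurd (ENNReal.ofReal_eq_zero.1 h1) (not_le.2 (C.jac_pos h2))
  rw [Filter.eventually_false_iff_eq_bot, ae_eq_bot, Measure.restrict_eq_zero] at h1
  exact (Metric.measure_ball_pos volume (0 : E2) C.rad_pos).ne' h1

end Chart

/-! ### Finiteness, support and rotation invariance of the area. -/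

instance isFiniteMeasure_area : IsFiniteMeasure O.area := by
  refine ⟨?_⟩
  rw [area, Measure.restrict_apply_univ]
  refine O.isCompact_surface.measure_lt_top_of_nhdsWithin fun x hx => ?_
  obtain ⟨C⟩ := O.exists_chart hx univ_mem
  have hr := C.rad_pos
  -- Half the radius: the density is continuous on the closed half disc, hence integrable there,
  -- while on the full disc no bound is known.
  refine ⟨C.ξ ⁻¹' (Metric.ball 0 (C.rad / 2)) ∩ (O.surface ∩ C.W), ?_, ?_⟩
  · refine inter_mem (mem_nhdsWithin_of_mem_nhds ?_) (inter_mem self_mem_nhdsWithin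
      (mem_nhdsWithin_of_mem_nhds (C.isOpen_W.mem_nhds C.mem_W)))
    refine C.contDiff_ξ.continuous.continuousAt.preimage_mem_nhds (Metric.isOpen_ball.mem_nhds ?_)
    rw [C.ξ_base]
    exact Metric.mem_ball_self (by linarith)
  · have hsub : Metric.ball (0 : E2) (C.rad / 2) ⊆ Metric.ball 0 C.rad :=
      Metric.ball_subset_ball (by linarith)
    rw [C.surface_inter_W_eq_image _ hsub, ← C.pushArea_apply measurableSet_ball hsub,
      C.pushArea_eq, C.densArea_apply measurableSet_ball hsub]
    have hint : IntegrableOn C.jac (Metric.ball 0 (C.rad / 2)) :=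
      ((C.continuousOn_jac.mono (Metric.closedBall_subset_ball (by linarith))).integrableOn_compact
        (isCompact_closedBall (0 : E2) (C.rad / 2))).mono_set Metric.ball_subset_closedBall
    exact hint.lintegral_lt_top

theorem area_pos_of_isOpen {U : Set E3} (hU : IsOpen U) {x : E3} (hx : x ∈ O.surface)
    (hxU : x ∈ U) : 0 < O.area U := by
  obtain ⟨C⟩ := O.exists_chart hx (hU.mem_nhds hxU)
  exact C.area_W_pos.trans_le (measure_mono C.W_subset)

/-- The set where two continuous functions differ is relatively open in M, and nonempty relatively
open sets have positive area. -/
theorem eqOn_of_ae_eq {F : Type*} [TopologicalSpace F] [T2Space F] {f g : E3 → F}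
    (hf : ContinuousOn f O.surface) (hg : ContinuousOn g O.surface) (h : f =ᵐ[O.area] g) :
    EqOn f g O.surface := by
  intro x hx
  by_contra hne
  have h1 : ∀ᶠ y in 𝓝[O.surface] x, f y ≠ g y :=
    ((hf x hx).prodMk (hg x hx)).eventually_mem
      ((isClosed_diagonal.isOpen_compl).mem_nhds (by simpa using hne))
  obtain ⟨U, hU, hxU, hsub⟩ := mem_nhdsWithin.1 h1
  refine (O.area_pos_of_isOpen hU hx hxU).ne' ?_
  refine measure_mono_null_ae ?_ h
  filter_upwards [O.ae_mem_surface] with y hy hyU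
  exact hsub ⟨hyU, hy⟩

theorem measurePreserving_rot (hrot : O.IsRotationInvariant) (s : ℝ) :
    MeasurePreserving (rot s) O.area O.area := by
  have h1 : MeasurePreserving (rot s) (μHE[2] : Measure E3) μHE[2] :=
    (rotE s).toIsometryEquiv.measurePreserving_euclideanHausdorffMeasure 2
  have h2 := h1.restrict_preimage (s := O.surface) isClosed_frontier.measurableSet
  have h3 : rot s ⁻¹' O.surface = O.surface := by
    ext x
    refine ⟨fun h => ?_, fun h => hrot s x h⟩
    rw [← rot_neg_rot s x]
    exact hrot _ _ h
  rwa [h3] at h2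

theorem integral_comp_rot (hrot : O.IsRotationInvariant) (s : ℝ) (f : E3 → ℝ) :
    ∫ x, f (rot s x) ∂O.area = ∫ x, f x ∂O.area :=
  (measurePreserving_rot hrot s).integral_comp
    (rotE s).toHomeomorph.measurableEmbedding f

theorem area_singleton (x : E3) : O.area {x} = 0 := by
  refine measure_mono_null (t := {x}) subset_rfl ?_
  refine le_antisymm ((Measure.restrict_apply_le _ _).trans ?_) bot_le
  rw [Measure.euclideanHausdorffMeasure_def, Measure.smul_apply]
  have : (μH[((2 : ℕ) : ℝ)] : Measure E3) {x} = 0 := by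
    have := Measure.nullSingletonClass_hausdorff E3 (d := ((2 : ℕ) : ℝ)) (by norm_num)
    exact measure_singleton x
  rw [this, smul_zero]

theorem IsOval.ae_rsq_pos (hO : O.IsOval) : ∀ᵐ x ∂O.area, 0 < rsq x := by
  obtain ⟨N, S, hP⟩ := hO.exists_poles
  have hN : ∀ᵐ x ∂O.area, x ≠ N := measure_eq_zero_iff_ae_notMem.1 (area_singleton N)
  have hS : ∀ᵐ x ∂O.area, x ≠ S := measure_eq_zero_iff_ae_notMem.1 (area_singleton S)
  filter_upwards [O.ae_mem_surface, hN, hS] with x hx h1 h2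
  refine (rsq_nonneg x).lt_of_ne' fun h0 => ?_
  rcases hP.eq_or_eq x hx h0 with h | h
  · exact h1 h
  · exact h2 h

end SmoothDomain

/-! ### Rotated gradients are weakly divergence free -/

theorem integrable_fderiv_of_hasCompactSupport {g : E2 → ℝ} (hg : ContDiff ℝ 1 g)
    (hc : HasCompactSupport g) (e : E2) :
    Integrable (fun y => fderiv ℝ g y e) ∧ ∫ y, fderiv ℝ g y e = 0 := by
  have h1 : Integrable fun y => fderiv ℝ g y e :=
    ((hg.continuous_fderiv one_ne_zero).clm_apply continuous_const).integrable_of_hasCompactSupport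
      (hc.fderiv_apply (𝕜 := ℝ) e)
  refine ⟨h1, ?_⟩
  -- Integration by parts against the constant 1.
  have h := integral_mul_fderiv_eq_neg_fderiv_mul_of_integrable (μ := (volume : Measure E2))
    (f := fun _ => (1 : ℝ)) (g := g) (v := e) (by simp) (by simpa using h1)
    (by simpa using hg.continuous.integrable_of_hasCompactSupport hc)
    (fun x _ => differentiableAt_const _)
    (fun x _ => hg.differentiable one_ne_zero x)
  simpa using h

/-- The integral of a derivative of a function supported inside an open set vanishes. -/
theorem setIntegral_fderiv_eq_zero {g : E2 → ℝ} {B K : Set E2} (hB : IsOpen B)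
    (hg : ContDiffOn ℝ 1 g B) (hK : IsCompact K) (hKB : K ⊆ B) (h0 : ∀ y ∈ B, y ∉ K → g y = 0)
    (e : E2) : IntegrableOn (fun y => fderiv ℝ g y e) B ∧ ∫ y in B, fderiv ℝ g y e = 0 := by
  have hz : ∀ y ∉ K, B.indicator g y = 0 := fun y hy => by
    by_cases hyB : y ∈ B
    · rw [indicator_of_mem hyB, h0 y hyB hy]
    · rw [indicator_of_notMem hyB]
  have heq : ∀ y ∈ B, B.indicator g =ᶠ[𝓝 y] g := fun y hy => by
    filter_upwards [hB.mem_nhds hy] with z hz using indicator_of_mem hz g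
  have hzero : ∀ y ∉ K, B.indicator g =ᶠ[𝓝 y] fun _ => 0 := fun y hy => by
    filter_upwards [hK.isClosed.isOpen_compl.mem_nhds hy] with z h using hz z h
  have hsm : ContDiff ℝ 1 (B.indicator g) := contDiff_iff_contDiffAt.2 fun y => by
    by_cases hy : y ∈ B
    · exact (hg.contDiffAt (hB.mem_nhds hy)).congr_of_eventuallyEq (heq y hy)
    · exact contDiffAt_const.congr_of_eventuallyEq (hzero y fun h => hy (hKB h))
  have hcs : HasCompactSupport (B.indicator g) := HasCompactSupport.intro hK hz
  obtain ⟨h1, h2⟩ := integrable_fderiv_of_hasCompactSupport hsm hcs e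
  have hind : B.indicator (fun y => fderiv ℝ g y e) = fun y => fderiv ℝ (B.indicator g) y e := by
    funext y
    by_cases hy : y ∈ B
    · rw [indicator_of_mem hy, (heq y hy).fderiv_eq]
    · rw [indicator_of_notMem hy, (hzero y fun h => hy (hKB h)).fderiv_eq]; simp
  rw [← integrable_indicator_iff hB.measurableSet, ← integral_indicator hB.measurableSet, hind]
  exact ⟨h1, h2⟩

/-- The Jacobian equals ∂_d(a ∂_e b) - ∂_e(a ∂_d b), since the second derivatives of b cancel by
symmetry; both terms have support inside the open set. -/
theorem setIntegral_jacobian_eq_zero {a b : E2 → ℝ} {B K : Set E2} (hB : IsOpen B)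
    (ha : ContDiffOn ℝ ∞ a B) (hb : ContDiffOn ℝ ∞ b B) (hK : IsCompact K) (hKB : K ⊆ B)
    (h0 : ∀ y ∈ B, y ∉ K → a y = 0) (d e : E2) :
    ∫ y in B, (fderiv ℝ a y d * fderiv ℝ b y e - fderiv ℝ a y e * fderiv ℝ b y d) = 0 := by
  have hb' : ContDiffOn ℝ ∞ (fderiv ℝ b) B := hb.fderiv_of_isOpen (m := ∞) hB (by simp)
  have hbv : ∀ v : E2, ContDiffOn ℝ ∞ (fun y => fderiv ℝ b y v) B := fun v =>
    hb'.clm_apply contDiffOn_const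
  have key : ∀ v w : E2, IntegrableOn (fun y => fderiv ℝ (fun z => a z * fderiv ℝ b z w) y v) B ∧
      ∫ y in B, fderiv ℝ (fun z => a z * fderiv ℝ b z w) y v = 0 := fun v w =>
    setIntegral_fderiv_eq_zero hB ((ha.mul (hbv w)).of_le (by simp)) hK hKB
      (fun y hy hyK => by rw [h0 y hy hyK, zero_mul]) v
  have hder : ∀ v w : E2, ∀ y ∈ B, fderiv ℝ (fun z => a z * fderiv ℝ b z w) y v =
      a y * fderiv ℝ (fderiv ℝ b) y v w + fderiv ℝ a y v * fderiv ℝ b y w := by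
    intro v w y hy
    have hya := (ha.contDiffAt (hB.mem_nhds hy)).differentiableAt (by simp)
    have hyb := (hb'.contDiffAt (hB.mem_nhds hy)).differentiableAt (by simp)
    have hyb2 : HasFDerivAt (fun z => fderiv ℝ b z w)
        ((fderiv ℝ (fderiv ℝ b) y).flip w) y := by
      simpa using hyb.hasFDerivAt.clm_apply (hasFDerivAt_const w y)
    have hprod : fderiv ℝ (fun z => a z * fderiv ℝ b z w) y = _ :=
      (hya.hasFDerivAt.mul hyb2).fderiv
    rw [hprod]
    simp [mul_comm]
  have hsub := integral_sub (key d e).1 (key e d).1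
  rw [(key d e).2, (key e d).2, sub_zero] at hsub
  rw [← hsub]
  refine setIntegral_congr_fun hB.measurableSet fun y hy => ?_
  have hsym : fderiv ℝ (fderiv ℝ b) y d e = fderiv ℝ (fderiv ℝ b) y e d :=
    ((hb.contDiffAt (hB.mem_nhds hy)).isSymmSndFDerivAt (by
      simp only [minSmoothness_of_isRCLikeNormedField]
      exact WithTop.coe_le_coe.2 (le_top : (2 : ℕ∞) ≤ ⊤))) d e
  simp only [hder _ _ y hy, hsym]
  ring

namespace SmoothDomain

variable {O : SmoothDomain}

namespace Chart

variable {x₀ : E3} {V : Set E3} (C : O.Chart x₀ V)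

/-- The cross product of the coordinate vectors is normal, so up to sign its length is its component
along ν. The sign is constant because the disc is connected and the density never vanishes. -/
theorem exists_sign : ∃ σ : ℝ, ∀ y ∈ Metric.ball 0 C.rad,
    C.jac y = σ * inner ℝ (O.normal (C.Φ y))
      (cross (fderiv ℝ C.Φ y (basisE2 0)) (fderiv ℝ C.Φ y (basisE2 1))) := by
  set g : E2 → ℝ := fun y => inner ℝ (O.normal (C.Φ y))
      (cross (fderiv ℝ C.Φ y (basisE2 0)) (fderiv ℝ C.Φ y (basisE2 1))) with hg
  have hgc : ContinuousOn g (Metric.ball 0 C.rad) :=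
    (O.continuousOn_normal.comp C.contDiffOn_Φ.continuousOn C.Φ_mem).inner
      C.continuousOn_cross_fderiv
  have hsq : EqOn (C.jac ^ 2) (g ^ 2) (Metric.ball 0 C.rad) := fun y hy => by
    have h1 := norm_normal (C.Φ_mem y hy)
    have h2 := cross_eq_smul_of_perp h1
      (mem_tangent.1 (C.fderiv_Φ_mem_tangent hy (basisE2 0)))
      (mem_tangent.1 (C.fderiv_Φ_mem_tangent hy (basisE2 1)))
    simp only [Pi.pow_apply, jac, hg]
    conv_lhs => rw [h2, norm_smul, h1, mul_one, Real.norm_eq_abs, sq_abs]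
  have hne : ∀ {y}, y ∈ Metric.ball 0 C.rad → g y ≠ 0 := fun {y} hy h => by
    have := hsq hy
    simp only [Pi.pow_apply, h] at this
    exact (C.jac_pos hy).ne' (by simpa using this)
  rcases (convex_ball (0 : E2) C.rad).isPreconnected.eq_or_eq_neg_of_sq_eq C.continuousOn_jac hgc
    hsq hne with h | h
  · exact ⟨1, fun y hy => by rw [one_mul, h hy]⟩
  · exact ⟨-1, fun y hy => by rw [neg_one_mul, h hy]; rfl⟩

/-- In a chart, `⟨J ∇η, ∇ψ⟩` is a Jacobian determinant. -/
theorem exists_jac_mul_eq : ∃ σ : ℝ, ∀ η ψ : E3 → ℝ, O.SmoothOn η → O.SmoothOn ψ →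
    ∀ y ∈ Metric.ball 0 C.rad,
      C.jac y * inner ℝ (O.J (C.Φ y) (O.grad η (C.Φ y))) (O.grad ψ (C.Φ y)) =
      σ * (fderiv ℝ (fun y => η (C.Φ y)) y (basisE2 0) * fderiv ℝ (fun y => ψ (C.Φ y)) y (basisE2 1)
        - fderiv ℝ (fun y => η (C.Φ y)) y (basisE2 1) *
          fderiv ℝ (fun y => ψ (C.Φ y)) y (basisE2 0)) := by
  obtain ⟨σ, hσ⟩ := C.exists_sign
  refine ⟨σ, fun η ψ hη hψ y hy => ?_⟩
  have t0 := C.fderiv_Φ_mem_tangent hy (basisE2 0)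
  have t1 := C.fderiv_Φ_mem_tangent hy (basisE2 1)
  rw [C.fderiv_comp_Φ hη hy, C.fderiv_comp_Φ hη hy, C.fderiv_comp_Φ hψ hy, C.fderiv_comp_Φ hψ hy,
    ← inner_grad t0, ← inner_grad t1, ← inner_grad t0, ← inner_grad t1, hσ y hy]
  have h1 := norm_normal (C.Φ_mem y hy)
  set v := O.grad η (C.Φ y) with hv
  set w := O.grad ψ (C.Φ y) with hw
  have h2 := cross_eq_smul_of_perp h1 (mem_tangent.1 t0) (mem_tangent.1 t1)
  -- Lagrange's identity: the determinant of the derivatives of η and ψ is the product of ⟨ν, ∇η ×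
  -- ∇ψ⟩ with the oriented area density.
  have h3 := inner_cross_cross v w (fderiv ℝ C.Φ y (basisE2 0)) (fderiv ℝ C.Φ y (basisE2 1))
  rw [h2, inner_smul_right, real_inner_comm (O.normal (C.Φ y)) (cross v w)] at h3
  have h4 : inner ℝ (O.J (C.Φ y) v) w = inner ℝ (O.normal (C.Φ y)) (cross v w) := by
    rw [J, E3_inner_eq, E3_inner_eq]
    simp only [cross_zero_apply, cross_one_apply, cross_two_apply]
    ring
  rw [h4]
  linear_combination σ * h3

/-- Rotated gradients of functions supported in a chart are weakly divergence free. -/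
theorem integral_inner_J_grad_eq_zero {η ψ : E3 → ℝ} (hη : ContDiff ℝ ∞ η)
    (hc : HasCompactSupport η) (hsupp : tsupport η ⊆ C.W) (hψ : O.SmoothOn ψ) :
    ∫ x, inner ℝ (O.J x (O.grad η x)) (O.grad ψ x) ∂O.area = 0 := by
  have hη' : O.SmoothOn η := hη.contDiffOn
  obtain ⟨σ, hσ⟩ := C.exists_jac_mul_eq
  have hoff : ∀ x ∈ O.surface, x ∉ C.W → O.grad η x = 0 := fun x hx hxW => by
    have h1 : η =ᶠ[𝓝 x] fun _ => 0 :=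
      notMem_tsupport_iff_eventuallyEq.1 fun h => hxW (hsupp h)
    have h2 : fderivWithin ℝ η O.surface x = 0 := by
      rw [(h1.filter_mono nhdsWithin_le_nhds).fderivWithin_eq h1.eq_of_nhds]
      simp
    rw [← inner_self_eq_zero (𝕜 := ℝ), inner_grad (grad_mem_tangent η x), h2]
    rfl
  have hcont : ContinuousOn (fun x => inner ℝ (O.J x (O.grad η x)) (O.grad ψ x)) O.surface :=
    (hη'.grad.J.inner hψ.grad).continuousOn
  have h1 : ∫ x, inner ℝ (O.J x (O.grad η x)) (O.grad ψ x) ∂O.area =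
      ∫ x in C.W, inner ℝ (O.J x (O.grad η x)) (O.grad ψ x) ∂O.area := by
    rw [← integral_indicator C.isOpen_W.measurableSet]
    refine integral_congr_ae ?_
    filter_upwards [O.ae_mem_surface] with x hx
    by_cases hxW : x ∈ C.W
    · rw [indicator_of_mem hxW]
    · rw [indicator_of_notMem hxW, hoff x hx hxW]
      have : O.J x 0 = 0 := (crossL (O.normal x)).map_zero
      rw [this, inner_zero_left]
  rw [h1, C.setIntegral_eq (hcont.comp C.contDiffOn_Φ.continuousOn C.Φ_mem)]
  have hK : IsCompact (C.ξ '' (tsupport η ∩ O.surface)) :=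
    ((HasCompactSupport.isCompact hc).inter_right isClosed_frontier).image C.contDiff_ξ.continuous
  have hKB : C.ξ '' (tsupport η ∩ O.surface) ⊆ Metric.ball 0 C.rad := by
    rintro _ ⟨x, hx, rfl⟩
    exact C.mem_ball_ξ (hsupp hx.1)
  have h0 : ∀ y ∈ Metric.ball 0 C.rad, y ∉ C.ξ '' (tsupport η ∩ O.surface) → η (C.Φ y) = 0 :=
    fun y hy hyK => by
      by_contra hne
      exact hyK ⟨C.Φ y, ⟨subset_tsupport _ hne, C.Φ_mem y hy⟩, C.ξ_Φ y hy⟩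
  have := setIntegral_jacobian_eq_zero Metric.isOpen_ball (C.smoothOn_comp hη') (C.smoothOn_comp hψ)
    hK hKB h0 (basisE2 0) (basisE2 1)
  rw [setIntegral_congr_fun measurableSet_ball fun y hy => by
    simpa only [smul_eq_mul] using hσ η ψ hη' hψ y hy, integral_const_mul, this, mul_zero]

end Chart

/-! ### Continuous fields as square integrable fields, and membership in V. -/

theorem _root_.ContinuousOn.memLp_area {f : E3 → E3} (hf : ContinuousOn f O.surface) :
    MemLp f 2 O.area := by
  obtain ⟨K, hK⟩ := O.isCompact_surface.exists_bound_of_continuousOn hf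
  refine MemLp.of_bound (C := K) ?_ ?_
  · exact hf.aestronglyMeasurable isClosed_frontier.measurableSet
  · filter_upwards [O.ae_mem_surface] with x hx using hK x hx

/-- A continuous tangent field as a square integrable tangent field. -/
noncomputable def toTangentL2 {w : E3 → E3} (hw : ContinuousOn w O.surface)
    (ht : ∀ x ∈ O.surface, w x ∈ O.tangent x) : O.tangentL2 :=
  ⟨hw.memLp_area.toLp w, by
    change ∀ᵐ x ∂O.area, _
    filter_upwards [hw.memLp_area.coeFn_toLp, O.ae_mem_surface] with x h1 h2
    rw [h1]; exact ht x h2⟩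

theorem coeFn_toTangentL2 {w : E3 → E3} (hw : ContinuousOn w O.surface)
    (ht : ∀ x ∈ O.surface, w x ∈ O.tangent x) :
    ((toTangentL2 hw ht : Lp E3 2 O.area) : E3 → E3) =ᵐ[O.area] w := hw.memLp_area.coeFn_toLp

theorem inner_tangentL2 (u w : O.tangentL2) : inner ℝ u w =
    ∫ x, inner ℝ ((u : Lp E3 2 O.area) x) ((w : Lp E3 2 O.area) x) ∂O.area := by
  rw [Submodule.coe_inner, L2.inner_def]

theorem mem_V_iff {u : O.tangentL2} : u ∈ O.V ↔ ∀ ψ : E3 → ℝ, O.SmoothOn ψ →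
    ∫ x, inner ℝ (O.grad ψ x) ((u : Lp E3 2 O.area) x) ∂O.area = 0 := by
  have hint : ∀ (w : O.tangentL2) (ψ : E3 → ℝ), ((w : Lp E3 2 O.area) : E3 → E3) =ᵐ[O.area] O.grad ψ →
      inner ℝ w u = ∫ x, inner ℝ (O.grad ψ x) ((u : Lp E3 2 O.area) x) ∂O.area := by
    intro w ψ h
    rw [inner_tangentL2]
    refine integral_congr_ae ?_
    filter_upwards [h] with x hx
    rw [hx]
  constructor
  · intro hu ψ hψ
    have hcoe := coeFn_toTangentL2 hψ.grad.continuousOn fun x _ => grad_mem_tangent ψ x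
    rw [← hint _ ψ hcoe]
    exact (Submodule.mem_orthogonal _ _).1 hu _ (Submodule.subset_span ⟨ψ, hψ, hcoe⟩)
  · intro h
    rw [V, Submodule.mem_orthogonal]
    intro w hw
    induction hw using Submodule.span_induction with
    | mem w hw =>
      obtain ⟨ψ, hψ, hcoe⟩ := hw
      rw [hint w ψ hcoe, h ψ hψ]
    | zero => exact inner_zero_left _
    | add a b _ _ ha hb => rw [inner_add_left, ha, hb, add_zero]
    | smul c a _ ha => rw [inner_smul_left, ha, mul_zero]

/-- On `V ∩ Ker B`, the field `χ J u` is orthogonal to `V`. -/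
theorem inner_chiJ_eq_zero {u w : O.tangentL2} (hu : u ∈ O.V) (hB : O.B u = 0) (hw : w ∈ O.V) :
    inner ℝ (O.chiJ u) w = 0 := by
  have h1 : O.leray u = u := Submodule.starProjection_eq_self_iff.2 hu
  rw [B, h1] at hB
  have h2 : O.chiJ u ∈ O.Vᗮ := (Submodule.starProjection_apply_eq_zero_iff _).1 hB
  rw [real_inner_comm]
  exact (Submodule.mem_orthogonal _ _).1 h2 w hw

end SmoothDomain

/-! ### The kernel of `B` consists of zonal flows -/

namespace SmoothDomain

variable {O : SmoothDomain}

theorem ae_mem_tangent (u : O.tangentL2) :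
    ∀ᵐ x ∂O.area, (u : Lp E3 2 O.area) x ∈ O.tangent x := u.2

theorem integrable_inner_of_continuousOn {w : E3 → E3} (hw : ContinuousOn w O.surface)
    (u : O.tangentL2) : Integrable (fun x => inner ℝ (w x) ((u : Lp E3 2 O.area) x)) O.area := by
  refine (L2.integrable_inner (𝕜 := ℝ) (hw.memLp_area.toLp w) (u : Lp E3 2 O.area)).congr ?_
  filter_upwards [hw.memLp_area.coeFn_toLp] with x hx
  rw [hx]

theorem fderivWithin_mul {a b : E3 → ℝ} (ha : O.SmoothOn a) (hb : O.SmoothOn b) {x τ : E3}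
    (hx : x ∈ O.surface) (hτ : τ ∈ O.tangent x) :
    fderivWithin ℝ (fun y => a y * b y) O.surface x τ =
      fderivWithin ℝ a O.surface x τ * b x + a x * fderivWithin ℝ b O.surface x τ := by
  obtain ⟨c, rfl, hc, hM⟩ := exists_curve hx hτ
  have hab : O.SmoothOn fun y => a y * b y := ContDiffOn.mul ha hb
  exact (hab.comp_hasDerivAt hc hM).unique
    ((ha.comp_hasDerivAt hc hM).mul (hb.comp_hasDerivAt hc hM))

theorem inner_grad_mul {a b : E3 → ℝ} (ha : O.SmoothOn a) (hb : O.SmoothOn b) {x τ : E3}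
    (hx : x ∈ O.surface) (hτ : τ ∈ O.tangent x) :
    inner ℝ (O.grad (fun y => a y * b y) x) τ =
      b x * inner ℝ (O.grad a x) τ + a x * inner ℝ (O.grad b x) τ := by
  rw [inner_grad hτ, inner_grad hτ, inner_grad hτ, fderivWithin_mul ha hb hx hτ, mul_comm (b x)]

/-- Since J∇η ∈ V and J is isometric on tangent planes, orthogonality of χJu to V gives ∫ χ⟨∇η, u⟩ =
0. The weak divergence of u tested with χη gives the sum of this integral and the wanted one. -/
theorem Chart.integral_mul_inner_grad_chi {x₀ : E3} {V : Set E3} (C : O.Chart x₀ V)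
    {u : O.tangentL2} (hu : u ∈ O.V) (hB : O.B u = 0) {η : E3 → ℝ} (hη : ContDiff ℝ ∞ η)
    (hc : HasCompactSupport η) (hsupp : tsupport η ⊆ C.W) :
    ∫ x, η x • inner ℝ (O.grad O.chi x) ((u : Lp E3 2 O.area) x) ∂O.area = 0 := by
  have hη' : O.SmoothOn η := hη.contDiffOn
  have hJT : ∀ x ∈ O.surface, O.J x (O.grad η x) ∈ O.tangent x := fun x _ => O.J_mem_tangent _ _
  set w := toTangentL2 hη'.grad.J.continuousOn hJT with hw
  have hcoe := coeFn_toTangentL2 hη'.grad.J.continuousOn hJT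
  have hwV : w ∈ O.V := mem_V_iff.2 fun ψ hψ => by
    rw [← C.integral_inner_J_grad_eq_zero hη hc hsupp hψ]
    refine integral_congr_ae ?_
    filter_upwards [hcoe] with x hx
    rw [hx, real_inner_comm]
  have h1 : ∫ x, inner ℝ (O.chi x • O.grad η x) ((u : Lp E3 2 O.area) x) ∂O.area = 0 := by
    rw [← inner_chiJ_eq_zero hu hB hwV, inner_tangentL2]
    refine integral_congr_ae ?_
    have h2 : ((O.chiJ u : Lp E3 2 O.area) : E3 → E3) =ᵐ[O.area] _ :=
      (O.memLp_chi_smul_J (Lp.memLp (u : Lp E3 2 O.area))).coeFn_toLp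
    filter_upwards [hcoe, h2, ae_mem_tangent u, O.ae_mem_surface] with x h3 h4 h5 h6
    rw [h3, h4, real_inner_smul_left, real_inner_smul_left, J, J,
      inner_cross_cross_self (norm_normal h6) (mem_tangent.1 h5), real_inner_comm]
  have h2 := mem_V_iff.1 hu (fun y => O.chi y * η y) (ContDiffOn.mul smoothOn_chi hη')
  have hi1 := integrable_inner_of_continuousOn
    (smoothOn_chi.continuousOn.smul hη'.grad.continuousOn) u
  have hi2 := integrable_inner_of_continuousOn
    (hη'.continuousOn.smul (smoothOn_chi (O := O)).grad.continuousOn) u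
  have h3 := integral_add hi2 hi1
  simp only [Pi.smul_apply'] at h3
  rw [h1, add_zero] at h3
  calc _ = ∫ x, inner ℝ (η x • O.grad O.chi x) ((u : Lp E3 2 O.area) x) ∂O.area := by
        simp only [real_inner_smul_left, smul_eq_mul]
    _ = _ := h3.symm
    _ = ∫ x, inner ℝ (O.grad (fun y => O.chi y * η y) x) ((u : Lp E3 2 O.area) x) ∂O.area := by
        refine integral_congr_ae ?_
        filter_upwards [ae_mem_tangent u, O.ae_mem_surface] with x h5 h6
        rw [inner_grad_mul smoothOn_chi hη' h6 h5, real_inner_smul_left, real_inner_smul_left]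
    _ = 0 := h2

/-- Fundamental lemma of the calculus of variations in each chart domain; null sets are a local
matter. -/
theorem ae_inner_grad_chi {u : O.tangentL2} (hu : u ∈ O.V) (hB : O.B u = 0) :
    ∀ᵐ x ∂O.area, inner ℝ (O.grad O.chi x) ((u : Lp E3 2 O.area) x) = 0 := by
  have hint := integrable_inner_of_continuousOn (smoothOn_chi (O := O)).grad.continuousOn u
  have h1 : O.area (O.surface ∩
      {x | ¬ inner ℝ (O.grad O.chi x) ((u : Lp E3 2 O.area) x) = 0}) = 0 := by
    refine measure_null_of_locally_null _ fun x hx => ?_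
    obtain ⟨C⟩ := O.exists_chart hx.1 univ_mem
    have h2 := C.isOpen_W.ae_eq_zero_of_integral_contDiff_smul_eq_zero
      (hint.locallyIntegrable.locallyIntegrableOn C.W)
      fun η h1 h2 h3 => C.integral_mul_inner_grad_chi hu hB h1 h2 h3
    refine ⟨C.W ∩ (O.surface ∩
      {x | ¬ inner ℝ (O.grad O.chi x) ((u : Lp E3 2 O.area) x) = 0}),
      inter_mem (mem_nhdsWithin_of_mem_nhds (C.isOpen_W.mem_nhds C.mem_W)) self_mem_nhdsWithin, ?_⟩
    refine measure_mono_null ?_ h2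
    rintro y ⟨h3, -, h4⟩ h5
    exact h4 (h5 h3)
  filter_upwards [O.ae_mem_surface, measure_eq_zero_iff_ae_notMem.1 h1] with x h2 h3
  by_contra h
  exact h3 ⟨h2, h⟩

/-- dχ is the vertical component of dν. It vanishes on X, since dν(X) = X(ν) is horizontal, and on Y
it is computed by `rsq_mul_height`. Hence ∇χ is along Y and nonzero off the poles by positive
definiteness. -/
theorem IsOval.rsq_mul_inner_grad_chi (hO : O.IsOval) {x v : E3} (hx : x ∈ O.surface)
    (hv : v ∈ O.tangent x) : rsq x ^ 2 * inner ℝ (O.grad O.chi x) v =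
      inner ℝ (fderivWithin ℝ O.normal O.surface x (O.Y x)) (O.Y x) * O.kap x *
        inner ℝ v (O.Y x) := by
  have hX := X₃_mem_tangent hO.rot hx
  have hY := Y_mem_tangent (O := O) x
  have hD : ∀ τ ∈ O.tangent x, inner ℝ (O.grad O.chi x) τ =
      fderivWithin ℝ O.normal O.surface x τ 2 := by
    intro τ hτ
    rw [inner_grad hτ]
    obtain ⟨c, rfl, hc, hM⟩ := exists_curve hx hτ
    have h1 := smoothOn_chi.comp_hasDerivAt hc hM
    have h2 : HasDerivAt (fun t => O.normal (c t) 2) _ 0 :=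
      (EuclideanSpace.proj 2 : E3 →L[ℝ] ℝ).hasFDerivAt.comp_hasDerivAt 0
        (smoothOn_normal.comp_hasDerivAt hc hM)
    simp only [chi_eq] at h1
    have h3 : O.chi = fun x => O.normal x 2 := funext chi_eq
    rw [h3]
    rw [h3] at h1
    exact h1.unique h2
  have h1 := congrArg (fun w => inner ℝ (O.grad O.chi x) w) (norm_sq_smul_eq hO.rot hx hv)
  simp only [inner_smul_right, inner_add_right] at h1
  rw [hD _ hX, hD _ hY, fderivWithin_normal_X₃ hO.rot hx] at h1
  have h2 := rsq_mul_height hO.rot hx (fderivWithin_normal_mem_tangent hx hY)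
  simp only [X₃_two_apply] at h1
  linear_combination rsq x * h1 + inner ℝ v (O.Y x) * h2

/-- Fields in `V ∩ Ker B` are tangent to the parallels. -/
theorem IsOval.ae_inner_Y (hO : O.IsOval) {u : O.tangentL2} (hu : u ∈ O.V) (hB : O.B u = 0) :
    ∀ᵐ x ∂O.area, inner ℝ ((u : Lp E3 2 O.area) x) (O.Y x) = 0 := by
  filter_upwards [ae_inner_grad_chi hu hB, hO.ae_rsq_pos, O.ae_mem_surface, ae_mem_tangent u]
    with x h1 h2 h3 h4
  have h5 := hO.rsq_mul_inner_grad_chi h3 h4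
  rw [h1, mul_zero] at h5
  have hY0 : O.Y x ≠ 0 := by
    intro h
    have h6 := hO.kap_pos h3 h2
    rw [← J_X₃_two, ← Y, h] at h6
    simp at h6
  have h6 := shape_pos hO.connected hO.rot hO.curvature_pos h3 (Y_mem_tangent x) hY0
  exact (mul_eq_zero.1 h5.symm).resolve_left (mul_pos h6 (hO.kap_pos h3 h2)).ne'

theorem fderivWithin_rsq_X₃ (hrot : O.IsRotationInvariant) {x : E3} (hx : x ∈ O.surface) :
    fderivWithin ℝ rsq O.surface x (X₃ x) = 0 := by
  have h1 := SmoothOn.hasDerivAt_rot hrot (O := O) contDiff_rsq.contDiffOn hx 0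
  simp only [rsq_rot, rot_zero] at h1
  exact h1.unique (hasDerivAt_const _ _)

/-- As r²u = ⟨u, X⟩X and r² is invariant, ⟨∇(r²ψ), u⟩ = ⟨X, u⟩ Xψ. The factor r² in the test
function cancels the singular denominator of the frame expansion. -/
theorem IsOval.integral_inner_X₃_mul (hO : O.IsOval) {u : O.tangentL2} (hu : u ∈ O.V)
    (hB : O.B u = 0) {ψ : E3 → ℝ} (hψ : O.SmoothOn ψ) :
    ∫ x, inner ℝ (X₃ x) ((u : Lp E3 2 O.area) x) *
      fderivWithin ℝ ψ O.surface x (X₃ x) ∂O.area = 0 := by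
  have hr : O.SmoothOn rsq := contDiff_rsq.contDiffOn
  rw [← mem_V_iff.1 hu (fun y => rsq y * ψ y) (ContDiffOn.mul hr hψ)]
  refine integral_congr_ae ?_
  filter_upwards [hO.ae_inner_Y hu hB, hO.ae_rsq_pos, O.ae_mem_surface, ae_mem_tangent u]
    with x h1 h2 h3 h4
  have hX := X₃_mem_tangent hO.rot h3
  have h5 := norm_sq_smul_eq hO.rot h3 h4
  rw [h1, zero_smul, add_zero] at h5
  have h6 := congrArg (fun w => inner ℝ (O.grad (fun y => rsq y * ψ y) x) w) h5
  simp only [inner_smul_right] at h6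
  rw [inner_grad hX, fderivWithin_mul hr hψ h3 hX, fderivWithin_rsq_X₃ hO.rot h3] at h6
  rw [real_inner_comm]
  apply mul_left_cancel₀ h2.ne'
  linear_combination -h6

theorem SmoothOn.comp_rot (hrot : O.IsRotationInvariant) {ψ : E3 → ℝ} (hψ : O.SmoothOn ψ) (s : ℝ) :
    O.SmoothOn fun x => ψ (rot s x) :=
  ContDiffOn.comp hψ (contDiff_rot.comp (contDiff_const.prodMk contDiff_id)).contDiffOn
    fun x hx => hrot s x hx

theorem fderivWithin_comp_rot_X₃ (hrot : O.IsRotationInvariant) {ψ : E3 → ℝ} (hψ : O.SmoothOn ψ)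
    (s : ℝ) {x : E3} (hx : x ∈ O.surface) :
    fderivWithin ℝ (fun x => ψ (rot s x)) O.surface x (X₃ x) =
      fderivWithin ℝ ψ O.surface (rot s x) (X₃ (rot s x)) := by
  have h1 := (hψ.comp_rot hrot s).hasDerivAt_rot hrot hx 0
  simp only [rot_zero, rot_rot] at h1
  have h2 := (hψ.hasDerivAt_rot hrot hx (s + 0)).comp_const_add s 0
  rw [add_zero] at h2
  exact h1.unique h2

theorem exists_fderivWithin_X₃_bound (hrot : O.IsRotationInvariant) {ψ : E3 → ℝ}
    (hψ : O.SmoothOn ψ) :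
    ∃ K, ∀ x ∈ O.surface, ‖fderivWithin ℝ ψ O.surface x (X₃ x)‖ ≤ K := by
  have h1 : ContinuousOn (fun x => O.tderiv ψ x (X₃ x)) O.surface :=
    hψ.tderiv.continuousOn.clm_apply contDiff_X₃.continuous.continuousOn
  obtain ⟨K, hK⟩ := isCompact_surface.exists_bound_of_continuousOn h1
  refine ⟨K, fun x hx => ?_⟩
  rw [← tderiv_apply_of_mem (X₃_mem_tangent hrot hx)]
  exact hK x hx

/-- Differentiating in the angle under the integral gives the preceding identity for the rotated
test function, so the integral is constant in the angle. -/
theorem IsOval.integral_inner_X₃_mul_comp_rot (hO : O.IsOval) {u : O.tangentL2} (hu : u ∈ O.V)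
    (hB : O.B u = 0) {ψ : E3 → ℝ} (hψ : O.SmoothOn ψ) (s : ℝ) :
    ∫ x, inner ℝ (X₃ x) ((u : Lp E3 2 O.area) x) * ψ (_root_.rot s x) ∂O.area =
      ∫ x, inner ℝ (X₃ x) ((u : Lp E3 2 O.area) x) * ψ x ∂O.area := by
  have hrot := hO.rot
  set g : E3 → ℝ := fun x => inner ℝ (X₃ x) ((u : Lp E3 2 O.area) x) with hg
  have hgi : Integrable g O.area :=
    integrable_inner_of_continuousOn contDiff_X₃.continuous.continuousOn u
  obtain ⟨K, hK⟩ := exists_fderivWithin_X₃_bound hrot hψ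
  have hmeas : ∀ f : E3 → ℝ, O.SmoothOn f → AEStronglyMeasurable f O.area := fun f hf =>
    hf.continuousOn.aestronglyMeasurable isClosed_frontier.measurableSet
  have hmeas' : ∀ f : E3 → ℝ, O.SmoothOn f →
      AEStronglyMeasurable (fun x => fderivWithin ℝ f O.surface x (X₃ x)) O.area := by
    intro f hf
    have h1 : ContinuousOn (fun x => O.tderiv f x (X₃ x)) O.surface :=
      hf.tderiv.continuousOn.clm_apply contDiff_X₃.continuous.continuousOn
    refine (h1.aestronglyMeasurable isClosed_frontier.measurableSet).congr ?_
    filter_upwards [O.ae_mem_surface] with x hx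
    rw [tderiv_apply_of_mem (X₃_mem_tangent hrot hx)]
  have hint : ∀ s, Integrable (fun x => g x * ψ (_root_.rot s x)) O.area := by
    intro s
    obtain ⟨K', hK'⟩ := isCompact_surface.exists_bound_of_continuousOn hψ.continuousOn
    refine hgi.mul_bdd (c := K') (hmeas _ (hψ.comp_rot hrot s)) ?_
    filter_upwards [O.ae_mem_surface] with x hx using hK' _ (hrot s x hx)
  have hder : ∀ s, HasDerivAt (fun s => ∫ x, g x * ψ (_root_.rot s x) ∂O.area) 0 s := by
    intro s
    have h := hasDerivAt_integral_of_dominated_loc_of_deriv_le (μ := O.area) (x₀ := s) (s := univ)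
      (F := fun s x => g x * ψ (_root_.rot s x))
      (F' := fun s x => g x * fderivWithin ℝ ψ O.surface (_root_.rot s x) (X₃ (_root_.rot s x)))
      (bound := fun x => ‖g x‖ * K) univ_mem
      (Eventually.of_forall fun s => (hint s).aestronglyMeasurable) (hint s) ?_ ?_
      (hgi.norm.mul_const K) ?_
    · have h2 : ∫ x, g x * fderivWithin ℝ ψ O.surface (_root_.rot s x) (X₃ (_root_.rot s x))
          ∂O.area = 0 := by
        rw [← hO.integral_inner_X₃_mul hu hB (hψ.comp_rot hrot s)]
        refine integral_congr_ae ?_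
        filter_upwards [O.ae_mem_surface] with x hx
        rw [fderivWithin_comp_rot_X₃ hrot hψ s hx]
      rw [← h2]
      exact h.2
    · refine hgi.aestronglyMeasurable.mul ((hmeas' _ (hψ.comp_rot hrot s)).congr ?_)
      filter_upwards [O.ae_mem_surface] with x hx
      rw [fderivWithin_comp_rot_X₃ hrot hψ s hx]
    · filter_upwards [O.ae_mem_surface] with x hx t _
      rw [norm_mul]
      exact mul_le_mul_of_nonneg_left (hK _ (hrot t x hx)) (norm_nonneg _)
    · filter_upwards [O.ae_mem_surface] with x hx t _
      exact (hψ.hasDerivAt_rot hrot hx t).const_mul (g x)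
  have := is_const_of_deriv_eq_zero (fun s => (hder s).differentiableAt)
    (fun s => (hder s).deriv) s 0
  simpa only [rot_zero] using this

/-- Fields in `V ∩ Ker B` are invariant under rotation. -/
theorem IsOval.ae_inner_X₃_rot (hO : O.IsOval) {u : O.tangentL2} (hu : u ∈ O.V)
    (hB : O.B u = 0) (s : ℝ) :
    ∀ᵐ x ∂O.area, inner ℝ (X₃ (_root_.rot s x)) ((u : Lp E3 2 O.area) (_root_.rot s x)) =
      inner ℝ (X₃ x) ((u : Lp E3 2 O.area) x) := by
  have hgi : Integrable (fun x => inner ℝ (X₃ x) ((u : Lp E3 2 O.area) x)) O.area :=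
    integrable_inner_of_continuousOn contDiff_X₃.continuous.continuousOn u
  have hgs := (measurePreserving_rot hO.rot s).integrable_comp_of_integrable hgi
  refine ae_eq_of_integral_contDiff_smul_eq hgs.locallyIntegrable hgi.locallyIntegrable
    fun ψ hψ _ => ?_
  -- Invariance of the area moves the rotation from the field to the test function, with the
  -- opposite angle.
  have h1 := hO.integral_inner_X₃_mul_comp_rot hu hB (hψ.contDiffOn : O.SmoothOn ψ) (-s)
  have h2 := integral_comp_rot hO.rot s
    (fun x => inner ℝ (X₃ x) ((u : Lp E3 2 O.area) x) * ψ (_root_.rot (-s) x))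
  simp only [rot_neg_rot] at h2
  simp only [smul_eq_mul, mul_comm (ψ _)]
  rw [h2, h1]

end SmoothDomain

/-! ### Averaging over rotations -/

namespace SmoothDomain

variable {O : SmoothDomain}

theorem continuous_rot_left (x : E3) : Continuous fun s => rot s x :=
  continuous_iff_continuousAt.2 fun s => (_root_.hasDerivAt_rot s x).continuousAt

theorem continuous_comp_rot (hrot : O.IsRotationInvariant) {f : E3 → ℝ}
    (hf : ContinuousOn f O.surface) {x : E3} (hx : x ∈ O.surface) :
    Continuous fun s => f (rot s x) :=
  hf.comp_continuous (continuous_rot_left x) fun s => hrot s x hx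

/-- The integrand is the derivative of s ↦ f(R_s x), which has period 2π. -/
theorem integral_fderivWithin_X₃_rot (hrot : O.IsRotationInvariant) {f : E3 → ℝ}
    (hf : O.SmoothOn f) {x : E3} (hx : x ∈ O.surface) :
    ∫ s in (0 : ℝ)..(2 * Real.pi), fderivWithin ℝ f O.surface (rot s x) (X₃ (rot s x)) = 0 := by
  have hc : Continuous fun s => fderivWithin ℝ f O.surface (rot s x) (X₃ (rot s x)) := by
    have h1 : ContinuousOn (fun x => O.tderiv f x (X₃ x)) O.surface :=
      hf.tderiv.continuousOn.clm_apply contDiff_X₃.continuous.continuousOn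
    refine (continuous_comp_rot hrot h1 hx).congr fun s => ?_
    rw [tderiv_apply_of_mem (X₃_mem_tangent hrot (hrot s x hx))]
  rw [intervalIntegral.integral_eq_sub_of_hasDerivAt
    (fun s _ => hf.hasDerivAt_rot hrot hx s) (hc.intervalIntegrable _ _), rot_two_pi, rot_zero,
    sub_self]

/-- `X⟨X, φ⟩ = ⟨X, ∇_X φ⟩ + χ ⟨Y, φ⟩`. -/
theorem fderivWithin_inner_X₃ (hrot : O.IsRotationInvariant) {φ : E3 → E3}
    (hφ : O.IsSmoothTangentField φ) {x : E3} (hx : x ∈ O.surface) :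
    fderivWithin ℝ (fun y => inner ℝ (φ y) (X₃ y)) O.surface x (X₃ x) =
      inner ℝ (fderivWithin ℝ φ O.surface x (X₃ x)) (X₃ x) +
        O.chi x * inner ℝ (O.Y x) (φ x) := by
  have hX := X₃_mem_tangent hrot hx
  rw [fderivWithin_inner hφ.1 smoothOn_X₃ hx hX, fderivWithin_X₃ hx hX, real_inner_comm,
    inner_X₃_X₃ hrot hx (hφ.2 x hx), add_comm]

/-- In the frame `X`, `Y` the divergence of a field is `r⁻² (X⟨φ, X⟩ + Y⟨φ, Y⟩)`. -/
theorem fderivWithin_inner_Y (hrot : O.IsRotationInvariant) {φ : E3 → E3}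
    (hφ : O.IsSmoothTangentField φ) {x : E3} (hx : x ∈ O.surface) (hdiv : O.div φ x = 0) :
    fderivWithin ℝ (fun y => inner ℝ (φ y) (O.Y y)) O.surface x (O.Y x) =
      - fderivWithin ℝ (fun y => inner ℝ (φ y) (X₃ y)) O.surface x (X₃ x) := by
  have hX := X₃_mem_tangent hrot hx
  have h1 := norm_sq_mul_div φ hx hX
  rw [hdiv, mul_zero] at h1
  rw [fderivWithin_inner_X₃ hrot hφ hx, fderivWithin_inner hφ.1 smoothOn_Y hx (Y_mem_tangent x),
    real_inner_comm, inner_fderivWithin_Y hrot hx (hφ.2 x hx)]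
  have h2 : O.J x (X₃ x) = O.Y x := rfl
  rw [h2] at h1
  linarith

/-- The average of a function over the parallels. -/
noncomputable def orbitIntegral (f : E3 → ℝ) (x : E3) : ℝ :=
  ∫ s in (0 : ℝ)..(2 * Real.pi), f (rot s x)

theorem orbitIntegral_rot (f : E3 → ℝ) (t : ℝ) (x : E3) :
    orbitIntegral f (rot t x) = orbitIntegral f x := by
  have hper : Function.Periodic (fun s => f (rot s x)) (2 * Real.pi) := fun s => by
    simp only
    rw [← rot_rot, rot_two_pi]
  simp only [orbitIntegral, rot_rot]
  rw [intervalIntegral.integral_comp_add_right (fun s => f (rot s x)), zero_add, add_comm,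
    hper.intervalIntegral_add_eq t 0, zero_add]

theorem continuousOn_orbitIntegral (hrot : O.IsRotationInvariant) {f : E3 → ℝ}
    (hf : ContinuousOn f O.surface) : ContinuousOn (orbitIntegral f) O.surface := by
  obtain ⟨K, hK⟩ := isCompact_surface.exists_bound_of_continuousOn hf
  intro x hx
  refine intervalIntegral.continuousWithinAt_of_dominated_interval (bound := fun _ => K) ?_ ?_
    intervalIntegrable_const ?_
  · filter_upwards [self_mem_nhdsWithin] with y hy
    exact (continuous_comp_rot hrot hf hy).aestronglyMeasurable
  · filter_upwards [self_mem_nhdsWithin] with y hy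
    exact Eventually.of_forall fun s _ => hK _ (hrot s y hy)
  · refine Eventually.of_forall fun s _ => ?_
    exact (hf _ (hrot s x hx)).comp (rotE s).continuous.continuousWithinAt
      fun y hy => hrot s y hy

theorem deriv_mem_tangent {m : ℝ → E3} {c : ℝ} {v : E3} (hm : HasDerivAt m v c)
    (hM : ∀ᶠ c' in 𝓝 c, m c' ∈ O.surface) : v ∈ O.tangent (m c) := by
  have h1 : HasDerivAt (fun t => m (c + t)) v 0 := by
    have h2 : HasDerivAt m v (c + 0) := by rwa [add_zero]
    exact h2.comp_const_add c 0
  have h2 : Tendsto (fun t => c + t) (𝓝 (0 : ℝ)) (𝓝 c) :=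
    (continuous_const.add continuous_id).tendsto' _ _ (by simp)
  simpa using mem_tangent_of_hasDerivAt h1 (h2.eventually hM)

/-- The derivative of the average along a curve on the surface. -/
theorem hasDerivAt_orbitIntegral (hrot : O.IsRotationInvariant) {f : E3 → ℝ} (hf : O.SmoothOn f)
    {m : ℝ → E3} {c₀ : ℝ} (hm : ContDiffAt ℝ ∞ m c₀) (hM : ∀ᶠ c in 𝓝 c₀, m c ∈ O.surface) :
    HasDerivAt (fun c => orbitIntegral f (m c))
      (∫ s in (0 : ℝ)..(2 * Real.pi),
        fderivWithin ℝ f O.surface (rot s (m c₀)) (rot s (deriv m c₀))) c₀ := by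
  obtain ⟨K, hK⟩ := exists_tderiv_bound hf
  have hm1 : ∀ᶠ c in 𝓝 c₀, ContDiffAt ℝ 1 m c :=
    (hm.of_le (by simp : (1 : WithTop ℕ∞) ≤ ∞)).eventually (by simp)
  have hdc : ContinuousAt (deriv m) c₀ :=
    (hm.continuousAt_fderiv (by simp)).clm_apply continuousAt_const
  have hbd : ∀ᶠ c in 𝓝 c₀, ‖deriv m c‖ < ‖deriv m c₀‖ + 1 :=
    hdc.norm.eventually_lt_const (lt_add_one _)
  have hd : ∀ c, ContDiffAt ℝ 1 m c → HasDerivAt m (deriv m c) c := fun c hc =>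
    (hc.differentiableAt one_ne_zero).hasDerivAt
  have hT : ∀ c, ContDiffAt ℝ 1 m c → (∀ᶠ c' in 𝓝 c, m c' ∈ O.surface) →
      deriv m c ∈ O.tangent (m c) := fun c hc hMc => deriv_mem_tangent (hd c hc) hMc
  have hrotd : ∀ (s : ℝ) (c : ℝ), ContDiffAt ℝ 1 m c →
      HasDerivAt (fun c => rot s (m c)) (rot s (deriv m c)) c := fun s c hc =>
    (rotE s).toContinuousLinearEquiv.hasFDerivAt.comp_hasDerivAt c (hd c hc)
  have hrotM : ∀ (s : ℝ) (c : ℝ), (∀ᶠ c' in 𝓝 c, m c' ∈ O.surface) →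
      ∀ᶠ c' in 𝓝 c, rot s (m c') ∈ O.surface := fun s c hc => by
    filter_upwards [hc] with c' h using hrot s _ h
  have hx := hM.self_of_nhds
  have hcont : Continuous fun s => fderivWithin ℝ f O.surface (rot s (m c₀))
      (rot s (deriv m c₀)) := by
    have h1 : Continuous fun s => O.tderiv f (rot s (m c₀)) (rot s (deriv m c₀)) :=
      (hf.tderiv.continuousOn.comp_continuous (continuous_rot_left _)
        fun s => hrot s _ hx).clm_apply (continuous_rot_left _)
    refine h1.congr fun s => ?_
    rw [tderiv_apply_of_mem (rot_mem_tangent hrot hx (hT c₀ hm1.self_of_nhds hM) s)]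
  -- The neighbourhood is where m is C¹, stays in the surface and has speed below that at c₀ plus
  -- one; rotations are isometric, so this bounds the integrand uniformly in s.
  refine (intervalIntegral.hasDerivAt_integral_of_dominated_loc_of_deriv_le
    (F := fun c s => f (rot s (m c)))
    (F' := fun c s => fderivWithin ℝ f O.surface (rot s (m c)) (rot s (deriv m c)))
    (bound := fun _ => K * (‖deriv m c₀‖ + 1))
    (s := {c | ContDiffAt ℝ 1 m c ∧ (∀ᶠ c' in 𝓝 c, m c' ∈ O.surface) ∧
      ‖deriv m c‖ < ‖deriv m c₀‖ + 1}) (hm1.and (hM.eventually_nhds.and hbd))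
    ?_ ?_ hcont.aestronglyMeasurable ?_ intervalIntegrable_const ?_).2
  · filter_upwards [hM] with c hc
    exact (continuous_comp_rot hrot hf.continuousOn hc).aestronglyMeasurable
  · exact (continuous_comp_rot hrot hf.continuousOn hx).intervalIntegrable _ _
  · refine Eventually.of_forall fun s _ c ⟨h1, h2, h3⟩ => ?_
    have h4 := h2.self_of_nhds
    rw [← tderiv_apply_of_mem (rot_mem_tangent hrot h4 (hT c h1 h2) s)]
    refine (ContinuousLinearMap.le_opNorm _ _).trans ?_
    rw [norm_rot]
    have h5 := hK _ (hrot s _ h4)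
    exact mul_le_mul h5 h3.le (norm_nonneg _) ((norm_nonneg _).trans h5)
  · refine Eventually.of_forall fun s _ c ⟨h1, h2, h3⟩ => ?_
    exact hf.comp_hasDerivAt (hrotd s c h1) (hrotM s c h2)

/-- The flux of a divergence-free field through the parallels vanishes. -/
theorem IsOval.orbitIntegral_inner_Y (hO : O.IsOval) {φ : E3 → E3}
    (hφ : O.IsSmoothTangentField φ) (hdiv : ∀ x ∈ O.surface, O.div φ x = 0) {x : E3}
    (hx : x ∈ O.surface) : orbitIntegral (fun y => inner ℝ (φ y) (O.Y y)) x = 0 := by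
  have hrot := hO.rot
  set f : E3 → ℝ := fun y => inner ℝ (φ y) (O.Y y) with hf
  have hfs : O.SmoothOn f := hφ.1.inner smoothOn_Y
  obtain ⟨N, S, hP⟩ := hO.exists_poles
  have hA : ∀ s, ∀ x ∈ O.surface, orbitIntegral f (_root_.rot s x) = orbitIntegral f x :=
    fun s x _ => orbitIntegral_rot f s x
  set q := O.heightFun (orbitIntegral f) with hq
  have hqx : ∀ x ∈ O.surface, q (x 2) = orbitIntegral f x := fun x hx => hO.heightFun_apply hA hx
  have hqc : ContinuousOn q (Icc (S 2) (N 2)) :=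
    hO.continuousOn_heightFun hA (continuousOn_orbitIntegral hrot hfs.continuousOn) hP
  have hder : ∀ c ∈ Ioo (S 2) (N 2), HasDerivAt q 0 c := by
    intro c hc
    obtain ⟨y, hy, rfl⟩ := hP.exists_height c (Ioo_subset_Icc_self hc)
    have hr := hP.rsq_pos hy hc.1 hc.2
    obtain ⟨m, hm0, hm, hmM⟩ := hO.exists_meridian hy hr
    have h1 := hasDerivAt_orbitIntegral hrot hfs hm (hmM.mono fun _ h => h.1)
    have h2 : q =ᶠ[𝓝 (y 2)] fun c => orbitIntegral f (m c) := by
      filter_upwards [hmM] with c hc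
      rw [← hqx _ hc.1, hc.2]
    refine (h1.congr_of_eventuallyEq h2).congr_deriv ?_
    rw [hm0]
    set v := deriv m (y 2) with hv
    have hvT : v ∈ O.tangent y := by
      have hmd : DifferentiableAt ℝ m (y 2) := hm.differentiableAt (by simp)
      have h3 := deriv_mem_tangent hmd.hasDerivAt (hmM.mono fun _ h => h.1)
      rwa [hm0] at h3
    have hve := norm_sq_smul_eq hrot hy hvT
    have hfX := integral_fderivWithin_X₃_rot hrot hfs hy
    have hφX := integral_fderivWithin_X₃_rot hrot (hφ.1.inner smoothOn_X₃) hy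
    -- Split the meridian velocity in the frame. Zero divergence replaces Y⟨φ, Y⟩ by -X⟨φ, X⟩, so
    -- only derivatives along X remain, and these integrate to zero over the orbit.
    have hpt : ∀ s, fderivWithin ℝ f O.surface (_root_.rot s y) (_root_.rot s v) =
        (inner ℝ v (X₃ y) / rsq y) *
          fderivWithin ℝ f O.surface (_root_.rot s y) (X₃ (_root_.rot s y)) -
        (inner ℝ v (O.Y y) / rsq y) * fderivWithin ℝ (fun y => inner ℝ (φ y) (X₃ y)) O.surface
          (_root_.rot s y) (X₃ (_root_.rot s y)) := by
      intro s
      have hys := hrot s y hy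
      have h3 := congrArg (rotE s) hve
      simp only [map_smul, map_add, rotE_apply, rot_X₃] at h3
      rw [← Y_equivariant hrot s y hy] at h3
      have h4 := congrArg (fderivWithin ℝ f O.surface (_root_.rot s y)) h3
      simp only [map_smul, map_add, smul_eq_mul] at h4
      rw [fderivWithin_inner_Y hrot hφ hys (hdiv _ hys)] at h4
      apply mul_left_cancel₀ hr.ne'
      rw [h4]
      field_simp
      ring
    have hcX : ∀ g : E3 → ℝ, O.SmoothOn g → Continuous fun s =>
        fderivWithin ℝ g O.surface (_root_.rot s y) (X₃ (_root_.rot s y)) := by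
      intro g hg
      have h1 : ContinuousOn (fun x => O.tderiv g x (X₃ x)) O.surface :=
        hg.tderiv.continuousOn.clm_apply contDiff_X₃.continuous.continuousOn
      refine (continuous_comp_rot hrot h1 hy).congr fun s => ?_
      rw [tderiv_apply_of_mem (X₃_mem_tangent hrot (hrot s y hy))]
    simp only [hpt]
    rw [intervalIntegral.integral_sub (((hcX f hfs).intervalIntegrable _ _).const_mul _)
      (((hcX _ (hφ.1.inner smoothOn_X₃)).intervalIntegrable _ _).const_mul _),
      intervalIntegral.integral_const_mul, intervalIntegral.integral_const_mul, hfX, hφX]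
    simp
  -- At a pole the parallel degenerates to a point and Y vanishes.
  have hqN : q (N 2) = 0 := by
    rw [hqx N hP.north_mem, orbitIntegral]
    have : ∀ s, f (_root_.rot s N) = 0 := fun s => by
      have h1 : X₃ (_root_.rot s N) = 0 := X₃_eq_zero (by rw [rsq_rot, hP.north_axis])
      have h2 : O.Y (_root_.rot s N) = 0 := by
        rw [Y, h1]; exact (crossL _).map_zero
      simp [hf, h2]
    simp [this]
  rw [← hqx x hx]
  rcases (hP.le_north x hx).eq_or_lt with h | h
  · rw [h, hqN]
  obtain ⟨c, hc, hslope⟩ := exists_hasDerivAt_eq_slope q (fun _ => 0) h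
    (hqc.mono (Icc_subset_Icc_left (hP.south_le x hx)))
    fun c hc => hder c ⟨(hP.south_le x hx).trans_lt hc.1, hc.2⟩
  rw [hqN, eq_comm, div_eq_zero_iff] at hslope
  rcases hslope with h1 | h1
  · linarith
  · linarith

/-- Average the integral over all rotations: as h, w and the area are invariant, the average falls
on F alone by Fubini and vanishes on every orbit. The bound makes F/w bounded, including where w =
0, as the quotient is then 0. -/
theorem integral_mul_div_eq_zero_of_measurable (hrot : O.IsRotationInvariant) {h F w : E3 → ℝ}
    (hh : Integrable h O.area) (hinv : ∀ s, ∀ᵐ x ∂O.area, h (rot s x) = h x)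
    (hF : Measurable F) (hw : Measurable w) (hw0 : ∀ x, 0 ≤ w x)
    (hwrot : ∀ s x, w (rot s x) = w x) {C : ℝ} (hC : 0 ≤ C) (hb : ∀ x, |F x| ≤ C * w x)
    (hav : ∀ x ∈ O.surface, orbitIntegral F x = 0) :
    ∫ x, h x * (F x / w x) ∂O.area = 0 := by
  have hGb : ∀ x, ‖F x / w x‖ ≤ C := fun x => by
    rw [Real.norm_eq_abs, abs_div, abs_of_nonneg (hw0 x)]
    exact div_le_of_le_mul₀ (hw0 x) hC (hb x)
  have hrotm : Measurable fun z : ℝ × E3 => rot z.1 z.2 := contDiff_rot.continuous.measurable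
  have hint : Integrable (fun z : ℝ × E3 => h z.2 * (F (rot z.1 z.2) / w (rot z.1 z.2)))
      ((volume.restrict (Ioc 0 (2 * Real.pi))).prod O.area) :=
    (hh.comp_snd _).mul_bdd (c := C) (((hF.div hw).comp hrotm).aestronglyMeasurable)
      (Eventually.of_forall fun z => hGb _)
  have hswap := integral_integral_swap (f := fun (s : ℝ) x =>
    h x * (F (rot s x) / w (rot s x))) hint
  have h1 : ∀ s, ∫ x, h x * (F (rot s x) / w (rot s x)) ∂O.area =
      ∫ x, h x * (F x / w x) ∂O.area := by
    intro s
    rw [← integral_comp_rot hrot s fun x => h x * (F x / w x)]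
    refine integral_congr_ae ?_
    filter_upwards [hinv s] with x hx
    rw [hx]
  have h2 : ∀ᵐ x ∂O.area, ∫ s in Ioc 0 (2 * Real.pi), h x * (F (rot s x) / w (rot s x)) = 0 := by
    filter_upwards [O.ae_mem_surface] with x hx
    have h3 := hav x hx
    rw [orbitIntegral, intervalIntegral.integral_of_le (by positivity)] at h3
    simp only [hwrot]
    rw [integral_const_mul, integral_div, h3, zero_div, mul_zero]
  simp only [h1] at hswap
  rw [integral_congr_ae h2, integral_zero, integral_const, smul_eq_mul] at hswap
  -- The factor is the length 2π of the range of angles.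
  refine (mul_eq_zero.1 hswap).resolve_left ?_
  simp [Real.pi_pos.le, Real.pi_ne_zero, Measure.real]

/-- Replacing F by zero off M makes it globally measurable, as Fubini requires, without changing any
of the integrals. -/
theorem integral_mul_div_eq_zero (hrot : O.IsRotationInvariant) {h F w : E3 → ℝ}
    (hh : Integrable h O.area) (hinv : ∀ s, ∀ᵐ x ∂O.area, h (rot s x) = h x)
    (hF : ContinuousOn F O.surface) (hw : Measurable w) (hw0 : ∀ x, 0 ≤ w x)
    (hwrot : ∀ s x, w (rot s x) = w x) {C : ℝ} (hC : 0 ≤ C)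
    (hb : ∀ x ∈ O.surface, |F x| ≤ C * w x) (hav : ∀ x ∈ O.surface, orbitIntegral F x = 0) :
    ∫ x, h x * (F x / w x) ∂O.area = 0 := by
  classical
  have hmeas : Measurable (O.surface.piecewise F fun _ => 0) :=
    hF.measurable_piecewise continuousOn_const isClosed_frontier.measurableSet
  have heq : ∀ x ∈ O.surface, O.surface.piecewise F (fun _ => 0) x = F x := fun x hx =>
    piecewise_eq_of_mem _ _ _ hx
  rw [← integral_mul_div_eq_zero_of_measurable hrot hh hinv hmeas hw hw0 hwrot hC ?_ ?_]
  · refine integral_congr_ae ?_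
    filter_upwards [O.ae_mem_surface] with x hx
    rw [heq x hx]
  · intro x
    by_cases hx : x ∈ O.surface
    · rw [heq x hx]; exact hb x hx
    · rw [piecewise_eq_of_notMem _ _ _ hx, abs_zero]; exact mul_nonneg hC (hw0 x)
  · intro x hx
    refine Eq.trans ?_ (hav x hx)
    exact intervalIntegral.integral_congr fun s _ => heq _ (hrot s x hx)

end SmoothDomain

/-! ### Stationary solutions -/

namespace SmoothDomain

variable {O : SmoothDomain}

theorem norm_Y_le {x : E3} (hx : x ∈ O.surface) : ‖O.Y x‖ ≤ ‖X₃ x‖ := by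
  simpa [Y, J, norm_normal hx] using norm_cross_le (O.normal x) (X₃ x)

theorem orbitIntegral_chi_mul (hrot : O.IsRotationInvariant) (f : E3 → ℝ) {x : E3}
    (hx : x ∈ O.surface) :
    orbitIntegral (fun y => O.chi y * f y) x = O.chi x * orbitIntegral f x := by
  simp only [orbitIntegral, chi_rot hrot _ hx, intervalIntegral.integral_const_mul]

theorem IsOval.integral_inner_chi_J (hO : O.IsOval) {u : O.tangentL2} (hu : u ∈ O.V)
    (hB : O.B u = 0) {φ : E3 → E3} (hφ : O.IsSmoothTangentField φ)
    (hdiv : ∀ x ∈ O.surface, O.div φ x = 0) :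
    ∫ x, inner ℝ (O.chi x • O.J x ((u : Lp E3 2 O.area) x)) (φ x) ∂O.area = 0 := by
  have hrot := hO.rot
  set g : E3 → ℝ := fun x => inner ℝ (X₃ x) ((u : Lp E3 2 O.area) x) with hg
  have hgi : Integrable g O.area :=
    integrable_inner_of_continuousOn contDiff_X₃.continuous.continuousOn u
  have hXm : Measurable fun x => ‖X₃ x‖ := contDiff_X₃.continuous.norm.measurable
  have hXrot : ∀ s x, ‖X₃ (_root_.rot s x)‖ = ‖X₃ x‖ := fun s x => by rw [← rot_X₃, norm_rot]
  -- The integrand is (⟨X, u⟩/|X|) · (χ⟨φ, Y⟩/|X|): the first factor is at most |u|, and the second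
  -- is bounded because |Y| ≤ |X|.
  have hh : Integrable (fun x => g x / ‖X₃ x‖) O.area := by
    have hui : Integrable (fun x => ‖(u : Lp E3 2 O.area) x‖) O.area :=
      ((Lp.memLp (u : Lp E3 2 O.area)).integrable one_le_two).norm
    refine hui.mono' (hgi.aestronglyMeasurable.aemeasurable.div
      hXm.aemeasurable).aestronglyMeasurable (Eventually.of_forall fun x => ?_)
    rw [norm_div, norm_norm]
    exact div_le_of_le_mul₀ (norm_nonneg _) (norm_nonneg _)
      ((norm_inner_le_norm _ _).trans_eq (mul_comm _ _))
  obtain ⟨K, hK⟩ := O.isCompact_surface.exists_bound_of_continuousOn hφ.1.continuousOn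
  have hFc : ContinuousOn (fun x => O.chi x * inner ℝ (φ x) (O.Y x)) O.surface :=
    (smoothOn_chi (O := O)).continuousOn.mul (hφ.1.inner smoothOn_Y).continuousOn
  have h := integral_mul_div_eq_zero (C := max K 0) hrot hh (fun s => ?_) hFc hXm
    (fun x => norm_nonneg _) hXrot (le_max_right _ _) (fun x hx => ?_) (fun x hx => ?_)
  · rw [← h]
    refine integral_congr_ae ?_
    filter_upwards [hO.ae_inner_Y hu hB, hO.ae_rsq_pos, O.ae_mem_surface, ae_mem_tangent u]
      with x h1 h2 h3 h4
    have h5 := norm_sq_smul_eq hrot h3 h4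
    rw [h1, zero_smul, add_zero, real_inner_comm] at h5
    have h6 := congrArg (fun v => inner ℝ (O.J x v) (φ x)) h5
    simp only [J, cross_smul_right, real_inner_smul_left] at h6
    have h7 : cross (O.normal x) (X₃ x) = O.Y x := rfl
    rw [h7] at h6
    rw [real_inner_smul_left, J, div_mul_div_comm, ← sq, norm_X₃_sq, eq_div_iff h2.ne',
      real_inner_comm (O.Y x) (φ x)]
    simp only [hg]
    linear_combination O.chi x * h6
  · filter_upwards [hO.ae_inner_X₃_rot hu hB s] with x hx
    simp only [hg, hx, hXrot]
  · rw [abs_mul]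
    calc |O.chi x| * |inner ℝ (φ x) (O.Y x)| ≤ 1 * (‖φ x‖ * ‖O.Y x‖) :=
          mul_le_mul (abs_chi_le hx) (abs_real_inner_le_norm _ _) (abs_nonneg _) zero_le_one
      _ ≤ max K 0 * ‖X₃ x‖ := by
          rw [one_mul]
          exact mul_le_mul ((hK x hx).trans (le_max_left _ _)) (norm_Y_le hx) (norm_nonneg _)
            (le_max_right _ _)
  · rw [orbitIntegral_chi_mul hrot _ hx, hO.orbitIntegral_inner_Y hφ hdiv hx, mul_zero]

theorem IsOval.integral_inner_covDeriv (hO : O.IsOval) {u : O.tangentL2} (hu : u ∈ O.V)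
    (hB : O.B u = 0) {φ : E3 → E3} (hφ : O.IsSmoothTangentField φ)
    (hdiv : ∀ x ∈ O.surface, O.div φ x = 0) :
    ∫ x, inner ℝ ((u : Lp E3 2 O.area) x) (O.covDeriv φ x ((u : Lp E3 2 O.area) x)) ∂O.area =
      0 := by
  have hrot := hO.rot
  set g : E3 → ℝ := fun x => inner ℝ (X₃ x) ((u : Lp E3 2 O.area) x) with hg
  have hgi : Integrable g O.area :=
    integrable_inner_of_continuousOn contDiff_X₃.continuous.continuousOn u
  have hrm : Measurable rsq := contDiff_rsq.continuous.measurable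
  -- The integrand is (⟨X, u⟩²/r²) · (⟨D_X φ, X⟩/r²): the first factor is at most |u|², and the
  -- second is bounded by the derivative of φ.
  have hh : Integrable (fun x => g x ^ 2 / rsq x) O.area := by
    have hui : Integrable (fun x => ‖(u : Lp E3 2 O.area) x‖ ^ 2) O.area :=
      (Lp.memLp (u : Lp E3 2 O.area)).norm.integrable_sq
    refine hui.mono' ((hgi.aestronglyMeasurable.aemeasurable.pow_const 2).div
      hrm.aemeasurable).aestronglyMeasurable (Eventually.of_forall fun x => ?_)
    rw [Real.norm_eq_abs, abs_of_nonneg (div_nonneg (sq_nonneg _) (rsq_nonneg x))]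
    refine div_le_of_le_mul₀ (rsq_nonneg x) (sq_nonneg _) ?_
    rw [← norm_X₃_sq, ← mul_pow, ← sq_abs]
    exact pow_le_pow_left₀ (abs_nonneg _)
      ((abs_real_inner_le_norm _ _).trans_eq (mul_comm _ _)) 2
  obtain ⟨K, hK⟩ := exists_tderiv_bound hφ.1
  have hFc : ContinuousOn (fun x => inner ℝ (O.tderiv φ x (X₃ x)) (X₃ x)) O.surface :=
    (hφ.1.tderiv.continuousOn.clm_apply contDiff_X₃.continuous.continuousOn).inner
      contDiff_X₃.continuous.continuousOn
  have h := integral_mul_div_eq_zero (C := max K 0) hrot hh (fun s => ?_) hFc hrm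
    rsq_nonneg rsq_rot (le_max_right _ _) (fun x hx => ?_) (fun x hx => ?_)
  · rw [← h]
    refine integral_congr_ae ?_
    filter_upwards [hO.ae_inner_Y hu hB, hO.ae_rsq_pos, O.ae_mem_surface, ae_mem_tangent u]
      with x h1 h2 h3 h4
    have h5 := norm_sq_smul_eq hrot h3 h4
    rw [h1, zero_smul, add_zero, real_inner_comm] at h5
    have h6 := congrArg (fun v => inner ℝ v (O.tderiv φ x v)) h5
    simp only [map_smul, real_inner_smul_left, real_inner_smul_right] at h6
    rw [covDeriv_eq h4, real_inner_comm, inner_starProjection_left h4, real_inner_comm,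
      div_mul_div_comm, eq_div_iff (mul_pos h2 h2).ne',
      real_inner_comm (X₃ x) (O.tderiv φ x (X₃ x))]
    simp only [hg]
    linear_combination h6
  · filter_upwards [hO.ae_inner_X₃_rot hu hB s] with x hx
    simp only [hg, hx, rsq_rot]
  · rw [← norm_X₃_sq, sq, ← mul_assoc]
    refine (abs_real_inner_le_norm _ _).trans (mul_le_mul_of_nonneg_right ?_ (norm_nonneg _))
    exact (ContinuousLinearMap.le_opNorm _ _).trans
      (mul_le_mul_of_nonneg_right ((hK x hx).trans (le_max_left _ _)) (norm_nonneg _))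
  · have h1 := integral_fderivWithin_X₃_rot hrot (hφ.1.inner smoothOn_X₃) hx
    have h2 := orbitIntegral_chi_mul hrot (fun y => inner ℝ (φ y) (O.Y y)) hx
    rw [hO.orbitIntegral_inner_Y hφ hdiv hx, mul_zero] at h2
    -- ⟨D_X φ, X⟩ = X⟨φ, X⟩ - χ⟨φ, Y⟩: the first term integrates to zero over the orbit, the second
    -- is χ times a vanishing flux.
    have hpt : ∀ s, inner ℝ (O.tderiv φ (_root_.rot s x) (X₃ (_root_.rot s x)))
          (X₃ (_root_.rot s x)) =
        fderivWithin ℝ (fun y => inner ℝ (φ y) (X₃ y)) O.surface (_root_.rot s x)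
          (X₃ (_root_.rot s x)) -
        O.chi (_root_.rot s x) * inner ℝ (φ (_root_.rot s x)) (O.Y (_root_.rot s x)) := by
      intro s
      have hxs := hrot s x hx
      rw [fderivWithin_inner_X₃ hrot hφ hxs, tderiv_apply_of_mem (X₃_mem_tangent hrot hxs),
        real_inner_comm (φ _) (O.Y _)]
      ring
    have hc1 : Continuous fun s => O.chi (_root_.rot s x) *
        inner ℝ (φ (_root_.rot s x)) (O.Y (_root_.rot s x)) :=
      continuous_comp_rot hrot ((smoothOn_chi (O := O)).continuousOn.mul
        (hφ.1.inner smoothOn_Y).continuousOn) hx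
    have hc2 : Continuous fun s => fderivWithin ℝ (fun y => inner ℝ (φ y) (X₃ y)) O.surface
        (_root_.rot s x) (X₃ (_root_.rot s x)) := by
      refine ((continuous_comp_rot hrot hFc hx).add hc1).congr fun s => ?_
      simp only [Pi.add_apply, hpt]; ring
    simp only [orbitIntegral, hpt]
    rw [intervalIntegral.integral_sub (hc2.intervalIntegrable _ _) (hc1.intervalIntegrable _ _),
      h1, zero_sub, neg_eq_zero]
    exact h2

/-- Smooth representatives of fields in `V ∩ Ker B` are zonal flows. -/
theorem IsOval.isEquivariant_of_ae_eq (hO : O.IsOval) {u : O.tangentL2} (hu : u ∈ O.V)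
    (hB : O.B u = 0) {v : E3 → E3} (hv : O.IsSmoothTangentField v)
    (huv : ((u : Lp E3 2 O.area) : E3 → E3) =ᵐ[O.area] v) :
    (∀ x ∈ O.surface, inner ℝ (v x) (O.Y x) = 0) ∧ O.IsEquivariant v := by
  have hrot := hO.rot
  have hY : ∀ x ∈ O.surface, inner ℝ (v x) (O.Y x) = 0 := by
    refine eqOn_of_ae_eq (hv.1.inner smoothOn_Y).continuousOn continuousOn_const ?_
    filter_upwards [hO.ae_inner_Y hu hB, huv] with x h1 h2
    rw [← h2, h1]
  refine ⟨hY, fun s => ?_⟩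
  have hrc : Continuous (_root_.rot s) := (rotE s).continuous
  refine eqOn_of_ae_eq (hv.1.continuousOn.comp hrc.continuousOn fun x hx => hrot s x hx)
    (hrc.comp_continuousOn hv.1.continuousOn) ?_
  filter_upwards [hO.ae_inner_X₃_rot hu hB s, huv,
    (measurePreserving_rot hrot s).quasiMeasurePreserving.ae huv, hO.ae_rsq_pos,
    O.ae_mem_surface] with x h1 h2 h3 h4 h5
  -- Off the poles v is determined by ⟨v, X⟩ because ⟨v, Y⟩ = 0, so invariance of ⟨v, X⟩ and
  -- equivariance of X give that of v.
  rw [h2, h3] at h1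
  have h6 := norm_sq_smul_eq hrot (hrot s x h5) (hv.2 _ (hrot s x h5))
  have h7 := congrArg (rotE s) (norm_sq_smul_eq hrot h5 (hv.2 x h5))
  rw [hY _ (hrot s x h5), zero_smul, add_zero, rsq_rot, real_inner_comm, h1] at h6
  rw [hY x h5, zero_smul, add_zero, map_smul, map_smul, rotE_apply, rotE_apply, rot_X₃,
    real_inner_comm, ← h6] at h7
  exact (smul_right_injective E3 h4.ne' h7).symm

end SmoothDomain

theorem proposition3p1p1 (O : SmoothDomain) (hconn : IsConnected O.surface)
    (hrot : O.IsRotationInvariant) (hK : ∀ x ∈ O.surface, 0 < O.gaussCurvature x) :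
    (∀ f : E3 → ℝ, O.IsZonal f → ∀ Ω : ℝ,
      O.IsStationarySolution Ω (fun x => O.J x (O.grad f x))) ∧
    (∀ u : O.tangentL2, u ∈ O.V → O.B u = 0 → ∀ Ω : ℝ,
      O.IsStationaryWeakSolution Ω u ∧
      ∀ v : E3 → E3, O.IsSmoothTangentField v →
        ((u : Lp E3 2 O.area) : E3 → E3) =ᵐ[O.area] v → O.IsStationarySolution Ω v) := by
  have hO : O.IsOval := ⟨hconn, hrot, hK⟩
  refine ⟨fun f hf Ω => hO.isStationarySolution_of_isZonal hf Ω, fun u hu hB Ω =>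
    ⟨⟨hu, fun φ hφ hdiv => ?_⟩, fun v hv huv => ?_⟩⟩
  · rw [hO.integral_inner_covDeriv hu hB hφ hdiv, hO.integral_inner_chi_J hu hB hφ hdiv, neg_zero,
      mul_zero]
  · obtain ⟨h1, h2⟩ := hO.isEquivariant_of_ae_eq hu hB hv huv
    exact hO.isStationarySolution hv h1 h2 Ω
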